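/- Let $1<\alpha<2$, $x_L<x_R$, $T>0$, and let $u$ be the exact (classical) solution of $$u_t=d_+(x)\,{}_{x_L}D_x^{\alpha}u+d_-(x)\,{}_xD_{x_R}^{\alpha}u+f(x,t),\quad x\in(x_L,x_R),\ t\in(0,T],$$ with $u(x_L,t)=u(x_R,t)=0$ for $t\in[0,T]$ and $u(x,0)=\varphi(x)$ for $x\in[x_L,x_R]$, where $u(\cdot,t)$ is continuous on $[x_L,x_R]$ for each $t\in[0,T]$ and $${}_{x_L}D_x^{\alpha}v(x)=\frac{1}{\Gamma(2-\alpha)}\frac{d^2}{dx^2}\int_{x_L}^x\frac{v(\xi)}{(x-\xi)^{\alpha-1}}d\xi,\qquad {}_xD_{x_R}^{\alpha}v(x)=\frac{1}{\Gamma(2-\alpha)}\frac{d^2}{dx^2}\int_x^{x_R}\frac{v(\xi)}{(\xi-x)^{\alpha-1}}d\xi .$$ Smoothness. For every $t\in[0,T]$ the extension $\tilde u(\cdot,t)$ of $u(\cdot,t)$ by zero to $\mathbb R$ is in $L^1(\mathbb R)$; the integrals $\int_{-\infty}^x\tilde u(\xi,t)(x-\xi)^{1-\alpha}d\xi$ and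 $\int_x^{\infty}\tilde u(\xi,t)(\xi-x)^{1-\alpha}d\xi$ are $C^4$ functions of $x\in\mathbb R$; their fourth derivatives divided by $\Gamma(2-\alpha)$, i.e. the left and right Riemann–Liouville derivatives ${}_{-\infty}D_x^{\alpha+2}\tilde u$ and ${}_xD_\infty^{\alpha+2}\tilde u$, and their Fourier transforms are in $L^1(\mathbb R)$, and the $L^1$ norms of these Fourier transforms are bounded uniformly in $t\in[0,T]$. For every $x\in(x_L,x_R)$, $u(x,\cdot)$ is $C^3$ and $f(x,\cdot)$ is $C^2$ on $[0,T]$, with $\partial_t^3u$ and $\partial_t^2f$ bounded on $(x_L,x_R)\times[0,T]$. Coefficients. There are constants $0<\delta\le\Delta$ with $\delta\le d_+\le\Delta$ on $[x_L,x_R]$; the ratio $\tilde d=d_- /d_+$ satisfies $0\le\kappa_{\min}\le\tilde d\le\kappa_{\max}<\infty$ on $[x_L,x_R]$, it is concave or convex there, and $$1+\kappa-\frac{\sqrt2(\kappa_{\max}-\kappa_{\min})}{\varsigma_\alpha}\ge0,$$ where $\kappa=\kappa_{\max}$ if $\tilde d$ is concave and $\kappa=\kappa_{\min}$ if $\tilde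 d$ is convex. Here $\varsigma_\alpha=\inf\{\mathrm{Re}(-g(\alpha,x))/|g(\alpha,x)| : x\in[-\pi,\pi],\ g(\alpha,x)\ne0\}$ with $g(\alpha,x)=\sum_{k\ge0}w_ke^{\mathbf i(k-1)x}$, $w_0=\frac\alpha2 g_0$, $w_k=\frac\alpha2g_k+\frac{2-\alpha}2g_{k-1}$ for $k\ge1$, and $g_0=1$, $g_k=(1-\frac{\alpha+1}k)g_{k-1}$. Scheme. For positive integers $M,N$ let $h=(x_R-x_L)/M$, $\tau=T/N$, $x_i=x_L+ih$, $t_n=n\tau$. Let $W$ be the $(M-1)\times(M-1)$ matrix with entries $W_{ij}=w_{i-j+1}$ for $j\le i+1$ and $W_{ij}=0$ otherwise, $D_\pm=\mathrm{diag}(d_\pm(x_1),\dots,d_\pm(x_{M-1}))$, $A=D_+W+D_-W^T$ and $\nu=\tau/(2h^\alpha)$. Let $u^n=(u_1^n,\dots,u_{M-1}^n)^T$ satisfy $u_i^0=\varphi(x_i)$ and $$(I-\nu A)u^{n+1}=(I+\nu A)u^n+\tau f^{n+1/2},\qquad f^{n+1/2}_i=f(x_i,(n+\tfrac12)\tau),\quad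 0\le n\le N-1.$$ Then there is a constant $c_2>0$, independent of $M$, $N$ and $n$, such that for all positive integers $M,N$ and all $0\le n\le N$ the errors $e^n_i=u(x_i,t_n)-u^n_i$, $1\le i\le M-1$, satisfy $$\|e^n\|^2\le c_2(\tau^2+h^2)^2,\qquad \|v\|=\sqrt{h\,v^Tv}.$$ -/

import Mathlib

open MeasureTheory Set
open scoped FourierTransform Matrix

noncomputable section

namespace WSGD

/-! ### Riemann-Liouville derivatives -/

/-- The integral `∫_{a}^{x} v(ξ) / (x - ξ)^(α-1) dξ`. -/
def leftKernelIntegral (a α : ℝ) (v : ℝ → ℝ) (x : ℝ) : ℝ :=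
  ∫ ξ in a..x, v ξ / (x - ξ) ^ (α - 1)

/-- The integral `∫_{x}^{b} v(ξ) / (ξ - x)^(α-1) dξ`. -/
def rightKernelIntegral (b α : ℝ) (v : ℝ → ℝ) (x : ℝ) : ℝ :=
  ∫ ξ in x..b, v ξ / (ξ - x) ^ (α - 1)

/-- The left Riemann-Liouville derivative of order `α ∈ (1,2)` based at `a`. -/
def leftRL (a α : ℝ) (v : ℝ → ℝ) (x : ℝ) : ℝ :=
  1 / Real.Gamma (2 - α) * iteratedDeriv 2 (leftKernelIntegral a α v) x

/-- The right Riemann-Liouville derivative of order `α ∈ (1,2)` based at `b`. -/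
def rightRL (b α : ℝ) (v : ℝ → ℝ) (x : ℝ) : ℝ :=
  1 / Real.Gamma (2 - α) * iteratedDeriv 2 (rightKernelIntegral b α v) x

/-- The integral `∫_{-∞}^{x} v(ξ) / (x - ξ)^(α-1) dξ`. -/
def leftKernelIntegralLine (α : ℝ) (v : ℝ → ℝ) (x : ℝ) : ℝ :=
  ∫ ξ in Iic x, v ξ / (x - ξ) ^ (α - 1)

/-- The integral `∫_{x}^{∞} v(ξ) / (ξ - x)^(α-1) dξ`. -/
def rightKernelIntegralLine (α : ℝ) (v : ℝ → ℝ) (x : ℝ) : ℝ :=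
  ∫ ξ in Ici x, v ξ / (ξ - x) ^ (α - 1)

/-- The left Riemann-Liouville derivative of order `α + 2 ∈ (3,4)` on the whole line; here
`4 = ⌈α + 2⌉` and `4 - (α + 2) = 2 - α`. -/
def leftRLLine (α : ℝ) (v : ℝ → ℝ) (x : ℝ) : ℝ :=
  1 / Real.Gamma (2 - α) * iteratedDeriv 4 (leftKernelIntegralLine α v) x

/-- The right Riemann-Liouville derivative of order `α + 2 ∈ (3,4)` on the whole line (the sign
`(-1)^4` is `1`). -/
def rightRLLine (α : ℝ) (v : ℝ → ℝ) (x : ℝ) : ℝ :=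
  1 / Real.Gamma (2 - α) * iteratedDeriv 4 (rightKernelIntegralLine α v) x

/-! ### The fractional diffusion equation -/

/-- `u` is a classical solution, on `[xL, xR] × [0, T]`, of
`u_t = dp · (left RL derivative of u) + dm · (right RL derivative of u) + f`
with homogeneous Dirichlet data and initial value `φ`. The fields `left_exists` and
`right_exists` say that the fractional derivatives exist. -/
structure IsExactSolution (α xL xR T : ℝ) (dp dm : ℝ → ℝ) (f : ℝ → ℝ → ℝ) (φ : ℝ → ℝ)
    (u : ℝ → ℝ → ℝ) : Prop where
  continuous_space : ∀ t ∈ Icc 0 T, ContinuousOn (fun x => u x t) (Icc xL xR)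
  left_exists : ∀ t ∈ Ioc 0 T, ∀ x ∈ Ioo xL xR,
    ContDiffAt ℝ 2 (leftKernelIntegral xL α (fun ξ => u ξ t)) x
  right_exists : ∀ t ∈ Ioc 0 T, ∀ x ∈ Ioo xL xR,
    ContDiffAt ℝ 2 (rightKernelIntegral xR α (fun ξ => u ξ t)) x
  equation : ∀ t ∈ Ioc 0 T, ∀ x ∈ Ioo xL xR,
    HasDerivWithinAt (fun s => u x s)
      (dp x * leftRL xL α (fun ξ => u ξ t) x + dm x * rightRL xR α (fun ξ => u ξ t) x + f x t)
      (Icc 0 T) t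
  boundary_left : ∀ t ∈ Icc 0 T, u xL t = 0
  boundary_right : ∀ t ∈ Icc 0 T, u xR t = 0
  initial : ∀ x ∈ Icc xL xR, u x 0 = φ x

/-- Extension by zero of a function outside `[xL, xR]`. -/
def zeroExt (xL xR : ℝ) (v : ℝ → ℝ) : ℝ → ℝ := (Icc xL xR).indicator v

/-- The spatial smoothness under which the difference formulas are of second order: `v` is in
`L¹(ℝ)`, and its two Riemann-Liouville derivatives of order `α + 2` exist and belong to `L¹(ℝ)`
together with their Fourier transforms; `K` bounds the `L¹` norms of the Fourier transforms. -/
structure SpaceSmooth (α K : ℝ) (v : ℝ → ℝ) : Prop where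
  integrable : Integrable v
  left_contDiff : ContDiff ℝ 4 (leftKernelIntegralLine α v)
  left_integrable : Integrable (leftRLLine α v)
  left_fourier_integrable : Integrable (𝓕 (fun x => (leftRLLine α v x : ℂ)))
  left_fourier_bound : ∫ ω, ‖𝓕 (fun x => (leftRLLine α v x : ℂ)) ω‖ ≤ K
  right_contDiff : ContDiff ℝ 4 (rightKernelIntegralLine α v)
  right_integrable : Integrable (rightRLLine α v)
  right_fourier_integrable : Integrable (𝓕 (fun x => (rightRLLine α v x : ℂ)))
  right_fourier_bound : ∫ ω, ‖𝓕 (fun x => (rightRLLine α v x : ℂ)) ω‖ ≤ K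

/-- The time smoothness of order `m`: for every interior `x` the function `v(x, ·)` is `C^m` on
`[0, T]`, and its `m`-th derivative is bounded by `K`. -/
structure TimeSmooth (xL xR T : ℝ) (m : ℕ) (K : ℝ) (v : ℝ → ℝ → ℝ) : Prop where
  contDiffOn : ∀ x ∈ Ioo xL xR, ContDiffOn ℝ m (fun t => v x t) (Icc 0 T)
  bound : ∀ x ∈ Ioo xL xR, ∀ t ∈ Icc 0 T,
    |iteratedDerivWithin m (fun s => v x s) (Icc 0 T) t| ≤ K

/-! ### The difference scheme -/

/-- The coefficients of the power series of `(1 - z)^α`. -/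
def gCoeff (α : ℝ) : ℕ → ℝ
  | 0 => 1
  | k + 1 => (1 - (α + 1) / ((k : ℝ) + 1)) * gCoeff α k

/-- The weights of the second order weighted and shifted Grünwald-Letnikov formula with shifts
`(1, 0)`. -/
def weight (α : ℝ) : ℕ → ℝ
  | 0 => α / 2 * gCoeff α 0
  | k + 1 => α / 2 * gCoeff α (k + 1) + (2 - α) / 2 * gCoeff α k

/-- The Toeplitz matrix with entries `w_{i-j+1}` (zero above the first superdiagonal). -/
def toeplitzW (α : ℝ) (m : ℕ) : Matrix (Fin m) (Fin m) ℝ :=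
  Matrix.of fun i j => if (j : ℕ) ≤ (i : ℕ) + 1 then weight α ((i : ℕ) + 1 - (j : ℕ)) else 0

/-- The mesh size `h = (xR - xL) / M`. -/
def meshSize (xL xR : ℝ) (M : ℕ) : ℝ := (xR - xL) / M

/-- The time step `τ = T / N`. -/
def timeStep (T : ℝ) (N : ℕ) : ℝ := T / N

/-- The interior grid points `x_1, …, x_{M-1}`, where `x_i = xL + i h`; the index `i : Fin (M - 1)`
stands for `x_{i+1}`. -/
def gridPoint (xL xR : ℝ) (M : ℕ) (i : Fin (M - 1)) : ℝ :=
  xL + ((i : ℕ) + 1 : ℝ) * meshSize xL xR M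

/-- The matrix `A = D₊ W + D₋ Wᵀ`. -/
def diffMatrix (α xL xR : ℝ) (dp dm : ℝ → ℝ) (M : ℕ) : Matrix (Fin (M - 1)) (Fin (M - 1)) ℝ :=
  Matrix.diagonal (fun i => dp (gridPoint xL xR M i)) * toeplitzW α (M - 1) +
    Matrix.diagonal (fun i => dm (gridPoint xL xR M i)) * (toeplitzW α (M - 1))ᵀ

/-- `U 0, …, U N` solves the Crank-Nicolson scheme
`(I - ν A) uⁿ⁺¹ = (I + ν A) uⁿ + τ f^{n+1/2}`, `ν = τ / (2 h^α)`, with initial vector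
`u⁰ = (φ(x_i))`. -/
structure IsSchemeSolution (α xL xR T : ℝ) (dp dm : ℝ → ℝ) (f : ℝ → ℝ → ℝ) (φ : ℝ → ℝ)
    (M N : ℕ) (U : ℕ → Fin (M - 1) → ℝ) : Prop where
  initial : ∀ i, U 0 i = φ (gridPoint xL xR M i)
  step : ∀ n < N,
    (1 - (timeStep T N / (2 * meshSize xL xR M ^ α)) • diffMatrix α xL xR dp dm M) *ᵥ U (n + 1) =
      (1 + (timeStep T N / (2 * meshSize xL xR M ^ α)) • diffMatrix α xL xR dp dm M) *ᵥ U n +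
        timeStep T N •
          (fun i => f (gridPoint xL xR M i) (((n : ℝ) + 1 / 2) * timeStep T N))

/-- The discrete `L²` norm `(h vᵀ v)^(1/2)`. -/
def discreteNorm {m : ℕ} (h : ℝ) (v : Fin m → ℝ) : ℝ := Real.sqrt (h * (v ⬝ᵥ v))

/-! ### The condition on the coefficients -/

/-- The generating function `g(α, x) = ∑ w_k e^{i(k-1)x}` of the Toeplitz matrices. -/
def genFun (α x : ℝ) : ℂ :=
  ∑' k : ℕ, (weight α k : ℂ) * Complex.exp (((((k : ℝ) - 1) * x : ℝ) : ℂ) * Complex.I)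

/-- The constant `ς_α`: the infimum of `Re(-g(α,x)) / |g(α,x)|` over the `x` with
`g(α,x) ≠ 0`. -/
def varsigma (α : ℝ) : ℝ :=
  sInf ((fun x => (-genFun α x).re / ‖genFun α x‖) ''
    {x | x ∈ Icc (-Real.pi) Real.pi ∧ genFun α x ≠ 0})

/-- The condition on the ratio `dm / dp`: it is concave or convex on `[xL, xR]`, takes values in
`[κmin, κmax]`, and `1 + κ - √2 (κmax - κmin) / ς_α ≥ 0`, where `κ = κmax` in the concave case and
`κ = κmin` in the convex case. -/
structure RatioCondition (α xL xR κmin κmax : ℝ) (dp dm : ℝ → ℝ) : Prop where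
  nonneg : 0 ≤ κmin
  lower : ∀ x ∈ Icc xL xR, κmin ≤ dm x / dp x
  upper : ∀ x ∈ Icc xL xR, dm x / dp x ≤ κmax
  cond :
    (ConcaveOn ℝ (Icc xL xR) (fun x => dm x / dp x) ∧
      0 ≤ 1 + κmax - Real.sqrt 2 * (κmax - κmin) / varsigma α) ∨
    (ConvexOn ℝ (Icc xL xR) (fun x => dm x / dp x) ∧
      0 ≤ 1 + κmin - Real.sqrt 2 * (κmax - κmin) / varsigma α)

end WSGD

end

noncomputable section

namespace WSGD

/-! ### Signs and sums of the weights -/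

/-! The proof is stability plus consistency, in the norm with weights `1 / dp`. The error satisfies
(I - νA)eⁿ⁺¹ = (I + νA)eⁿ + τr with r the truncation error. Testing with D₊⁻¹(eⁿ⁺¹ + eⁿ) shows that
the weighted norm grows by at most τ‖r‖ per step (`crankNicolson_step_le`), provided that the
quadratic form of D₊⁻¹A = W + diag(ρ)Wᵀ, ρ = dm/dp, is nonpositive (`diffMatrix_dissipative`). As nτ
≤ T, the error is then of the order of the truncation error.

Stability. The form in question is ⟨W(1+ρ)v, v⟩. Write ρ = κ ± E with E convex and 0 ≤ E ≤ d = κmax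
- κmin; the form becomes (1+κ)⟨Wv,v⟩ ± ⟨WEv,v⟩. Two estimates control the last term. On the Fourier
side, ς|g| ≤ Re(-g) gives ς|⟨Wy,v⟩| ≤ (s(-⟨Wy,y⟩) + s⁻¹(-⟨Wv,v⟩))/2 for every s > 0
(`varsigma_mul_abs_le`). On the matrix side, -W is, up to its antisymmetric part, a discrete
Dirichlet form with killing, and a ground-state identity gives -⟨WEv,Ev⟩ ≤ 2d²(-⟨Wv,v⟩) for convex E
(`toeplitzW_convex_mul`). Together, |⟨WEv,v⟩| ≤ (√2 d/ς)(-⟨Wv,v⟩), which is what the condition on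
the coefficients absorbs (`toeplitzW_mul_form_nonpos`).

Consistency in space. The closed form of g yields |g(x) - (-ix)^α| ≤ C|x|^(α+2)
(`norm_genFun_sub_le`). Fourier inversion turns this into an O(h²) error controlled by the L¹ norm
of the Fourier transform of the derivative of order α+2 (`LeftSmooth.consistency`). This needs the
transform of the classically defined Riemann-Liouville derivative to be (2πiω)^(α+2) times that of v
(`LeftSmooth.fourier_leftRLLine`). The kernel integral need not be integrable, so the identity is
obtained from Laplace transforms on Re s > 0 by letting Re s tend to 0. The right derivative follows
by reflection.

Consistency in time is the trapezoidal rule for u_t and the midpoint rule for f (`truncation_le`).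
-/

lemma gCoeff_succ_eq (α : ℝ) (n : ℕ) :
    gCoeff α (n + 1) = -(α / ((n : ℝ) + 1)) * gCoeff (α - 1) n := by
  induction n with
  | zero => simp [gCoeff]
  | succ n ih =>
    rw [gCoeff, ih, gCoeff]
    have h1 : (n : ℝ) + 1 ≠ 0 := by positivity
    have h2 : (n : ℝ) + 1 + 1 ≠ 0 := by positivity
    push_cast
    field_simp
    ring

/-- Taking partial sums divides the generating function (1-z)^α by 1-z. -/
lemma sum_gCoeff (α : ℝ) (n : ℕ) :
    ∑ k ∈ Finset.range (n + 1), gCoeff α k = gCoeff (α - 1) n := by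
  induction n with
  | zero => simp [gCoeff]
  | succ n ih =>
    rw [Finset.sum_range_succ, ih, gCoeff_succ_eq, gCoeff]
    ring

lemma gCoeff_sub_one_nonpos {α : ℝ} (h1 : 1 < α) (h2 : α < 2) (n : ℕ) :
    gCoeff (α - 1) (n + 1) ≤ 0 := by
  induction n with
  | zero => simp [gCoeff]; linarith
  | succ n ih =>
    rw [gCoeff]
    refine mul_nonpos_of_nonneg_of_nonpos ?_ ih
    rw [sub_nonneg, div_le_one (by positivity)]
    push_cast
    have : (0 : ℝ) ≤ n := Nat.cast_nonneg n
    linarith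

lemma gCoeff_nonneg {α : ℝ} (h1 : 1 < α) (h2 : α < 2) (n : ℕ) : 0 ≤ gCoeff α (n + 2) := by
  rw [gCoeff_succ_eq, neg_mul, ← mul_neg]
  exact mul_nonneg (by positivity) (neg_nonneg.2 (gCoeff_sub_one_nonpos h1 h2 n))

/-- From index 2 on the coefficients are nonnegative, and all partial sums from index 0 are
nonpositive, so the tail sums are at most -(1 - α). -/
lemma summable_abs_gCoeff {α : ℝ} (h1 : 1 < α) (h2 : α < 2) :
    Summable (fun k => |gCoeff α k|) := by
  rw [← summable_nat_add_iff 2]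
  refine summable_of_sum_range_le (c := α - 1) (fun n => abs_nonneg _) fun n => ?_
  have h : ∑ i ∈ Finset.range n, |gCoeff α (i + 2)| = ∑ i ∈ Finset.range n, gCoeff α (i + 2) :=
    Finset.sum_congr rfl fun i _ => abs_of_nonneg (gCoeff_nonneg h1 h2 i)
  have h3 := sum_gCoeff α (n + 1)
  rw [Finset.sum_range_succ', Finset.sum_range_succ'] at h3
  have h4 := gCoeff_sub_one_nonpos h1 h2 n
  have h5 : gCoeff α (0 + 1) + gCoeff α 0 = 1 - α := by simp [gCoeff]; ring
  rw [h]
  linarith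

lemma summable_abs_weight {α : ℝ} (h1 : 1 < α) (h2 : α < 2) :
    Summable (fun k => |weight α k|) := by
  rw [← summable_nat_add_iff 1]
  have h := summable_abs_gCoeff h1 h2
  have h' := (summable_nat_add_iff 1).2 h
  refine Summable.of_nonneg_of_le (fun _ => abs_nonneg _) (fun k => ?_)
    ((h'.mul_left (α / 2)).add (h.mul_left ((2 - α) / 2)))
  rw [weight]
  refine (abs_add_le _ _).trans (le_of_eq ?_)
  rw [abs_mul, abs_mul, abs_of_nonneg (by linarith : 0 ≤ α / 2),
    abs_of_nonneg (by linarith : 0 ≤ (2 - α) / 2)]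

lemma weight_nonneg {α : ℝ} (h1 : 1 < α) (h2 : α < 2) (n : ℕ) : 0 ≤ weight α (n + 3) := by
  rw [weight]
  exact add_nonneg (mul_nonneg (by linarith) (gCoeff_nonneg h1 h2 (n + 1)))
    (mul_nonneg (by linarith) (gCoeff_nonneg h1 h2 n))

/-- `weight α 2` by itself can be negative. Only this sum, the entry of W + Wᵀ next to the diagonal,
enters the quadratic form. -/
lemma weight_zero_add_two_nonneg {α : ℝ} (h1 : 1 < α) : 0 ≤ weight α 0 + weight α 2 := by
  have : weight α 0 + weight α 2 = α * (α - 1) * (α + 2) / 4 := by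
    simp [weight, gCoeff]; ring
  rw [this]
  have : 0 < α - 1 := by linarith
  positivity

lemma sum_weight (α : ℝ) (n : ℕ) :
    ∑ k ∈ Finset.range (n + 2), weight α k =
      α / 2 * gCoeff (α - 1) (n + 1) + (2 - α) / 2 * gCoeff (α - 1) n := by
  rw [Finset.sum_range_succ']
  simp only [weight]
  rw [Finset.sum_add_distrib, ← Finset.mul_sum, ← Finset.mul_sum, sum_gCoeff, ← sum_gCoeff α (n + 1),
    Finset.sum_range_succ' _ (n + 1)]
  ring

lemma sum_weight_nonpos {α : ℝ} (h1 : 1 < α) (h2 : α < 2) (n : ℕ) :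
    ∑ k ∈ Finset.range (n + 3), weight α k ≤ 0 := by
  rw [sum_weight α (n + 1)]
  exact add_nonpos
    (mul_nonpos_of_nonneg_of_nonpos (by linarith) (gCoeff_sub_one_nonpos h1 h2 (n + 1)))
    (mul_nonpos_of_nonneg_of_nonpos (by linarith) (gCoeff_sub_one_nonpos h1 h2 n))

/-! ### The quadratic form of the Toeplitz matrix and convex multipliers -/

/-- If `E` is a supersolution-type multiplier with values in `[0, κ]`, multiplication by `E`
increases the Dirichlet form by at most the factor `2 κ²`. -/
lemma dirichletForm_mul_le {ι : Type*} [Fintype ι] (a : ι → ι → ℝ) (s κ : ℝ) (E x : ι → ℝ)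
    (ha : ∀ i j, 0 ≤ a i j) (hsymm : ∀ i j, a i j = a j i) (hs : ∀ i, ∑ j, a i j ≤ s)
    (hE : ∀ i, 0 ≤ E i) (hκ : ∀ i, E i ≤ κ)
    (h : ∀ i, (2 * ∑ j, a i j - s) * E i ≤ ∑ j, a i j * E j) :
    s * ∑ i, (E i * x i) ^ 2 - ∑ i, ∑ j, a i j * (E i * x i) * (E j * x j) ≤
      2 * κ ^ 2 * (s * ∑ i, x i ^ 2 - ∑ i, ∑ j, a i j * x i * x j) := by
  -- Ground-state (Doob) identity: the form at F·x splits into a jump part with conductances a·F·F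
  -- and a killing part. It is used for F = 1 and F = E.
  have key : ∀ F : ι → ℝ, s * ∑ i, (F i * x i) ^ 2 - ∑ i, ∑ j, a i j * (F i * x i) * (F j * x j) =
      1 / 2 * ∑ i, ∑ j, a i j * (F i * F j) * (x i - x j) ^ 2 +
        ∑ i, F i * x i ^ 2 * (s * F i - ∑ j, a i j * F j) := by
    intro F
    have e1 : ∑ i, ∑ j, a i j * (F i * F j) * (x i - x j) ^ 2 =
        ∑ i, ∑ j, (a i j * (F i * F j) * x i ^ 2) + ∑ i, ∑ j, (a i j * (F i * F j) * x j ^ 2)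
          - 2 * ∑ i, ∑ j, a i j * (F i * x i) * (F j * x j) := by
      simp only [Finset.mul_sum, ← Finset.sum_add_distrib, ← Finset.sum_sub_distrib]
      exact Finset.sum_congr rfl fun i _ => Finset.sum_congr rfl fun j _ => by ring
    have e2 : ∑ i, ∑ j, (a i j * (F i * F j) * x j ^ 2) =
        ∑ i, ∑ j, (a i j * (F i * F j) * x i ^ 2) := by
      rw [Finset.sum_comm]
      exact Finset.sum_congr rfl fun i _ => Finset.sum_congr rfl fun j _ => by
        rw [hsymm j i]; ring
    have e3 : ∑ i, F i * x i ^ 2 * (s * F i - ∑ j, a i j * F j) =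
        s * ∑ i, (F i * x i) ^ 2 - ∑ i, ∑ j, (a i j * (F i * F j) * x i ^ 2) := by
      simp only [Finset.mul_sum, mul_sub, ← Finset.sum_sub_distrib]
      refine Finset.sum_congr rfl fun i _ => ?_
      congr 1
      · ring
      · exact Finset.sum_congr rfl fun j _ => by ring
    rw [e1, e2, e3]
    ring
  have k1 := key (fun _ => 1)
  simp only [one_mul, mul_one] at k1
  rw [key E, k1, mul_add]
  -- The two parts are compared separately. The jump part costs κ²; the killing part costs 2κ²,
  -- because `h` bounds the killing rate of E by twice the original one.
  refine add_le_add ?_ ?_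
  · have : ∑ i, ∑ j, a i j * (E i * E j) * (x i - x j) ^ 2 ≤
        κ ^ 2 * ∑ i, ∑ j, a i j * (x i - x j) ^ 2 := by
      simp only [Finset.mul_sum]
      refine Finset.sum_le_sum fun i _ => Finset.sum_le_sum fun j _ => ?_
      have h1 : E i * E j ≤ κ ^ 2 := by
        rw [sq]; exact mul_le_mul (hκ i) (hκ j) (hE j) ((hE i).trans (hκ i))
      have h2 := mul_nonneg (ha i j) (sq_nonneg (x i - x j))
      nlinarith
    have h0 : 0 ≤ ∑ i, ∑ j, a i j * (x i - x j) ^ 2 :=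
      Finset.sum_nonneg fun i _ => Finset.sum_nonneg fun j _ => mul_nonneg (ha i j) (sq_nonneg _)
    nlinarith [mul_nonneg (sq_nonneg κ) h0]
  · rw [Finset.mul_sum]
    refine Finset.sum_le_sum fun i _ => ?_
    have h1 := h i
    have h2 := hs i
    have h3 : s * E i - ∑ j, a i j * E j ≤ 2 * (s - ∑ j, a i j) * E i := by linarith
    have h4 : E i ^ 2 ≤ κ ^ 2 := pow_le_pow_left₀ (hE i) (hκ i) 2
    have h5 : 0 ≤ x i ^ 2 * (s - ∑ j, a i j) := mul_nonneg (sq_nonneg _) (by linarith)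
    calc E i * x i ^ 2 * (s * E i - ∑ j, a i j * E j)
        ≤ E i * x i ^ 2 * (2 * (s - ∑ j, a i j) * E i) :=
          mul_le_mul_of_nonneg_left h3 (mul_nonneg (hE i) (sq_nonneg _))
      _ = 2 * E i ^ 2 * (x i ^ 2 * (s - ∑ j, a i j)) := by ring
      _ ≤ 2 * κ ^ 2 * (x i ^ 2 * (s - ∑ j, a i j)) :=
          mul_le_mul_of_nonneg_right (by linarith) h5
      _ = _ := by ring

/-- The off-diagonal entries of `W + Wᵀ` as a function of the distance to the diagonal. -/
def symWeight (α : ℝ) : ℕ → ℝ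
  | 0 => 0
  | 1 => weight α 0 + weight α 2
  | k + 2 => weight α (k + 3)

lemma symWeight_nonneg {α : ℝ} (h1 : 1 < α) (h2 : α < 2) : ∀ k, 0 ≤ symWeight α k
  | 0 => le_rfl
  | 1 => weight_zero_add_two_nonneg h1
  | k + 2 => weight_nonneg h1 h2 k

lemma sum_symWeight_le {α : ℝ} (h1 : 1 < α) (h2 : α < 2) (n : ℕ) :
    ∑ k ∈ Finset.range n, symWeight α (k + 1) ≤ -weight α 1 := by
  -- One extra term guarantees that distance 1 occurs, so that the sum matches a partial sum of
  -- weights containing indices 0, 1 and 2.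
  have hmono : ∑ k ∈ Finset.range n, symWeight α (k + 1) ≤
      ∑ k ∈ Finset.range (n + 1), symWeight α (k + 1) := by
    rw [Finset.sum_range_succ]
    linarith [symWeight_nonneg h1 h2 (n + 1)]
  refine hmono.trans ?_
  have h := sum_weight_nonpos h1 h2 n
  rw [Finset.sum_range_succ', Finset.sum_range_succ', Finset.sum_range_succ'] at h
  rw [Finset.sum_range_succ']
  have : ∀ k, symWeight α (k + 1 + 1) = weight α (k + 1 + 1 + 1) := fun k => rfl
  simp only [this]
  simp only [symWeight]
  norm_num at h ⊢
  linarith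

/-- With truncated subtraction, `(i - j) + (j - i)` is the distance |i - j|. -/
lemma toeplitzW_symm (α : ℝ) (m : ℕ) (i j : Fin m) :
    toeplitzW α m i j + toeplitzW α m j i =
      (if i = j then 2 * weight α 1 else 0) + symWeight α ((i : ℕ) - j + (j - i)) := by
  simp only [toeplitzW, Matrix.of_apply]
  rcases lt_trichotomy (i : ℕ) (j : ℕ) with h | h | h
  · obtain ⟨k, hk⟩ := Nat.exists_eq_add_of_lt h
    have hne : i ≠ j := fun h' => by simp [h'] at h
    rw [hk, if_neg hne]
    rcases k with _ | k
    · rw [if_pos (by omega), if_pos (by omega), show (i : ℕ) + 0 + 1 + 1 - i = 2 by omega,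
        show (i : ℕ) + 1 - (i + 0 + 1) = 0 by omega,
        show (i : ℕ) - (i + 0 + 1) + (i + 0 + 1 - i) = 1 by omega]
      simp [symWeight]
    · rw [if_neg (by omega), if_pos (by omega),
        show (i : ℕ) + (k + 1) + 1 + 1 - i = k + 3 by omega,
        show (i : ℕ) - (i + (k + 1) + 1) + (i + (k + 1) + 1 - i) = k + 2 by omega]
      simp [symWeight]
  · have : i = j := Fin.ext h
    subst this
    simp [symWeight]
    ring
  · obtain ⟨k, hk⟩ := Nat.exists_eq_add_of_lt h
    have hne : i ≠ j := fun h' => by simp [h'] at h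
    rw [hk, if_neg hne]
    rcases k with _ | k
    · rw [if_pos (by omega), if_pos (by omega), show (j : ℕ) + 0 + 1 + 1 - j = 2 by omega,
        show (j : ℕ) + 1 - (j + 0 + 1) = 0 by omega,
        show (j : ℕ) + 0 + 1 - j + (j - (j + 0 + 1)) = 1 by omega]
      simp [symWeight, add_comm]
    · rw [if_pos (by omega), if_neg (by omega),
        show (j : ℕ) + (k + 1) + 1 + 1 - j = k + 3 by omega,
        show (j : ℕ) + (k + 1) + 1 - j + (j - (j + (k + 1) + 1)) = k + 2 by omega]
      simp [symWeight]

lemma dotProduct_toeplitzW (α : ℝ) {m : ℕ} (x : Fin m → ℝ) :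
    (toeplitzW α m *ᵥ x) ⬝ᵥ x = weight α 1 * ∑ i, x i ^ 2 +
      ∑ i : Fin m, ∑ j : Fin m, symWeight α ((i : ℕ) - j + (j - i)) / 2 * x i * x j := by
  have h1 : (toeplitzW α m *ᵥ x) ⬝ᵥ x = ∑ i, ∑ j, toeplitzW α m i j * x i * x j := by
    simp only [dotProduct, Matrix.mulVec, Finset.sum_mul]
    exact Finset.sum_congr rfl fun i _ => Finset.sum_congr rfl fun j _ => by ring
  have h2 : ∑ i, ∑ j, toeplitzW α m i j * x i * x j = ∑ i, ∑ j, toeplitzW α m j i * x i * x j := by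
    rw [Finset.sum_comm]
    exact Finset.sum_congr rfl fun i _ => Finset.sum_congr rfl fun j _ => by ring
  have h3 : ∑ i, ∑ j, (toeplitzW α m i j + toeplitzW α m j i) * x i * x j =
      2 * (toeplitzW α m *ᵥ x) ⬝ᵥ x := by
    simp only [add_mul, Finset.sum_add_distrib]
    rw [← h2, h1]; ring
  have h4 : ∑ i : Fin m, ∑ j : Fin m, (if i = j then 2 * weight α 1 else 0) * x i * x j =
      2 * (weight α 1 * ∑ i, x i ^ 2) := by
    simp only [Finset.mul_sum]
    refine Finset.sum_congr rfl fun i _ => ?_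
    simp only [ite_mul, zero_mul, Finset.sum_ite_eq, Finset.mem_univ, if_true]
    ring
  simp only [toeplitzW_symm, add_mul _ _ (x _), Finset.sum_add_distrib] at h3
  rw [h4] at h3
  have h5 : ∑ i : Fin m, ∑ j : Fin m, symWeight α ((i : ℕ) - j + (j - i)) / 2 * x i * x j =
      1 / 2 * ∑ i : Fin m, ∑ j : Fin m, symWeight α ((i : ℕ) - j + (j - i)) * x i * x j := by
    simp only [Finset.mul_sum]
    exact Finset.sum_congr rfl fun i _ => Finset.sum_congr rfl fun j _ => by ring
  rw [h5]
  linarith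

/-- Neighbours to the left and to the right are listed by distance, so that convexity can pair i - k
with i + k. -/
lemma sum_dist_eq (b F : ℕ → ℝ) (hb : b 0 = 0) {m : ℕ} (i : Fin m) :
    ∑ j : Fin m, b ((i : ℕ) - j + (j - i)) * F j =
      ∑ k ∈ Finset.range i, b (k + 1) * F (i - 1 - k) +
        ∑ k ∈ Finset.range (m - 1 - i), b (k + 1) * F (i + 1 + k) := by
  rw [Fin.sum_univ_eq_sum_range (fun j => b ((i : ℕ) - j + (j - i)) * F j) m]
  obtain ⟨i, hi⟩ := i
  obtain ⟨r, rfl⟩ := Nat.exists_eq_add_of_le (Nat.succ_le_of_lt hi)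
  rw [Finset.sum_range_add, Finset.sum_range_succ, show i.succ + r - 1 - i = r by omega]
  simp only [Nat.sub_self, add_zero, hb, zero_mul]
  congr 1
  · rw [← Finset.sum_range_reflect]
    refine Finset.sum_congr rfl fun k hk => ?_
    have := Finset.mem_range.1 hk
    congr 2
    omega
  · refine Finset.sum_congr rfl fun k hk => ?_
    congr 2
    omega

/-- Multiplication by a convex sequence with values in `[0, κ]` increases the quadratic form of
`-W` by at most the factor `2 κ²`. -/
lemma toeplitzW_convex_mul {α : ℝ} (h1 : 1 < α) (h2 : α < 2) {m : ℕ} (E : ℕ → ℝ) (κ : ℝ)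
    (hE : ∀ i < m, 0 ≤ E i) (hκ : ∀ i < m, E i ≤ κ)
    (hconv : ∀ i k, k ≤ i → i + k < m → 2 * E i ≤ E (i - k) + E (i + k)) (x : Fin m → ℝ) :
    -((toeplitzW α m *ᵥ fun i => E i * x i) ⬝ᵥ fun i => E i * x i) ≤
      2 * κ ^ 2 * (-((toeplitzW α m *ᵥ x) ⬝ᵥ x)) := by
  set b := symWeight α with hb
  have hb0 : ∀ k, 0 ≤ b k := symWeight_nonneg h1 h2
  have hsum : ∀ i : Fin m, ∑ j : Fin m, b ((i : ℕ) - j + (j - i)) / 2 =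
      1 / 2 * (∑ k ∈ Finset.range i, b (k + 1) + ∑ k ∈ Finset.range (m - 1 - i), b (k + 1)) := by
    intro i
    have := sum_dist_eq b (fun _ => 1) rfl i
    simp only [mul_one] at this
    rw [← this, Finset.mul_sum]
    exact Finset.sum_congr rfl fun j _ => by ring
  have hs := sum_symWeight_le h1 h2
  rw [← hb] at hs
  -- The symmetric part of -W has diagonal `-weight α 1`, which is s, and off-diagonal entries -b/2.
  -- Row sums are at most s by `sum_symWeight_le`.
  have key := dirichletForm_mul_le (fun i j : Fin m => b ((i : ℕ) - j + (j - i)) / 2)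
    (-weight α 1) κ (fun i => E i) x (fun i j => div_nonneg (hb0 _) zero_le_two)
    (fun i j => by simp only [add_comm]) (fun i => ?_) (fun i => hE i i.2) (fun i => hκ i i.2)
    (fun i => ?_)
  · rw [dotProduct_toeplitzW, dotProduct_toeplitzW, ← hb]
    linarith
  · rw [hsum]
    linarith [hs i, hs (m - 1 - i)]
  · rw [hsum]
    have e1 : ∑ j : Fin m, b ((i : ℕ) - j + (j - i)) / 2 * E j =
        1 / 2 * (∑ k ∈ Finset.range i, b (k + 1) * E (i - 1 - k) +
        ∑ k ∈ Finset.range (m - 1 - i), b (k + 1) * E (i + 1 + k)) := by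
      rw [← sum_dist_eq b E rfl i, Finset.mul_sum]
      exact Finset.sum_congr rfl fun j _ => by ring
    simp only [e1]
    have hi := i.2
    generalize (i : ℕ) = p at hi ⊢
    set r : ℕ := m - 1 - p with hr
    -- Up to distance l both neighbours exist and convexity bounds their sum below by 2E(p). Beyond
    -- l the one-sided terms are nonnegative and dropped; the matching coefficients are absorbed by
    -- s, since the sum up to `max p r` is at most s.
    set l := min p r with hl
    have hlp : l ≤ p := min_le_left _ _
    have hlr : l ≤ r := min_le_right _ _
    have e2 : ∑ k ∈ Finset.range p, b (k + 1) + ∑ k ∈ Finset.range r, b (k + 1) =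
        ∑ k ∈ Finset.range l, b (k + 1) + ∑ k ∈ Finset.range (max p r), b (k + 1) := by
      rcases le_total p r with h | h
      · rw [hl, min_eq_left h, max_eq_right h]
      · rw [hl, min_eq_right h, max_eq_left h, add_comm]
    have e3 : ∑ k ∈ Finset.range l, b (k + 1) * E (p - 1 - k) ≤
        ∑ k ∈ Finset.range p, b (k + 1) * E (p - 1 - k) :=
      Finset.sum_le_sum_of_subset_of_nonneg (Finset.range_mono hlp) fun k hk _ =>
        mul_nonneg (hb0 _) (hE _ (by omega))
    have e4 : ∑ k ∈ Finset.range l, b (k + 1) * E (p + 1 + k) ≤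
        ∑ k ∈ Finset.range r, b (k + 1) * E (p + 1 + k) :=
      Finset.sum_le_sum_of_subset_of_nonneg (Finset.range_mono hlr) fun k hk _ =>
        mul_nonneg (hb0 _) (hE _ (by have := Finset.mem_range.1 hk; omega))
    have e5 : 2 * ((∑ k ∈ Finset.range l, b (k + 1)) * E p) ≤
        ∑ k ∈ Finset.range l, b (k + 1) * E (p - 1 - k) +
          ∑ k ∈ Finset.range l, b (k + 1) * E (p + 1 + k) := by
      rw [Finset.sum_mul, Finset.mul_sum, ← Finset.sum_add_distrib]
      refine Finset.sum_le_sum fun k hk => ?_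
      have hk' := Finset.mem_range.1 hk
      have := hconv p (k + 1) (by omega) (by omega)
      rw [show p - (k + 1) = p - 1 - k by omega, show p + (k + 1) = p + 1 + k by omega] at this
      nlinarith [hb0 (k + 1)]
    have e6 := mul_nonneg (sub_nonneg.2 (hs (max p r))) (hE p hi)
    rw [e2]
    nlinarith

/-! ### The generating function in closed form -/

lemma gCoeff_eq_choose (α : ℝ) (k : ℕ) : gCoeff α k = (-1) ^ k * Ring.choose α k := by
  induction k with
  | zero => simp [gCoeff]
  | succ k ih =>
    have h : (k + 1 : ℝ) * Ring.choose α (k + 1) = (α - k) * Ring.choose α k := by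
      have h1 := Ring.descPochhammer_eq_factorial_smul_choose α (k + 1)
      have h2 := Ring.descPochhammer_eq_factorial_smul_choose α k
      rw [descPochhammer_succ_right, Polynomial.smeval_mul, h2] at h1
      simp only [Polynomial.smeval_sub, Polynomial.smeval_X, Polynomial.smeval_natCast, pow_one,
        pow_zero, nsmul_eq_mul, mul_one, Nat.factorial_succ, Nat.cast_mul] at h1
      have h3 : (k.factorial : ℝ) ≠ 0 := by positivity
      push_cast at h1
      apply mul_left_cancel₀ h3
      linarith
    rw [gCoeff, ih, pow_succ]
    have h3 : (k + 1 : ℝ) ≠ 0 := by positivity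
    apply mul_left_cancel₀ h3
    have : (k + 1 : ℝ) * ((-1) ^ k * -1 * Ring.choose α (k + 1)) =
      -(-1) ^ k * ((k + 1 : ℝ) * Ring.choose α (k + 1)) := by ring
    rw [this, h]
    field_simp
    ring

lemma hasSum_gCoeff_of_norm_lt (α : ℝ) {z : ℂ} (hz : ‖z‖ < 1) :
    HasSum (fun k => (gCoeff α k : ℂ) * z ^ k) ((1 - z) ^ (α : ℂ)) := by
  have h := (Complex.one_add_cpow_hasFPowerSeriesOnBall_zero (a := (α : ℂ))).hasSum (y := -z)
    (by simpa [← ENNReal.ofReal_one, Metric.eball_ofReal] using hz)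
  have e : (fun k => (gCoeff α k : ℂ) * z ^ k) =
      fun k => binomialSeries ℂ (α : ℂ) k fun _ => -z := by
    ext k
    rw [gCoeff_eq_choose, binomialSeries_apply, ← Complex.ofReal_choose]
    simp [neg_pow z]
    ring
  rwa [zero_add, ← sub_eq_add_neg, ← e] at h

/-- The generating function lives on |z| = 1, outside the open disc of the binomial series. Absolute
summability makes the series continuous on the closed disc, and so is (1-y)^α because Re(1-y) ≥ 0
there; agreement extends from the open disc. -/
lemma hasSum_gCoeff {α : ℝ} (h1 : 1 < α) (h2 : α < 2) {z : ℂ} (hz : ‖z‖ ≤ 1) :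
    HasSum (fun k => (gCoeff α k : ℂ) * z ^ k) ((1 - z) ^ (α : ℂ)) := by
  have hbd : ∀ (k : ℕ) (y : ℂ), y ∈ Metric.closedBall (0 : ℂ) 1 →
      ‖(gCoeff α k : ℂ) * y ^ k‖ ≤ |gCoeff α k| := by
    intro k y hy
    rw [norm_mul, norm_pow, Complex.norm_real, Real.norm_eq_abs]
    exact mul_le_of_le_one_right (abs_nonneg _)
      (pow_le_one₀ (norm_nonneg _) (by simpa using hy))
  have hzm : z ∈ Metric.closedBall (0 : ℂ) 1 := by simpa using hz
  have hs : Summable (fun k => (gCoeff α k : ℂ) * z ^ k) :=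
    Summable.of_norm_bounded (summable_abs_gCoeff h1 h2) fun k => hbd k z hzm
  have hc1 : ContinuousOn (fun y : ℂ => ∑' k, (gCoeff α k : ℂ) * y ^ k)
      (Metric.closedBall (0 : ℂ) 1) :=
    continuousOn_tsum (fun k => by fun_prop) (summable_abs_gCoeff h1 h2) hbd
  have hc2 : ContinuousOn (fun y : ℂ => (1 - y) ^ (α : ℂ)) (Metric.closedBall (0 : ℂ) 1) := by
    intro y hy
    have hre : 0 ≤ (1 - y).re := by
      have := (Complex.re_le_norm y).trans (by simpa using hy : ‖y‖ ≤ 1)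
      simp only [Complex.sub_re, Complex.one_re]
      linarith
    have hcont := Complex.continuousAt_cpow_const_of_re_pos (z := 1 - y) (w := (α : ℂ))
      (Or.inl hre) (by simp; linarith)
    exact (ContinuousAt.comp (f := fun y : ℂ => 1 - y) hcont (by fun_prop)).continuousWithinAt
  have heq : EqOn (fun y : ℂ => ∑' k, (gCoeff α k : ℂ) * y ^ k) (fun y => (1 - y) ^ (α : ℂ))
      (Metric.closedBall (0 : ℂ) 1) := by
    have h0 : EqOn (fun y : ℂ => ∑' k, (gCoeff α k : ℂ) * y ^ k) (fun y => (1 - y) ^ (α : ℂ))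
        (Metric.ball (0 : ℂ) 1) := fun y hy =>
      (hasSum_gCoeff_of_norm_lt α (by simpa using hy)).tsum_eq
    exact h0.of_subset_closure hc1 hc2 Metric.ball_subset_closedBall
      (closure_ball (0 : ℂ) one_ne_zero).ge
  have h := hs.hasSum
  rwa [show ∑' k, (gCoeff α k : ℂ) * z ^ k = (1 - z) ^ (α : ℂ) from heq hzm] at h

lemma hasSum_genFun {α : ℝ} (h1 : 1 < α) (h2 : α < 2) (x : ℝ) :
    HasSum (fun k : ℕ => (weight α k : ℂ) *
      Complex.exp (((((k : ℝ) - 1) * x : ℝ) : ℂ) * Complex.I)) (genFun α x) := by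
  refine Summable.hasSum (Summable.of_norm_bounded (summable_abs_weight h1 h2) fun k => ?_)
  rw [norm_mul, Complex.norm_exp_ofReal_mul_I, mul_one, Complex.norm_real, Real.norm_eq_abs]

lemma norm_genFun_le {α : ℝ} (h1 : 1 < α) (h2 : α < 2) (x : ℝ) :
    ‖genFun α x‖ ≤ ∑' k, |weight α k| := by
  refine tsum_of_norm_bounded (summable_abs_weight h1 h2).hasSum fun k => ?_
  rw [norm_mul, Complex.norm_exp_ofReal_mul_I, mul_one, Complex.norm_real, Real.norm_eq_abs]

lemma continuous_genFun {α : ℝ} (h1 : 1 < α) (h2 : α < 2) : Continuous (genFun α) := by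
  refine continuous_tsum (fun k => by fun_prop) (summable_abs_weight h1 h2) fun k x => ?_
  rw [norm_mul, Complex.norm_exp_ofReal_mul_I, mul_one, Complex.norm_real, Real.norm_eq_abs]

lemma genFun_neg (α x : ℝ) : genFun α (-x) = (starRingEnd ℂ) (genFun α x) := by
  rw [genFun, genFun, Complex.conj_tsum]
  refine tsum_congr fun k => ?_
  rw [map_mul, Complex.conj_ofReal, ← Complex.exp_conj, map_mul, Complex.conj_ofReal,
    Complex.conj_I]
  push_cast
  ring_nf

/-- The recursion for the weights multiplies the series of (1-z)^α by α/2 + (1-α/2)z; the shift by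
one node contributes e^(-ix). -/
lemma genFun_eq_mul_cpow {α : ℝ} (h1 : 1 < α) (h2 : α < 2) (x : ℝ) :
    genFun α x = Complex.exp (-((x : ℂ) * Complex.I)) *
      ((α : ℂ) / 2 + (2 - α) / 2 * Complex.exp ((x : ℂ) * Complex.I)) *
      (1 - Complex.exp ((x : ℂ) * Complex.I)) ^ (α : ℂ) := by
  set z := Complex.exp ((x : ℂ) * Complex.I) with hz
  have hg := hasSum_gCoeff h1 h2 (z := z) (Complex.norm_exp_ofReal_mul_I x).le
  set G := (1 - z) ^ (α : ℂ)
  have e0 : ∀ k : ℕ, Complex.exp (((((k : ℝ) - 1) * x : ℝ) : ℂ) * Complex.I) =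
      Complex.exp (-((x : ℂ) * Complex.I)) * z ^ k := by
    intro k
    rw [hz, ← Complex.exp_nat_mul, ← Complex.exp_add]
    congr 1
    push_cast
    ring
  have hw : HasSum (fun k => (weight α k : ℂ) * z ^ k)
      (((α : ℂ) / 2 + (2 - α) / 2 * z) * G) := by
    have hg' := (hasSum_nat_add_iff' 1).2 hg
    rw [← hasSum_nat_add_iff' 1]
    have := (hg'.mul_left ((α : ℂ) / 2)).add (hg.mul_left ((2 - α) / 2 * z))
    have e1 : (fun k => (weight α (k + 1) : ℂ) * z ^ (k + 1)) = fun k =>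
        (α : ℂ) / 2 * ((gCoeff α (k + 1) : ℂ) * z ^ (k + 1)) +
          (2 - α) / 2 * z * ((gCoeff α k : ℂ) * z ^ k) := by
      ext k
      simp only [weight]
      push_cast
      ring
    have e2 : ((α : ℂ) / 2 + (2 - α) / 2 * z) * G - ∑ i ∈ Finset.range 1, (weight α i : ℂ) * z ^ i =
        (α : ℂ) / 2 * (G - ∑ i ∈ Finset.range 1, (gCoeff α i : ℂ) * z ^ i) +
          (2 - α) / 2 * z * G := by
      simp [weight, gCoeff]
      ring
    rw [e1, e2]
    exact this
  have h3 := hw.mul_left (Complex.exp (-((x : ℂ) * Complex.I)))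
  rw [mul_assoc, ← h3.tsum_eq, genFun]
  refine tsum_congr fun k => ?_
  rw [e0]
  ring

lemma polar_cpow {r θ α : ℝ} (hr : 0 ≤ r) (hα : α ≠ 0) (h1 : -Real.pi < θ) (h2 : θ ≤ Real.pi) :
    ((r : ℂ) * Complex.exp ((θ : ℂ) * Complex.I)) ^ (α : ℂ) =
      ((r ^ α : ℝ) : ℂ) * Complex.exp (((α * θ : ℝ) : ℂ) * Complex.I) := by
  rcases hr.eq_or_lt with rfl | hr
  · simp [hα, Real.zero_rpow hα]
  · have hne : (r : ℂ) * Complex.exp ((θ : ℂ) * Complex.I) ≠ 0 :=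
      mul_ne_zero (by exact_mod_cast hr.ne') (Complex.exp_ne_zero _)
    rw [Complex.cpow_def_of_ne_zero hne, Complex.log_ofReal_mul hr (Complex.exp_ne_zero _),
      Complex.log_exp (by simpa using h1) (by simpa using h2), Real.rpow_def_of_pos hr, add_mul,
      Complex.exp_add]
    push_cast
    congr 2
    ring

/-- On [0, π] this is a polar form with nonnegative modulus and principal argument, so that the
complex power can be evaluated by `polar_cpow`. -/
lemma one_sub_cexp (x : ℝ) : 1 - Complex.exp ((x : ℂ) * Complex.I) =
    ((2 * Real.sin (x / 2) : ℝ) : ℂ) *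
      Complex.exp ((((x - Real.pi) / 2 : ℝ) : ℂ) * Complex.I) := by
  have e1 : Complex.exp ((((x - Real.pi) / 2 : ℝ) : ℂ) * Complex.I) =
      -Complex.I * Complex.exp (((x / 2 : ℝ) : ℂ) * Complex.I) := by
    have : (((x - Real.pi) / 2 : ℝ) : ℂ) * Complex.I =
      -((Real.pi : ℂ) / 2 * Complex.I) + ((x / 2 : ℝ) : ℂ) * Complex.I := by push_cast; ring
    rw [this, Complex.exp_add, Complex.exp_neg, Complex.exp_pi_div_two_mul_I, Complex.inv_I]
  have e2 : Complex.exp ((x : ℂ) * Complex.I) =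
      Complex.exp (((x / 2 : ℝ) : ℂ) * Complex.I) * Complex.exp (((x / 2 : ℝ) : ℂ) * Complex.I) := by
    rw [← Complex.exp_add]; congr 1; push_cast; ring
  have e3 : (1 : ℂ) = Complex.exp (-(((x / 2 : ℝ) : ℂ)) * Complex.I) *
      Complex.exp (((x / 2 : ℝ) : ℂ) * Complex.I) := by
    rw [← Complex.exp_add]; simp
  rw [e1, e2]
  conv_lhs => rw [e3]
  rw [← sub_mul]
  push_cast
  rw [Complex.sin]
  linear_combination (norm := ring_nf)
    (Complex.exp (-((x : ℂ) / 2) * Complex.I) - Complex.exp ((x : ℂ) / 2 * Complex.I)) *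
      Complex.exp ((x : ℂ) / 2 * Complex.I) * Complex.I_sq

/-- The closed form of the generating function on `[0, π]`. -/
lemma genFun_eq {α : ℝ} (h1 : 1 < α) (h2 : α < 2) {x : ℝ} (hx0 : 0 ≤ x) (hx : x ≤ Real.pi) :
    genFun α x = -(((2 * Real.sin (x / 2)) ^ α : ℝ) : ℂ) *
      (((α / 2 : ℝ) : ℂ) * Complex.exp ((((1 - α / 2) * (Real.pi - x) : ℝ) : ℂ) * Complex.I) +
      ((1 - α / 2 : ℝ) : ℂ) *
        Complex.exp ((((1 - α / 2) * (Real.pi - x) + x : ℝ) : ℂ) * Complex.I)) := by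
  have hpi := Real.pi_pos
  have hsin : 0 ≤ 2 * Real.sin (x / 2) :=
    mul_nonneg zero_le_two (Real.sin_nonneg_of_nonneg_of_le_pi (by linarith) (by linarith))
  rw [genFun_eq_mul_cpow h1 h2, one_sub_cexp, polar_cpow hsin (by linarith) (by linarith)
    (by linarith)]
  set r : ℂ := (((2 * Real.sin (x / 2)) ^ α : ℝ) : ℂ)
  have e1 : Complex.exp (-((x : ℂ) * Complex.I)) *
      Complex.exp (((α * ((x - Real.pi) / 2) : ℝ) : ℂ) * Complex.I) =
      -Complex.exp ((((1 - α / 2) * (Real.pi - x) : ℝ) : ℂ) * Complex.I) := by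
    rw [← Complex.exp_add, ← Complex.exp_sub_pi_mul_I]
    congr 1
    push_cast
    ring
  have e2 : Complex.exp ((((1 - α / 2) * (Real.pi - x) + x : ℝ) : ℂ) * Complex.I) =
      Complex.exp ((((1 - α / 2) * (Real.pi - x) : ℝ) : ℂ) * Complex.I) *
        Complex.exp ((x : ℂ) * Complex.I) := by
    rw [← Complex.exp_add]; congr 1; push_cast; ring
  rw [e2]
  push_cast at e1 ⊢
  linear_combination (r * ((α : ℂ) / 2 + (2 - α) / 2 * Complex.exp ((x : ℂ) * Complex.I))) * e1

/-! ### Sectoriality of the generating function -/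

/-- With p = α/2 and y = π - x, the phases of the two terms of -g are (1-p)y and π - py. Since p ≥
1-p, the second cosine is at least -cos((1-p)y), which leaves p - (1-p) = α - 1 times cos((1-p)y),
and y ≤ π. -/
lemma re_neg_genFun_ge {α : ℝ} (h1 : 1 < α) (h2 : α < 2) {x : ℝ} (hx0 : 0 ≤ x)
    (hx : x ≤ Real.pi) :
    (2 * Real.sin (x / 2)) ^ α * ((α - 1) * Real.cos ((1 - α / 2) * Real.pi)) ≤
      (-genFun α x).re := by
  have hpi := Real.pi_pos
  have hsin : 0 ≤ 2 * Real.sin (x / 2) :=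
    mul_nonneg zero_le_two (Real.sin_nonneg_of_nonneg_of_le_pi (by linarith) (by linarith))
  rw [genFun_eq h1 h2 hx0 hx, neg_mul, neg_neg, Complex.re_ofReal_mul, Complex.add_re,
    Complex.re_ofReal_mul, Complex.re_ofReal_mul, Complex.exp_ofReal_mul_I_re,
    Complex.exp_ofReal_mul_I_re]
  refine mul_le_mul_of_nonneg_left ?_ (Real.rpow_nonneg hsin _)
  set y := Real.pi - x with hy
  have hy0 : 0 ≤ y := by linarith
  have hy1 : y ≤ Real.pi := by linarith
  have e1 : (1 - α / 2) * y + x = Real.pi - α / 2 * y := by rw [hy]; ring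
  rw [e1, Real.cos_pi_sub]
  have hq : 0 < 1 - α / 2 := by linarith
  have c1 : Real.cos (α / 2 * y) ≤ Real.cos ((1 - α / 2) * y) :=
    Real.cos_le_cos_of_nonneg_of_le_pi (mul_nonneg hq.le hy0) (by nlinarith) (by nlinarith)
  have c2 : Real.cos ((1 - α / 2) * Real.pi) ≤ Real.cos ((1 - α / 2) * y) :=
    Real.cos_le_cos_of_nonneg_of_le_pi (mul_nonneg hq.le hy0) (by nlinarith)
      (mul_le_mul_of_nonneg_left hy1 hq.le)
  nlinarith [mul_le_mul_of_nonneg_left c1 hq.le,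
    mul_le_mul_of_nonneg_left c2 (by linarith : 0 ≤ α - 1)]

lemma norm_genFun_le_rpow {α : ℝ} (h1 : 1 < α) (h2 : α < 2) {x : ℝ} (hx0 : 0 ≤ x)
    (hx : x ≤ Real.pi) : ‖genFun α x‖ ≤ (2 * Real.sin (x / 2)) ^ α := by
  have hpi := Real.pi_pos
  have hsin : 0 ≤ 2 * Real.sin (x / 2) :=
    mul_nonneg zero_le_two (Real.sin_nonneg_of_nonneg_of_le_pi (by linarith) (by linarith))
  rw [genFun_eq h1 h2 hx0 hx, norm_mul, norm_neg, Complex.norm_real, Real.norm_eq_abs,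
    abs_of_nonneg (Real.rpow_nonneg hsin _)]
  refine mul_le_of_le_one_right (Real.rpow_nonneg hsin _) ((norm_add_le _ _).trans ?_)
  rw [norm_mul, norm_mul, Complex.norm_exp_ofReal_mul_I, Complex.norm_exp_ofReal_mul_I,
    Complex.norm_real, Complex.norm_real, Real.norm_eq_abs, Real.norm_eq_abs,
    abs_of_nonneg (by linarith), abs_of_nonneg (by linarith)]
  linarith

/-- A lower bound for `varsigma`. -/
def sectorConst (α : ℝ) : ℝ := (α - 1) * Real.cos ((1 - α / 2) * Real.pi)

lemma sectorConst_pos {α : ℝ} (h1 : 1 < α) (h2 : α < 2) : 0 < sectorConst α :=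
  mul_pos (by linarith) (Real.cos_pos_of_mem_Ioo ⟨by nlinarith [Real.pi_pos],
    by nlinarith [Real.pi_pos]⟩)

lemma sectorConst_mul_norm_le {α : ℝ} (h1 : 1 < α) (h2 : α < 2) {x : ℝ}
    (hx : x ∈ Icc (-Real.pi) Real.pi) : sectorConst α * ‖genFun α x‖ ≤ (-genFun α x).re := by
  have key : ∀ y, 0 ≤ y → y ≤ Real.pi → sectorConst α * ‖genFun α y‖ ≤ (-genFun α y).re := by
    intro y hy0 hy
    refine le_trans ?_ (re_neg_genFun_ge h1 h2 hy0 hy)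
    rw [mul_comm]
    exact mul_le_mul_of_nonneg_right (norm_genFun_le_rpow h1 h2 hy0 hy) (sectorConst_pos h1 h2).le
  rcases le_total 0 x with h | h
  · exact key x h hx.2
  · have := key (-x) (by linarith) (by linarith [hx.1])
    rwa [genFun_neg, RCLike.norm_conj, ← map_neg, Complex.conj_re] at this

lemma sectorConst_le_ratio {α : ℝ} (h1 : 1 < α) (h2 : α < 2) {x : ℝ}
    (hx : x ∈ Icc (-Real.pi) Real.pi) (h : genFun α x ≠ 0) :
    sectorConst α ≤ (-genFun α x).re / ‖genFun α x‖ := by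
  rw [le_div_iff₀ (norm_pos_iff.2 h)]
  exact sectorConst_mul_norm_le h1 h2 hx

/-- The infimum is over a nonempty set, as g does not vanish at π, and `sectorConst` is a positive
lower bound. -/
lemma varsigma_pos {α : ℝ} (h1 : 1 < α) (h2 : α < 2) : 0 < varsigma α := by
  have hpi := Real.pi_pos
  refine (sectorConst_pos h1 h2).trans_le (le_csInf ?_ ?_)
  · refine ⟨_, Real.pi, ⟨⟨by linarith, le_rfl⟩, fun h => ?_⟩, rfl⟩
    have h3 := re_neg_genFun_ge h1 h2 hpi.le le_rfl
    rw [h, neg_zero, Complex.zero_re, Real.sin_pi_div_two, mul_one] at h3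
    have : 0 < (2 : ℝ) ^ α * sectorConst α := mul_pos (by positivity) (sectorConst_pos h1 h2)
    exact absurd h3 (not_le.2 this)
  · rintro _ ⟨x, ⟨hx, h⟩, rfl⟩
    exact sectorConst_le_ratio h1 h2 hx h

lemma varsigma_mul_norm_le {α : ℝ} (h1 : 1 < α) (h2 : α < 2) {x : ℝ}
    (hx : x ∈ Icc (-Real.pi) Real.pi) : varsigma α * ‖genFun α x‖ ≤ (-genFun α x).re := by
  by_cases h : genFun α x = 0
  · simp [h]
  · rw [← le_div_iff₀ (norm_pos_iff.2 h)]
    refine csInf_le ⟨sectorConst α, ?_⟩ ⟨x, ⟨hx, h⟩, rfl⟩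
    rintro _ ⟨y, ⟨hy, h'⟩, rfl⟩
    exact sectorConst_le_ratio h1 h2 hy h'

/-! ### The generating function as an approximation of the symbol of the derivative -/

lemma norm_cexp_sub_one_sub_le (y : ℝ) :
    ‖Complex.exp ((y : ℂ) * Complex.I) - 1 - y * Complex.I‖ ≤ 2 * y ^ 2 := by
  have hn : ‖(y : ℂ) * Complex.I‖ = |y| := by simp
  rcases le_total |y| 1 with h | h
  · have := Complex.norm_exp_sub_one_sub_id_le (x := (y : ℂ) * Complex.I) (by rwa [hn])
    rw [hn, sq_abs] at this
    nlinarith [sq_nonneg y]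
  · have h3 := Real.norm_exp_I_mul_ofReal_sub_one_le (x := y)
    rw [mul_comm, Real.norm_eq_abs] at h3
    refine (norm_sub_le _ _).trans ?_
    rw [hn]
    nlinarith [sq_abs y, abs_nonneg y]

/-- For t = sin(x/2)/(x/2) one has 1 - t ≤ x²/4, and t² ≤ t^α gives 1 - t^α ≤ 1 - t² ≤ 2(1-t). -/
lemma rpow_sub_rpow_two_sin_le {α : ℝ} (h1 : 1 < α) (h2 : α < 2) {x : ℝ} (hx0 : 0 ≤ x)
    (hx : x ≤ Real.pi) :
    |(2 * Real.sin (x / 2)) ^ α - x ^ α| ≤ x ^ α * (x ^ 2 / 2) := by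
  rcases hx0.eq_or_lt with rfl | hx0
  · simp
  have hsin : 0 ≤ Real.sin (x / 2) :=
    Real.sin_nonneg_of_nonneg_of_le_pi (by linarith) (by linarith [Real.pi_pos])
  set t := 2 * Real.sin (x / 2) / x with ht
  have ht0 : 0 ≤ t := div_nonneg (by linarith) hx0.le
  have ht1 : t ≤ 1 := by
    rw [ht, div_le_one hx0]
    linarith [Real.sin_le (by linarith : 0 ≤ x / 2)]
  have ht2 : 1 - t ≤ x ^ 2 / 4 := by
    have h3 := Real.sin_gt_sub_cube (by linarith : 0 < x / 2)
    have : 1 - x ^ 2 / 4 ≤ t := by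
      rw [ht, le_div_iff₀ hx0]
      nlinarith [pow_pos hx0 3]
    linarith
  have e : 2 * Real.sin (x / 2) = x * t := by rw [ht]; field_simp
  rw [e, Real.mul_rpow hx0.le ht0]
  have h4 : t ^ α ≤ 1 := Real.rpow_le_one ht0 ht1 (by linarith)
  have h5 : t ^ 2 ≤ t ^ α := by
    rcases ht0.eq_or_lt with h | h
    · rw [← h, Real.zero_rpow (by linarith)]; norm_num
    · have := Real.rpow_le_rpow_of_exponent_ge h ht1 h2.le
      rwa [Real.rpow_two] at this
  have hxa : 0 < x ^ α := Real.rpow_pos_of_pos hx0 _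
  rw [abs_sub_comm, abs_of_nonneg (by nlinarith)]
  have h6 : 1 - t ^ α ≤ x ^ 2 / 2 := by nlinarith
  nlinarith [mul_le_mul_of_nonneg_left h6 hxa.le]

lemma norm_genFun_sub_le_of_nonneg {α : ℝ} (h1 : 1 < α) (h2 : α < 2) {x : ℝ} (hx0 : 0 ≤ x) :
    ‖genFun α x - (-((x : ℂ) * Complex.I)) ^ (α : ℂ)‖ ≤
      (4 + ∑' k, |weight α k|) * x ^ (α + 2) := by
  have hpi := Real.pi_pos
  have hS : 0 ≤ ∑' k, |weight α k| := tsum_nonneg fun _ => abs_nonneg _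
  have hpolar : (-((x : ℂ) * Complex.I)) ^ (α : ℂ) =
      ((x ^ α : ℝ) : ℂ) * Complex.exp (((α * (-(Real.pi / 2)) : ℝ) : ℂ) * Complex.I) := by
    rw [← polar_cpow hx0 (by linarith) (by linarith) (by linarith)]
    congr 1
    push_cast
    rw [neg_mul, Complex.exp_neg, Complex.exp_pi_div_two_mul_I, Complex.inv_I]
    ring
  have hxa : 0 ≤ x ^ α := Real.rpow_nonneg hx0 _
  have hadd : x ^ (α + 2) = x ^ α * x ^ 2 := by
    rw [Real.rpow_add' hx0 (by linarith), Real.rpow_two]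
  rw [hadd]
  rcases le_total x Real.pi with hx | hx
  · set r := (2 * Real.sin (x / 2)) ^ α with hr
    set p : ℝ := α / 2 with hp
    have hsin : 0 ≤ 2 * Real.sin (x / 2) :=
      mul_nonneg zero_le_two (Real.sin_nonneg_of_nonneg_of_le_pi (by linarith) (by linarith))
    have hr0 : 0 ≤ r := Real.rpow_nonneg hsin _
    set e0 := Complex.exp ((((1 - p) * Real.pi : ℝ) : ℂ) * Complex.I) with he0
    set A := Complex.exp (((-((1 - p) * x) : ℝ) : ℂ) * Complex.I) with hA
    set B := Complex.exp (((p * x : ℝ) : ℂ) * Complex.I) with hB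
    have hg : genFun α x = -(r : ℂ) * (e0 * ((p : ℂ) * A + (1 - p) * B)) := by
      rw [genFun_eq h1 h2 hx0 hx, ← hr, mul_add e0, mul_left_comm, mul_left_comm e0, he0, hA, hB,
        ← Complex.exp_add, ← Complex.exp_add, hp]
      push_cast
      ring_nf
    have hq : Complex.exp (((α * (-(Real.pi / 2)) : ℝ) : ℂ) * Complex.I) = -e0 := by
      rw [he0, ← Complex.exp_sub_pi_mul_I]
      congr 1
      rw [hp]
      push_cast
      ring
    have hp0 : 0 ≤ p := by rw [hp]; linarith
    have hp1 : p ≤ 1 := by rw [hp]; linarith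
    -- The source of second order: the phases are -(1-p)x and px with weights p and 1-p, so the
    -- linear terms cancel.
    have hS1 : ‖(p : ℂ) * A + (1 - p) * B - 1‖ ≤ 2 * x ^ 2 := by
      have e1 : (p : ℂ) * A + (1 - p) * B - 1 =
          (p : ℂ) * (A - 1 - ((-((1 - p) * x) : ℝ) : ℂ) * Complex.I) +
            ((1 - p : ℝ) : ℂ) * (B - 1 - ((p * x : ℝ) : ℂ) * Complex.I) := by
        push_cast
        ring
      rw [e1]
      refine (norm_add_le _ _).trans ?_
      rw [norm_mul, norm_mul, Complex.norm_real, Complex.norm_real, Real.norm_eq_abs,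
        Real.norm_eq_abs, abs_of_nonneg hp0, abs_of_nonneg (sub_nonneg.2 hp1)]
      have b1 := norm_cexp_sub_one_sub_le (-((1 - p) * x))
      have b2 := norm_cexp_sub_one_sub_le (p * x)
      have b1' : 2 * (-((1 - p) * x)) ^ 2 ≤ 2 * x ^ 2 := by
        have : (1 - p) ^ 2 ≤ 1 := by nlinarith
        nlinarith [sq_nonneg x]
      have b2' : 2 * (p * x) ^ 2 ≤ 2 * x ^ 2 := by
        have : p ^ 2 ≤ 1 := by nlinarith
        nlinarith [sq_nonneg x]
      nlinarith [mul_le_mul_of_nonneg_left (b1.trans b1') hp0,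
        mul_le_mul_of_nonneg_left (b2.trans b2') (sub_nonneg.2 hp1)]
    have hSn : ‖(p : ℂ) * A + (1 - p) * B‖ ≤ 1 := by
      refine (norm_add_le _ _).trans ?_
      rw [show (1 - p : ℂ) = ((1 - p : ℝ) : ℂ) by push_cast; rfl, norm_mul, norm_mul, hA, hB,
        Complex.norm_exp_ofReal_mul_I, Complex.norm_exp_ofReal_mul_I, Complex.norm_real,
        Complex.norm_real, Real.norm_eq_abs, Real.norm_eq_abs, abs_of_nonneg hp0,
        abs_of_nonneg (sub_nonneg.2 hp1)]
      linarith
    have he0n : ‖e0‖ = 1 := Complex.norm_exp_ofReal_mul_I _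
    have e2 : genFun α x - ((x ^ α : ℝ) : ℂ) * -e0 =
        -e0 * (((r - x ^ α : ℝ) : ℂ) * ((p : ℂ) * A + (1 - p) * B) +
          ((x ^ α : ℝ) : ℂ) * ((p : ℂ) * A + (1 - p) * B - 1)) := by
      rw [hg]
      push_cast
      ring
    rw [hpolar, hq, e2, norm_mul, norm_neg, he0n, one_mul]
    refine (norm_add_le _ _).trans ?_
    rw [norm_mul, norm_mul, Complex.norm_real, Complex.norm_real, Real.norm_eq_abs,
      Real.norm_eq_abs, abs_of_nonneg hxa]
    have b3 := rpow_sub_rpow_two_sin_le h1 h2 hx0 hx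
    have b4 : |r - x ^ α| * ‖(p : ℂ) * A + (1 - p) * B‖ ≤ x ^ α * (x ^ 2 / 2) :=
      (mul_le_of_le_one_right (abs_nonneg _) hSn).trans b3
    have b5 := mul_le_mul_of_nonneg_left hS1 hxa
    nlinarith [mul_nonneg hxa (sq_nonneg x), mul_nonneg hS (mul_nonneg hxa (sq_nonneg x))]
  -- Beyond π no cancellation is needed: both terms are dominated by multiples of x^(α+2).
  · have hx1 : 1 ≤ x := by linarith [Real.pi_gt_three]
    refine (norm_sub_le _ _).trans ?_
    rw [hpolar, norm_mul, Complex.norm_exp_ofReal_mul_I, mul_one, Complex.norm_real,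
      Real.norm_eq_abs, abs_of_nonneg hxa]
    have b1 := norm_genFun_le h1 h2 x
    have b2 : 1 ≤ x ^ α := Real.one_le_rpow hx1 (by linarith)
    have b3 : 1 ≤ x ^ 2 := by nlinarith
    have b4 : x ^ α ≤ x ^ α * x ^ 2 := le_mul_of_one_le_right hxa b3
    nlinarith [mul_le_mul_of_nonneg_left (b2.trans b4) hS]

lemma norm_genFun_sub_le {α : ℝ} (h1 : 1 < α) (h2 : α < 2) (x : ℝ) :
    ‖genFun α x - (-((x : ℂ) * Complex.I)) ^ (α : ℂ)‖ ≤
      (4 + ∑' k, |weight α k|) * |x| ^ (α + 2) := by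
  rcases le_total 0 x with h | h
  · rw [abs_of_nonneg h]
    exact norm_genFun_sub_le_of_nonneg h1 h2 h
  · have := norm_genFun_sub_le_of_nonneg h1 h2 (neg_nonneg.2 h)
    rw [abs_of_nonpos h]
    refine le_of_eq_of_le ?_ this
    rw [genFun_neg, ← RCLike.norm_conj]
    congr 1
    rw [map_sub]
    congr 1
    rcases h.eq_or_lt with rfl | h
    · simp [Complex.zero_cpow (show (α : ℂ) ≠ 0 by norm_cast; linarith)]
    have harg : (-(((-x : ℝ) : ℂ) * Complex.I)).arg ≠ Real.pi := by
      refine Complex.slitPlane_arg_ne_pi (Complex.mem_slitPlane_iff.2 (Or.inr ?_))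
      simp [h.ne]
    have h3 := Complex.cpow_conj (-(((-x : ℝ) : ℂ) * Complex.I)) (α : ℂ) harg
    rw [Complex.conj_ofReal] at h3
    rw [h3, map_neg, map_mul, Complex.conj_ofReal, Complex.conj_I]
    push_cast
    ring_nf

/-! ### Sectoriality of the Toeplitz matrices -/

lemma integral_cexp_int_mul (n : ℤ) :
    ∫ θ in (-Real.pi)..Real.pi, Complex.exp (((n * θ : ℝ) : ℂ) * Complex.I) =
      if n = 0 then 2 * (Real.pi : ℂ) else 0 := by
  rcases eq_or_ne n 0 with rfl | hn
  · simp
    ring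
  · rw [if_neg hn]
    have hc : (n : ℂ) * Complex.I ≠ 0 := mul_ne_zero (by exact_mod_cast hn) Complex.I_ne_zero
    have e : ∀ θ : ℝ, Complex.exp (((n * θ : ℝ) : ℂ) * Complex.I) =
        Complex.exp ((n : ℂ) * Complex.I * θ) := by
      intro θ
      congr 1
      push_cast
      ring
    simp only [e]
    rw [integral_exp_mul_complex hc]
    have e2 : (n : ℂ) * Complex.I * (Real.pi : ℝ) =
        (n : ℂ) * Complex.I * ((-Real.pi : ℝ) : ℂ) + n * (2 * Real.pi * Complex.I) := by
      push_cast
      ring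
    rw [e2, Complex.exp_periodic.int_mul n, sub_self, zero_div]

/-- The Fourier coefficients of g are the entries of W, by termwise integration and orthogonality.
-/
lemma integral_genFun_mul {α : ℝ} (h1 : 1 < α) (h2 : α < 2) (i j : ℕ) :
    ∫ θ in (-Real.pi)..Real.pi,
        genFun α θ * Complex.exp (((((j : ℤ) - (i : ℤ) : ℤ) * θ : ℝ) : ℂ) * Complex.I) =
      2 * Real.pi * ((if j ≤ i + 1 then weight α (i + 1 - j) else 0 : ℝ) : ℂ) := by
  set c : ℝ → ℂ := fun θ => Complex.exp (((((j : ℤ) - (i : ℤ) : ℤ) * θ : ℝ) : ℂ) * Complex.I)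
  set F : ℕ → ℝ → ℂ := fun k θ => (weight α k : ℂ) *
    Complex.exp (((((k : ℝ) - 1) * θ : ℝ) : ℂ) * Complex.I) * c θ
  have hF : ∀ k θ, ‖F k θ‖ ≤ |weight α k| := by
    intro k θ
    simp only [F, c, norm_mul, Complex.norm_exp_ofReal_mul_I, mul_one, Complex.norm_real,
      Real.norm_eq_abs, le_refl]
  have hs : HasSum (fun k => ∫ θ in (-Real.pi)..Real.pi, F k θ)
      (∫ θ in (-Real.pi)..Real.pi, genFun α θ * c θ) := by
    refine intervalIntegral.hasSum_integral_of_dominated_convergence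
      (fun k _ => |weight α k|) (fun k => ?_) (fun k => ?_) ?_ ?_ ?_
    · exact (by fun_prop : Continuous (F k)).aestronglyMeasurable
    · exact Filter.Eventually.of_forall fun θ _ => hF k θ
    · exact Filter.Eventually.of_forall fun θ _ => summable_abs_weight h1 h2
    · exact intervalIntegrable_const
    · exact Filter.Eventually.of_forall fun θ _ => (hasSum_genFun h1 h2 θ).mul_right _
  have hval : ∀ k : ℕ, ∫ θ in (-Real.pi)..Real.pi, F k θ =
      (weight α k : ℂ) * if (k : ℤ) - 1 + (j - i) = 0 then 2 * (Real.pi : ℂ) else 0 := by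
    intro k
    rw [← integral_cexp_int_mul, ← intervalIntegral.integral_const_mul]
    refine intervalIntegral.integral_congr fun θ _ => ?_
    simp only [F, c]
    rw [mul_assoc, ← Complex.exp_add]
    congr 2
    push_cast
    ring
  rw [← hs.tsum_eq]
  simp only [hval]
  split_ifs with h
  · rw [tsum_eq_single (i + 1 - j) fun k hk => ?_]
    · rw [if_pos (by omega)]
      ring
    · rw [if_neg (by omega), mul_zero]
  · rw [Complex.ofReal_zero, mul_zero]
    convert tsum_zero with k
    rw [if_neg (by omega), mul_zero]

/-- The trigonometric polynomial with coefficients `x`. -/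
def trigPoly {m : ℕ} (x : Fin m → ℝ) (θ : ℝ) : ℂ :=
  ∑ j : Fin m, (x j : ℂ) * Complex.exp ((((j : ℕ) * θ : ℝ) : ℂ) * Complex.I)

lemma continuous_trigPoly {m : ℕ} (x : Fin m → ℝ) : Continuous (trigPoly x) := by
  unfold trigPoly
  fun_prop

lemma integral_genFun_trigPoly {α : ℝ} (h1 : 1 < α) (h2 : α < 2) {m : ℕ} (x y : Fin m → ℝ) :
    ∫ θ in (-Real.pi)..Real.pi,
        genFun α θ * (trigPoly y θ * (starRingEnd ℂ) (trigPoly x θ)) =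
      2 * Real.pi * (((toeplitzW α m *ᵥ y) ⬝ᵥ x : ℝ) : ℂ) := by
  have e : ∀ θ : ℝ, genFun α θ * (trigPoly y θ * (starRingEnd ℂ) (trigPoly x θ)) =
      ∑ i : Fin m, ∑ j : Fin m, ((x i : ℂ) * y j) * (genFun α θ *
        Complex.exp (((((j : ℕ) : ℤ) - ((i : ℕ) : ℤ) : ℤ) * θ : ℝ) * Complex.I)) := by
    intro θ
    simp only [trigPoly, map_sum, map_mul, Complex.conj_ofReal, ← Complex.exp_conj, Complex.conj_I]
    rw [Finset.sum_mul_sum, Finset.sum_comm, Finset.mul_sum]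
    refine Finset.sum_congr rfl fun i _ => ?_
    rw [Finset.mul_sum]
    refine Finset.sum_congr rfl fun j _ => ?_
    rw [show Complex.exp (((((j : ℕ) : ℤ) - ((i : ℕ) : ℤ) : ℤ) * θ : ℝ) * Complex.I) =
      Complex.exp ((((j : ℕ) * θ : ℝ) : ℂ) * Complex.I) *
        Complex.exp ((((i : ℕ) * θ : ℝ) : ℂ) * -Complex.I) by
      rw [← Complex.exp_add]; congr 1; push_cast; ring]
    ring
  have hint : ∀ i j : Fin m, IntervalIntegrable (fun θ : ℝ => ((x i : ℂ) * y j) * (genFun α θ *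
        Complex.exp (((((j : ℕ) : ℤ) - ((i : ℕ) : ℤ) : ℤ) * θ : ℝ) * Complex.I))) volume
        (-Real.pi) Real.pi := by
    intro i j
    have := continuous_genFun h1 h2
    exact (by fun_prop : Continuous _).intervalIntegrable _ _
  simp only [e]
  have hint' : ∀ i ∈ Finset.univ (α := Fin m), IntervalIntegrable (fun θ : ℝ =>
      ∑ j : Fin m, ((x i : ℂ) * y j) * (genFun α θ *
        Complex.exp (((((j : ℕ) : ℤ) - ((i : ℕ) : ℤ) : ℤ) * θ : ℝ) * Complex.I))) volume
        (-Real.pi) Real.pi := by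
    intro i _
    have := continuous_genFun h1 h2
    exact (by fun_prop : Continuous _).intervalIntegrable _ _
  rw [intervalIntegral.integral_finsetSum hint']
  simp only [dotProduct, Matrix.mulVec, Finset.sum_mul, Complex.ofReal_sum, Finset.mul_sum]
  refine Finset.sum_congr rfl fun i _ => ?_
  rw [intervalIntegral.integral_finsetSum fun j _ => hint i j]
  refine Finset.sum_congr rfl fun j _ => ?_
  rw [intervalIntegral.integral_const_mul, integral_genFun_mul h1 h2]
  simp only [toeplitzW, Matrix.of_apply]
  push_cast
  ring

lemma integral_re_neg_genFun {α : ℝ} (h1 : 1 < α) (h2 : α < 2) {m : ℕ} (x : Fin m → ℝ) :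
    ∫ θ in (-Real.pi)..Real.pi, (-genFun α θ).re * ‖trigPoly x θ‖ ^ 2 =
      2 * Real.pi * -((toeplitzW α m *ᵥ x) ⬝ᵥ x) := by
  have h := integral_genFun_trigPoly h1 h2 x x
  have hg := continuous_genFun h1 h2
  have hx := continuous_trigPoly x
  have hi : IntervalIntegrable (fun θ : ℝ =>
      genFun α θ * (trigPoly x θ * (starRingEnd ℂ) (trigPoly x θ))) volume (-Real.pi) Real.pi :=
    (hg.mul (hx.mul (Complex.continuous_conj.comp hx))).intervalIntegrable _ _
  have h3 := congrArg Complex.re h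
  have h4 := Complex.reCLM.intervalIntegral_comp_comm hi
  simp only [Complex.reCLM_apply] at h4
  rw [← h4] at h3
  have e : ∀ θ, (genFun α θ * (trigPoly x θ * (starRingEnd ℂ) (trigPoly x θ))).re =
      -((-genFun α θ).re * ‖trigPoly x θ‖ ^ 2) := by
    intro θ
    rw [Complex.mul_conj, Complex.re_mul_ofReal, Complex.normSq_eq_norm_sq, Complex.neg_re]
    ring
  simp only [e] at h3
  rw [intervalIntegral.integral_neg] at h3
  have h5 : (2 * (Real.pi : ℂ) * (((toeplitzW α m *ᵥ x) ⬝ᵥ x : ℝ) : ℂ)).re =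
      2 * Real.pi * ((toeplitzW α m *ᵥ x) ⬝ᵥ x) := by
    rw [Complex.re_mul_ofReal]
    simp
  rw [h5] at h3
  linarith

/-- In the integral representation, ς|g| ≤ Re(-g) holds pointwise, and the product of the two
trigonometric polynomials is split by the weighted AM-GM inequality. The free parameter s is
optimised later. -/
lemma varsigma_mul_abs_le {α : ℝ} (h1 : 1 < α) (h2 : α < 2) {m : ℕ} (x y : Fin m → ℝ) {s : ℝ}
    (hs : 0 < s) :
    varsigma α * |(toeplitzW α m *ᵥ y) ⬝ᵥ x| ≤
      (s * -((toeplitzW α m *ᵥ y) ⬝ᵥ y) + s⁻¹ * -((toeplitzW α m *ᵥ x) ⬝ᵥ x)) / 2 := by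
  have hpi := Real.pi_pos
  have hς := varsigma_pos h1 h2
  have hg := continuous_genFun h1 h2
  have hx := continuous_trigPoly x
  have hy := continuous_trigPoly y
  have h := congrArg norm (integral_genFun_trigPoly h1 h2 x y)
  rw [norm_mul, Complex.norm_real, Real.norm_eq_abs, norm_mul, Complex.norm_real,
    Complex.norm_ofNat, Real.norm_eq_abs, abs_of_pos hpi] at h
  have hle : varsigma α * ‖∫ θ in (-Real.pi)..Real.pi,
        genFun α θ * (trigPoly y θ * (starRingEnd ℂ) (trigPoly x θ))‖ ≤
      ∫ θ in (-Real.pi)..Real.pi, (s / 2 * ((-genFun α θ).re * ‖trigPoly y θ‖ ^ 2) +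
        s⁻¹ / 2 * ((-genFun α θ).re * ‖trigPoly x θ‖ ^ 2)) := by
    refine (mul_le_mul_of_nonneg_left
      (intervalIntegral.norm_integral_le_integral_norm (by linarith)) hς.le).trans ?_
    rw [← intervalIntegral.integral_const_mul]
    have hre : Continuous fun θ => (-genFun α θ).re := Complex.continuous_re.comp hg.neg
    refine intervalIntegral.integral_mono_on (by linarith) ?_ ?_ fun θ hθ => ?_
    · exact (continuous_const.mul (hg.mul
        (hy.mul (Complex.continuous_conj.comp hx))).norm).intervalIntegrable _ _
    · exact (by fun_prop : Continuous _).intervalIntegrable _ _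
    · rw [norm_mul, norm_mul, RCLike.norm_conj]
      have h3 := varsigma_mul_norm_le h1 h2 hθ
      set R := (-genFun α θ).re
      have hR : 0 ≤ R := le_trans (by positivity) h3
      set a := ‖trigPoly y θ‖
      set b := ‖trigPoly x θ‖
      have h4 : a * b ≤ s / 2 * a ^ 2 + s⁻¹ / 2 * b ^ 2 := by
        have h5 : 0 ≤ s / 2 * (a - s⁻¹ * b) ^ 2 := by positivity
        have h6 : s / 2 * (a - s⁻¹ * b) ^ 2 =
            s / 2 * a ^ 2 + s⁻¹ / 2 * b ^ 2 - a * b := by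
          field_simp
          ring
        linarith
      calc varsigma α * (‖genFun α θ‖ * (a * b)) = (varsigma α * ‖genFun α θ‖) * (a * b) := by ring
        _ ≤ R * (a * b) := mul_le_mul_of_nonneg_right h3 (by positivity)
        _ ≤ R * (s / 2 * a ^ 2 + s⁻¹ / 2 * b ^ 2) := mul_le_mul_of_nonneg_left h4 hR
        _ = _ := by ring
  have hre : Continuous fun θ => (-genFun α θ).re := Complex.continuous_re.comp hg.neg
  rw [h, intervalIntegral.integral_add ((by fun_prop : Continuous _).intervalIntegrable _ _)
    ((by fun_prop : Continuous _).intervalIntegrable _ _), intervalIntegral.integral_const_mul,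
    intervalIntegral.integral_const_mul, integral_re_neg_genFun h1 h2,
    integral_re_neg_genFun h1 h2] at hle
  have h2pi : 0 < 2 * Real.pi := by linarith
  refine le_of_mul_le_mul_left ?_ h2pi
  linarith

/-- For y = x and s = 1 the sector bound reads ς|Q| ≤ -Q. -/
lemma toeplitzW_form_nonpos {α : ℝ} (h1 : 1 < α) (h2 : α < 2) {m : ℕ} (x : Fin m → ℝ) :
    (toeplitzW α m *ᵥ x) ⬝ᵥ x ≤ 0 := by
  have h := varsigma_mul_abs_le h1 h2 x x one_pos
  have := mul_nonneg (varsigma_pos h1 h2).le (abs_nonneg ((toeplitzW α m *ᵥ x) ⬝ᵥ x))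
  rw [inv_one] at h
  linarith

/-- Negativity of `W (I + K)` for a diagonal matrix `K` that differs from a constant by a convex
sequence, up to sign. -/
lemma toeplitzW_mul_form_nonpos {α : ℝ} (h1 : 1 < α) (h2 : α < 2) {m : ℕ} (E : ℕ → ℝ)
    {d κ σ : ℝ} (hd : 0 ≤ d) (hσ : |σ| = 1) (hE : ∀ i < m, 0 ≤ E i) (hEd : ∀ i < m, E i ≤ d)
    (hconv : ∀ i k, k ≤ i → i + k < m → 2 * E i ≤ E (i - k) + E (i + k))
    (hκ : 0 ≤ 1 + κ - Real.sqrt 2 * d / varsigma α) (x : Fin m → ℝ) :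
    (toeplitzW α m *ᵥ fun i => (1 + κ + σ * E i) * x i) ⬝ᵥ x ≤ 0 := by
  have hς := varsigma_pos h1 h2
  set y : Fin m → ℝ := fun i => E i * x i with hy
  have e : (fun i : Fin m => (1 + κ + σ * E i) * x i) = (1 + κ) • x + σ • y := by
    ext i
    simp [hy]
    ring
  rw [e, Matrix.mulVec_add, Matrix.mulVec_smul, Matrix.mulVec_smul, add_dotProduct, smul_dotProduct,
    smul_dotProduct, smul_eq_mul, smul_eq_mul]
  have hQ := toeplitzW_form_nonpos h1 h2 x
  have hEQ := toeplitzW_convex_mul h1 h2 E d hE hEd hconv x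
  rw [← hy] at hEQ
  set Q := (toeplitzW α m *ᵥ x) ⬝ᵥ x
  set B := (toeplitzW α m *ᵥ y) ⬝ᵥ x
  have hB : varsigma α * |B| ≤ Real.sqrt 2 * d * -Q := by
    rcases hd.eq_or_lt with rfl | hd
    · have : y = 0 := by
        ext i
        have : E i = 0 := le_antisymm (hEd i i.2) (hE i i.2)
        simp [hy, this]
      simp [B, this]
    · have h22 : Real.sqrt 2 * Real.sqrt 2 = 2 := Real.mul_self_sqrt zero_le_two
      have hs2 : 0 < Real.sqrt 2 := Real.sqrt_pos.2 zero_lt_two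
      -- This s balances the two terms: the first is at most s·2d²(-Q) = √2 d(-Q), which equals
      -- s⁻¹(-Q). The case d = 0 is separate because s would degenerate.
      have hs : 0 < (Real.sqrt 2 * d)⁻¹ := by positivity
      refine (varsigma_mul_abs_le h1 h2 x y hs).trans ?_
      have h3 := mul_le_mul_of_nonneg_left hEQ hs.le
      rw [inv_inv]
      have h4 : (Real.sqrt 2 * d)⁻¹ * (2 * d ^ 2 * -Q) = Real.sqrt 2 * d * -Q := by
        field_simp
        linear_combination Q * h22
      linarith
  have h5 : |B| ≤ Real.sqrt 2 * d / varsigma α * -Q := by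
    rw [div_mul_eq_mul_div, le_div_iff₀ hς]
    linarith
  have h6 : σ * B ≤ |B| := by
    calc σ * B ≤ |σ * B| := le_abs_self _
      _ = |B| := by rw [abs_mul, hσ, one_mul]
  nlinarith

/-! ### Stability of the scheme -/

/-- One step of a Crank-Nicolson scheme with a dissipative matrix in a weighted norm. -/
lemma crankNicolson_step_le {m : ℕ} (A : Matrix (Fin m) (Fin m) ℝ) (D : Fin m → ℝ)
    (hD : ∀ i, 0 ≤ D i) (hA : ∀ v : Fin m → ℝ, ∑ i, D i * (A *ᵥ v) i * v i ≤ 0) {ν τ : ℝ}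
    (hν : 0 ≤ ν) (hτ : 0 ≤ τ) (e₀ e₁ r : Fin m → ℝ)
    (h : (1 - ν • A) *ᵥ e₁ = (1 + ν • A) *ᵥ e₀ + τ • r) :
    Real.sqrt (∑ i, D i * e₁ i ^ 2) ≤
      Real.sqrt (∑ i, D i * e₀ i ^ 2) + τ * Real.sqrt (∑ i, D i * r i ^ 2) := by
  have hN : ∀ v : Fin m → ℝ, 0 ≤ ∑ i, D i * v i ^ 2 := fun v =>
    Finset.sum_nonneg fun i _ => mul_nonneg (hD i) (sq_nonneg _)
  have hcs : ∀ v w : Fin m → ℝ, ∑ i, D i * v i * w i ≤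
      Real.sqrt (∑ i, D i * v i ^ 2) * Real.sqrt (∑ i, D i * w i ^ 2) := by
    intro v w
    have := Real.sum_mul_le_sqrt_mul_sqrt Finset.univ (fun i => Real.sqrt (D i) * v i)
      (fun i => Real.sqrt (D i) * w i)
    simp only [mul_pow, Real.sq_sqrt (hD _)] at this
    refine le_of_eq_of_le (Finset.sum_congr rfl fun i _ => ?_) this
    have := Real.mul_self_sqrt (hD i)
    linear_combination (-(v i * w i)) * this
  have hi : ∀ i, e₁ i - e₀ i = ν * (A *ᵥ (e₁ + e₀)) i + τ * r i := by
    intro i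
    have := congrFun h i
    simp only [Matrix.sub_mulVec, Matrix.add_mulVec, Matrix.one_mulVec, Matrix.smul_mulVec,
      Pi.sub_apply, Pi.add_apply, Pi.smul_apply, smul_eq_mul] at this
    rw [Matrix.mulVec_add, Pi.add_apply]
    linarith
  -- The scheme is tested with D(e₁ + e₀); the A-term has the good sign.
  have henergy : ∑ i, D i * e₁ i ^ 2 - ∑ i, D i * e₀ i ^ 2 ≤
      τ * (∑ i, D i * r i * e₁ i + ∑ i, D i * r i * e₀ i) := by
    have e : ∑ i, D i * e₁ i ^ 2 - ∑ i, D i * e₀ i ^ 2 =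
        ν * ∑ i, D i * (A *ᵥ (e₁ + e₀)) i * (e₁ + e₀) i +
          τ * (∑ i, D i * r i * e₁ i + ∑ i, D i * r i * e₀ i) := by
      rw [← Finset.sum_sub_distrib, ← Finset.sum_add_distrib, Finset.mul_sum, Finset.mul_sum,
        ← Finset.sum_add_distrib]
      refine Finset.sum_congr rfl fun i _ => ?_
      rw [Pi.add_apply]
      linear_combination (D i * (e₁ i + e₀ i)) * hi i
    have := mul_nonpos_of_nonneg_of_nonpos hν (hA (e₁ + e₀))
    linarith
  have c1 := hcs r e₁
  have c0 := hcs r e₀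
  have q1 := Real.sq_sqrt (hN e₁)
  have q0 := Real.sq_sqrt (hN e₀)
  have p1 := Real.sqrt_nonneg (∑ i, D i * e₁ i ^ 2)
  have p0 := Real.sqrt_nonneg (∑ i, D i * e₀ i ^ 2)
  have pr := Real.sqrt_nonneg (∑ i, D i * r i ^ 2)
  set n₁ := Real.sqrt (∑ i, D i * e₁ i ^ 2)
  set n₀ := Real.sqrt (∑ i, D i * e₀ i ^ 2)
  set n := Real.sqrt (∑ i, D i * r i ^ 2)
  have key : n₁ ^ 2 - n₀ ^ 2 ≤ τ * n * (n₁ + n₀) := by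
    nlinarith [mul_le_mul_of_nonneg_left c1 hτ, mul_le_mul_of_nonneg_left c0 hτ]
  -- If n₁ > n₀ + τn, then n₁ + n₀ > 0 and (n₁ - n₀)(n₁ + n₀) > τn(n₁ + n₀), against `key`.
  by_contra! hcon
  nlinarith [mul_nonneg hτ pr]

/-! ### Laplace transforms -/

/-- Analytic continuation from real s. The left side is the complex moment generating function of -t
under t^(a-1)dt, hence analytic on Re s > 0; it agrees with the right side on the positive reals,
which accumulate at 1. -/
lemma integral_rpow_mul_cexp_neg {a : ℝ} (ha : 0 < a) {s : ℂ} (hs : 0 < s.re) :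
    ∫ t in Ioi (0 : ℝ), ((t ^ (a - 1) : ℝ) : ℂ) * Complex.exp (-(s * t)) =
      s ^ (-a : ℂ) * Real.Gamma a := by
  set μ : Measure ℝ := (volume.restrict (Ioi (0 : ℝ))).withDensity
    fun t => (Real.toNNReal (t ^ (a - 1)) : ENNReal) with hμ
  have hmeas : Measurable fun t : ℝ => Real.toNNReal (t ^ (a - 1)) := by fun_prop
  set X : ℝ → ℝ := fun t => -t with hX
  have hmgf : ∀ z : ℂ, ProbabilityTheory.complexMGF X μ z =
      ∫ t in Ioi (0 : ℝ), ((t ^ (a - 1) : ℝ) : ℂ) * Complex.exp (-(z * t)) := by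
    intro z
    rw [ProbabilityTheory.complexMGF, hμ, integral_withDensity_eq_integral_smul hmeas]
    refine setIntegral_congr_fun measurableSet_Ioi fun t ht => ?_
    have ht' : 0 ≤ t ^ (a - 1) := Real.rpow_nonneg (le_of_lt ht) _
    simp only [hX, NNReal.smul_def, Real.coe_toNNReal _ ht', Complex.real_smul]
    push_cast
    ring_nf
  have hset : Ioi (0 : ℝ) ⊆ ProbabilityTheory.integrableExpSet X μ := by
    intro r hr
    have hr : 0 < r := hr
    change Integrable (fun t => Real.exp (r * X t)) μ
    rw [hμ, integrable_withDensity_iff_integrable_smul₀ hmeas.aemeasurable]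
    have h1 : IntegrableOn (fun t : ℝ => t ^ (a - 1) * Real.exp (-(r * t))) (Ioi 0) := by
      have := integrableOn_rpow_mul_exp_neg_mul_rpow (by linarith : -1 < a - 1) one_pos hr
      simpa only [Real.rpow_one, neg_mul] using this
    refine h1.congr_fun (fun t ht => ?_) measurableSet_Ioi
    have ht' : 0 ≤ t ^ (a - 1) := Real.rpow_nonneg (le_of_lt ht) _
    simp only [hX, NNReal.smul_def, Real.coe_toNNReal _ ht', smul_eq_mul]
    ring_nf
  set U : Set ℂ := {z | 0 < z.re} with hU
  have hUo : IsOpen U := isOpen_lt continuous_const Complex.continuous_re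
  have hf : AnalyticOnNhd ℂ (ProbabilityTheory.complexMGF X μ) U :=
    ProbabilityTheory.analyticOnNhd_complexMGF.mono fun z hz =>
      interior_mono hset (by rw [interior_Ioi]; exact hz)
  have hg : AnalyticOnNhd ℂ (fun z : ℂ => z ^ (-a : ℂ) * Real.Gamma a) U := by
    refine DifferentiableOn.analyticOnNhd (fun z hz => ?_) hUo
    exact ((differentiableAt_id.cpow_const (Or.inl hz)).mul_const _).differentiableWithinAt
  have hUc : IsPreconnected U := (convex_halfSpace_re_gt 0).isPreconnected
  have hfreq : ∃ᶠ z in nhdsWithin (1 : ℂ) {1}ᶜ,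
      ProbabilityTheory.complexMGF X μ z = z ^ (-a : ℂ) * Real.Gamma a := by
    have ht : Filter.Tendsto (fun r : ℝ => (r : ℂ)) (nhdsWithin 1 {1}ᶜ)
        (nhdsWithin (1 : ℂ) {1}ᶜ) := by
      refine tendsto_nhdsWithin_of_tendsto_nhds_of_eventually_within _ ?_ ?_
      · have := Complex.continuous_ofReal.tendsto 1
        rw [Complex.ofReal_one] at this
        exact this.mono_left nhdsWithin_le_nhds
      · filter_upwards [self_mem_nhdsWithin] with r hr
        simpa using hr
    refine ht.frequently (Filter.Eventually.frequently ?_)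
    have h0 : ∀ᶠ r : ℝ in nhdsWithin 1 {1}ᶜ, 0 < r :=
      nhdsWithin_le_nhds (lt_mem_nhds one_pos)
    filter_upwards [h0] with r hr
    rw [hmgf]
    have := Complex.integral_cpow_mul_exp_neg_mul_Ioi (a := a) (r := r) (by simpa using ha) hr
    rw [Complex.Gamma_ofReal, one_div, Complex.inv_cpow _ _ (by
      rw [Complex.arg_ofReal_of_nonneg hr.le]; exact Real.pi_pos.ne), ← Complex.cpow_neg] at this
    rw [← this]
    refine setIntegral_congr_fun measurableSet_Ioi fun t ht => ?_
    rw [Complex.ofReal_cpow (le_of_lt ht)]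
    push_cast
    rfl
  rw [← hmgf]
  exact AnalyticOnNhd.eqOn_of_preconnected_of_frequently_eq hf hg hUc
    (show (1 : ℂ) ∈ U by simp [hU]) hfreq hs

/-- The kernel of the fractional integral of order `2 - α`, up to a constant. -/
def powKernel (α t : ℝ) : ℝ := (Ioi (0 : ℝ)).indicator (fun t => t ^ (1 - α)) t

lemma leftKernelIntegralLine_eq {α : ℝ} (h1 : 1 < α) (v : ℝ → ℝ) (x : ℝ) :
    leftKernelIntegralLine α v x = ∫ ξ, v ξ * powKernel α (x - ξ) := by
  rw [leftKernelIntegralLine, ← integral_indicator measurableSet_Iic]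
  refine integral_congr_ae (Filter.Eventually.of_forall fun ξ => ?_)
  simp only [powKernel]
  rcases lt_trichotomy ξ x with h | h | h
  · rw [indicator_of_mem (mem_Iic.2 h.le), indicator_of_mem (mem_Ioi.2 (sub_pos.2 h)),
      div_eq_mul_inv, ← Real.rpow_neg (sub_pos.2 h).le, neg_sub]
  -- At ξ = x the integrand is a division by 0^(α-1) = 0, hence 0, matching the open half-line in
  -- `powKernel`.
  · subst h
    simp [Real.zero_rpow (show α - 1 ≠ 0 by linarith)]
  · rw [indicator_of_notMem (by simpa using h), indicator_of_notMem (by simpa using h.le), mul_zero]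

lemma laplace_powKernel {α : ℝ} (h2 : α < 2) {s : ℂ} (hs : 0 < s.re) :
    Integrable (fun t : ℝ => Complex.exp (-(s * t)) * (powKernel α t : ℂ)) ∧
      ∫ t : ℝ, Complex.exp (-(s * t)) * (powKernel α t : ℂ) =
        Real.Gamma (2 - α) * s ^ ((α - 2 : ℝ) : ℂ) := by
  have e : (fun t : ℝ => Complex.exp (-(s * t)) * (powKernel α t : ℂ)) =
      (Ioi (0 : ℝ)).indicator
        fun t => ((t ^ ((2 - α) - 1) : ℝ) : ℂ) * Complex.exp (-(s * t)) := by
    ext t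
    simp only [powKernel]
    by_cases h : t ∈ Ioi (0 : ℝ)
    · rw [indicator_of_mem h, indicator_of_mem h, mul_comm]
      congr 3
      ring
    · rw [indicator_of_notMem h, indicator_of_notMem h, Complex.ofReal_zero, mul_zero]
  rw [e]
  constructor
  · rw [integrable_indicator_iff measurableSet_Ioi]
    have := integrableOn_rpow_mul_exp_neg_mul_rpow (by linarith : -1 < (2 - α) - 1) one_pos hs
    simp only [Real.rpow_one] at this
    refine Integrable.mono this ?_ ?_
    · exact (by fun_prop : Measurable _).aestronglyMeasurable
    · filter_upwards [self_mem_ae_restrict measurableSet_Ioi] with t ht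
      rw [norm_mul, norm_mul, Complex.norm_real, Complex.norm_exp, Real.norm_eq_abs (Real.exp _),
        Real.abs_exp]
      simp
  · rw [integral_indicator measurableSet_Ioi,
      integral_rpow_mul_cexp_neg (by linarith : 0 < 2 - α) hs, mul_comm]
    congr 2
    push_cast
    ring

/-- The exponential factor distributes over the convolution, and after damping both factors are
integrable. -/
lemma laplace_leftKernelIntegralLine {α : ℝ} (h1 : 1 < α) (h2 : α < 2) {v : ℝ → ℝ}
    (hv : Continuous v) (hc : HasCompactSupport v) {s : ℂ} (hs : 0 < s.re) :
    Integrable (fun x : ℝ => Complex.exp (-(s * x)) * (leftKernelIntegralLine α v x : ℂ)) ∧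
      ∫ x : ℝ, Complex.exp (-(s * x)) * (leftKernelIntegralLine α v x : ℂ) =
        Real.Gamma (2 - α) * s ^ ((α - 2 : ℝ) : ℂ) *
          ∫ x : ℝ, Complex.exp (-(s * x)) * (v x : ℂ) := by
  obtain ⟨hk, hk'⟩ := laplace_powKernel h2 hs
  set f : ℝ → ℂ := fun x => Complex.exp (-(s * x)) * (v x : ℂ) with hf
  set g : ℝ → ℂ := fun t => Complex.exp (-(s * t)) * (powKernel α t : ℂ) with hg
  have hfi : Integrable f := by
    refine Continuous.integrable_of_hasCompactSupport (by fun_prop) ?_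
    exact (hc.comp_left (g := fun y : ℝ => (y : ℂ)) Complex.ofReal_zero).mul_left
  have e : (fun x : ℝ => Complex.exp (-(s * x)) * (leftKernelIntegralLine α v x : ℂ)) =
      convolution f g (ContinuousLinearMap.mul ℂ ℂ) volume := by
    ext x
    rw [convolution, leftKernelIntegralLine_eq h1, ← integral_complex_ofReal, ← integral_const_mul]
    refine integral_congr_ae (Filter.Eventually.of_forall fun ξ => ?_)
    simp only [hf, hg, ContinuousLinearMap.mul_apply', Complex.ofReal_mul]
    rw [show -(s * (x : ℂ)) = -(s * ξ) + -(s * ((x - ξ : ℝ) : ℂ)) by push_cast; ring,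
      Complex.exp_add]
    ring
  rw [e]
  refine ⟨hfi.integrable_convolution _ hk, ?_⟩
  rw [integral_convolution _ hfi hk, ContinuousLinearMap.mul_apply', hk', mul_comm]

lemma integrable_cexp_mul {F : ℝ → ℝ} (hF : Continuous F) {s : ℂ}
    (h : Integrable fun x => Real.exp (-(s.re * x)) * F x) :
    Integrable fun x : ℝ => Complex.exp (-(s * x)) * (F x : ℂ) := by
  refine h.mono (by fun_prop : Continuous _).aestronglyMeasurable
    (Filter.Eventually.of_forall fun x => ?_)
  rw [norm_mul, norm_mul, Complex.norm_exp, Complex.norm_real, Real.norm_eq_abs (Real.exp _),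
    Real.abs_exp]
  simp

/-- Integrating f from the left of a, with the rate ε/2, gives |F(x)| ≤ Ce^(εx/2); the remaining
half of the damping makes F integrable. All ε > 0 are treated at once so that the step can be
iterated. -/
lemma integrable_exp_mul_of_hasDerivAt {F f : ℝ → ℝ} {a : ℝ} (hF : ∀ x, HasDerivAt F (f x) x)
    (hf : Continuous f) (h0 : ∀ x < a, F x = 0)
    (hint : ∀ ε > 0, Integrable fun x => Real.exp (-(ε * x)) * f x) :
    ∀ ε > 0, Integrable fun x => Real.exp (-(ε * x)) * F x := by
  intro ε hε
  have hε2 : 0 < ε / 2 := by linarith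
  have hi := hint (ε / 2) hε2
  set C := ∫ x, |Real.exp (-(ε / 2 * x)) * f x| with hC
  have hC0 : 0 ≤ C := integral_nonneg fun _ => abs_nonneg _
  have hFc : Continuous F := continuous_iff_continuousAt.2 fun x => (hF x).continuousAt
  have hbd : ∀ x, |F x| ≤ Real.exp (ε / 2 * x) * C := by
    intro x
    obtain ⟨y, hy⟩ := exists_lt (min x a)
    have hyx : y ≤ x := (hy.trans_le (min_le_left _ _)).le
    have hya : y < a := hy.trans_le (min_le_right _ _)
    have hftc : ∫ t in y..x, f t = F x := by
      rw [intervalIntegral.integral_eq_sub_of_hasDerivAt (fun t _ => hF t)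
        (hf.intervalIntegrable _ _), h0 y hya, sub_zero]
    rw [← hftc, ← Real.norm_eq_abs]
    refine (intervalIntegral.norm_integral_le_integral_norm hyx).trans ?_
    have hle : ∫ t in y..x, ‖f t‖ ≤
        ∫ t in y..x, Real.exp (ε / 2 * x) * |Real.exp (-(ε / 2 * t)) * f t| := by
      refine intervalIntegral.integral_mono_on hyx (hf.norm.intervalIntegrable _ _)
        ((by fun_prop : Continuous _).intervalIntegrable _ _) fun t ht => ?_
      rw [abs_mul, Real.abs_exp, ← mul_assoc, ← Real.exp_add, Real.norm_eq_abs]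
      refine le_mul_of_one_le_left (abs_nonneg _) (Real.one_le_exp ?_)
      nlinarith [ht.2]
    refine hle.trans ?_
    rw [intervalIntegral.integral_const_mul, intervalIntegral.integral_of_le hyx]
    exact mul_le_mul_of_nonneg_left
      (setIntegral_le_integral hi.abs (Filter.Eventually.of_forall fun _ => abs_nonneg _))
      (Real.exp_pos _).le
  have hdom : Integrable ((Ioi (a - 1)).indicator fun x => C * Real.exp (-(ε / 2) * x)) := by
    rw [integrable_indicator_iff measurableSet_Ioi]
    exact (exp_neg_integrableOn_Ioi (a - 1) hε2).const_mul C
  refine hdom.mono' (by fun_prop : Continuous _).aestronglyMeasurable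
    (Filter.Eventually.of_forall fun x => ?_)
  rw [norm_mul, Real.norm_eq_abs, Real.abs_exp, Real.norm_eq_abs]
  by_cases hx : x < a
  · rw [h0 x hx, abs_zero, mul_zero]
    exact indicator_nonneg (fun _ _ => by positivity) _
  · rw [indicator_of_mem (by simp only [mem_Ioi]; linarith)]
    refine (mul_le_mul_of_nonneg_left (hbd x) (Real.exp_pos _).le).trans (le_of_eq ?_)
    rw [← mul_assoc, ← Real.exp_add, mul_comm]
    congr 2
    ring

lemma laplace_deriv {F f : ℝ → ℝ} (hF : ∀ x, HasDerivAt F (f x) x) (hf : Continuous f) {s : ℂ}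
    (hFi : Integrable fun x => Real.exp (-(s.re * x)) * F x)
    (hfi : Integrable fun x => Real.exp (-(s.re * x)) * f x) :
    ∫ x : ℝ, Complex.exp (-(s * x)) * (f x : ℂ) =
      s * ∫ x : ℝ, Complex.exp (-(s * x)) * (F x : ℂ) := by
  have hFc : Continuous F := continuous_iff_continuousAt.2 fun x => (hF x).continuousAt
  have i1 := integrable_cexp_mul hFc hFi
  have i2 := integrable_cexp_mul hf hfi
  have hu : ∀ x : ℝ, HasDerivAt (fun x : ℝ => Complex.exp (-(s * x)))
      (-s * Complex.exp (-(s * x))) x := by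
    intro x
    have h := ((Complex.ofRealCLM.hasDerivAt (x := x)).const_mul s).neg.cexp
    simp only [Complex.ofRealCLM_apply, Complex.ofReal_one, mul_one] at h
    rw [mul_comm]
    exact h
  have h := integral_mul_deriv_eq_deriv_mul_of_integrable
    (u := fun x : ℝ => Complex.exp (-(s * x))) (v := fun x => (F x : ℂ))
    (u' := fun x : ℝ => -s * Complex.exp (-(s * x))) (v' := fun x => (f x : ℂ))
    (fun x _ => hu x) (fun x _ => (hF x).ofReal_comp) i2
    (by
      have := i1.const_mul (-s)
      refine this.congr (Filter.Eventually.of_forall fun x => ?_)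
      simp only [Pi.mul_apply]
      ring) i1
  rw [h, ← integral_neg, ← integral_const_mul]
  refine integral_congr_ae (Filter.Eventually.of_forall fun x => ?_)
  simp only
  ring

/-! ### The Fourier transform of the fractional derivative -/

/-- The left-sided part of the smoothness of a continuous function `v` supported in `[a, b]`. -/
structure LeftSmooth (α K a b : ℝ) (v : ℝ → ℝ) : Prop where
  continuous : Continuous v
  zero_of_notMem : ∀ x ∉ Icc a b, v x = 0
  contDiff : ContDiff ℝ 4 (leftKernelIntegralLine α v)
  integrable : Integrable (leftRLLine α v)
  fourier_integrable : Integrable (𝓕 (fun x => (leftRLLine α v x : ℂ)))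
  fourier_bound : ∫ ω, ‖𝓕 (fun x => (leftRLLine α v x : ℂ)) ω‖ ≤ K

lemma fourier_eq_integral (f : ℝ → ℂ) (ω : ℝ) :
    𝓕 f ω = ∫ x : ℝ, Complex.exp (-(((2 * Real.pi * ω : ℝ) : ℂ) * Complex.I * x)) * f x := by
  rw [Real.fourier_real_eq_integral_exp_smul]
  refine integral_congr_ae (Filter.Eventually.of_forall fun x => ?_)
  simp only [smul_eq_mul]
  congr 2
  push_cast
  ring

lemma fourierInv_eq_integral (f : ℝ → ℂ) (x : ℝ) :
    𝓕⁻ f x = ∫ ω : ℝ, Complex.exp (((2 * Real.pi * x * ω : ℝ) : ℂ) * Complex.I) * f ω := by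
  rw [Real.fourierInv_eq_fourier_neg, fourier_eq_integral]
  refine integral_congr_ae (Filter.Eventually.of_forall fun ω => ?_)
  simp only
  congr 2
  push_cast
  ring

lemma continuous_fourier_real {f : ℝ → ℂ} (hf : Integrable f) : Continuous (𝓕 f) :=
  VectorFourier.fourierIntegral_continuous Real.continuous_fourierChar
    (by simp only [innerₗ_apply_apply]; fun_prop) hf

lemma norm_fourier_le (f : ℝ → ℂ) (ω : ℝ) : ‖𝓕 f ω‖ ≤ ∫ x, ‖f x‖ :=
  VectorFourier.norm_fourierIntegral_le_integral_norm _ _ _ _ _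

namespace LeftSmooth

variable {α K a b : ℝ} {v : ℝ → ℝ}

lemma hasCompactSupport (hv : LeftSmooth α K a b v) : HasCompactSupport v :=
  HasCompactSupport.intro isCompact_Icc hv.zero_of_notMem

lemma integrable_ofReal (hv : LeftSmooth α K a b v) : Integrable (fun x => (v x : ℂ)) :=
  (hv.continuous.integrable_of_hasCompactSupport hv.hasCompactSupport).ofReal

lemma kernelIntegral_eq_zero (hv : LeftSmooth α K a b v) {x : ℝ} (hx : x < a) :
    leftKernelIntegralLine α v x = 0 := by
  rw [leftKernelIntegralLine]
  refine setIntegral_eq_zero_of_forall_eq_zero fun ξ hξ => ?_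
  rw [hv.zero_of_notMem ξ fun h => by linarith [h.1, mem_Iic.1 hξ], zero_div]

lemma iteratedDeriv_eq_zero (hv : LeftSmooth α K a b v) (k : ℕ) {x : ℝ} (hx : x < a) :
    iteratedDeriv k (leftKernelIntegralLine α v) x = 0 := by
  have h : leftKernelIntegralLine α v =ᶠ[nhds x] fun _ => 0 := by
    filter_upwards [Iio_mem_nhds hx] with y hy
    exact hv.kernelIntegral_eq_zero hy
  rw [h.iteratedDeriv_eq]
  simp

lemma hasDerivAt_iteratedDeriv (hv : LeftSmooth α K a b v) {k : ℕ} (hk : k < 4) (x : ℝ) :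
    HasDerivAt (iteratedDeriv k (leftKernelIntegralLine α v))
      (iteratedDeriv (k + 1) (leftKernelIntegralLine α v) x) x := by
  rw [iteratedDeriv_succ]
  exact (hv.contDiff.differentiable_iteratedDeriv k (by exact_mod_cast hk) x).hasDerivAt

lemma continuous_iteratedDeriv (hv : LeftSmooth α K a b v) {k : ℕ} (hk : k ≤ 4) :
    Continuous (iteratedDeriv k (leftKernelIntegralLine α v)) :=
  hv.contDiff.continuous_iteratedDeriv k (by exact_mod_cast hk)

lemma iteratedDeriv_four_eq (h2 : α < 2) (x : ℝ) :
    iteratedDeriv 4 (leftKernelIntegralLine α v) x = Real.Gamma (2 - α) * leftRLLine α v x := by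
  have hΓ : Real.Gamma (2 - α) ≠ 0 := (Real.Gamma_pos_of_pos (by linarith)).ne'
  rw [leftRLLine]
  field_simp

lemma continuous_leftRLLine (hv : LeftSmooth α K a b v) : Continuous (leftRLLine α v) :=
  continuous_const.mul (hv.continuous_iteratedDeriv le_rfl)

lemma leftRLLine_eq_zero (hv : LeftSmooth α K a b v) {x : ℝ} (hx : x < a) :
    leftRLLine α v x = 0 := by
  rw [leftRLLine, hv.iteratedDeriv_eq_zero 4 hx, mul_zero]

/-- Only the fourth derivative is known to be integrable, so the induction descends from 4. At the
top, the damping factor is bounded on [a, ∞), where the derivative can be nonzero. -/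
lemma integrable_exp_mul_iteratedDeriv (h2 : α < 2) (hv : LeftSmooth α K a b v) {k : ℕ}
    (hk : k ≤ 4) :
    ∀ ε > 0, Integrable fun x =>
      Real.exp (-(ε * x)) * iteratedDeriv k (leftKernelIntegralLine α v) x := by
  induction hk using Nat.decreasingInduction with
  | self =>
    intro ε hε
    refine ((hv.integrable.norm.const_mul (Real.exp (-(ε * a)) * Real.Gamma (2 - α)))).mono'
      ((by fun_prop : Continuous fun x => Real.exp (-(ε * x))).mul
        (hv.continuous_iteratedDeriv le_rfl)).aestronglyMeasurable
      (Filter.Eventually.of_forall fun x => ?_)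
    have hΓ : 0 < Real.Gamma (2 - α) := Real.Gamma_pos_of_pos (by linarith)
    rw [iteratedDeriv_four_eq h2, norm_mul, norm_mul, Real.norm_eq_abs, Real.abs_exp,
      Real.norm_eq_abs (Real.Gamma _), abs_of_pos hΓ, ← mul_assoc]
    rcases lt_or_ge x a with hx | hx
    · simp [hv.leftRLLine_eq_zero hx]
    · gcongr
  | of_succ k hk ih =>
    exact integrable_exp_mul_of_hasDerivAt (hv.hasDerivAt_iteratedDeriv hk)
      (hv.continuous_iteratedDeriv hk) (fun x hx => hv.iteratedDeriv_eq_zero k hx) ih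

/-- Four derivatives contribute s⁴ and the kernel s^(α-2); the Gamma factors cancel. -/
lemma laplace_leftRLLine (h1 : 1 < α) (h2 : α < 2) (hv : LeftSmooth α K a b v) {s : ℂ}
    (hs : 0 < s.re) :
    ∫ x : ℝ, Complex.exp (-(s * x)) * (leftRLLine α v x : ℂ) =
      s ^ ((α + 2 : ℝ) : ℂ) * ∫ x : ℝ, Complex.exp (-(s * x)) * (v x : ℂ) := by
  have hstep : ∀ k < 4,
      ∫ x : ℝ, Complex.exp (-(s * x)) *
        ((iteratedDeriv (k + 1) (leftKernelIntegralLine α v) x : ℝ) : ℂ) =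
      s * ∫ x : ℝ, Complex.exp (-(s * x)) *
        ((iteratedDeriv k (leftKernelIntegralLine α v) x : ℝ) : ℂ) := fun k hk =>
    laplace_deriv (hv.hasDerivAt_iteratedDeriv hk) (hv.continuous_iteratedDeriv hk)
      (hv.integrable_exp_mul_iteratedDeriv h2 hk.le _ hs)
      (hv.integrable_exp_mul_iteratedDeriv h2 hk _ hs)
  have h4 := hstep 3 (by norm_num)
  rw [hstep 2 (by norm_num), hstep 1 (by norm_num), hstep 0 (by norm_num), iteratedDeriv_zero,
    (laplace_leftKernelIntegralLine h1 h2 hv.continuous hv.hasCompactSupport hs).2] at h4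
  have hΓ : (Real.Gamma (2 - α) : ℂ) ≠ 0 := by
    exact_mod_cast (Real.Gamma_pos_of_pos (by linarith)).ne'
  have e : ∫ x : ℝ, Complex.exp (-(s * x)) *
      ((iteratedDeriv (3 + 1) (leftKernelIntegralLine α v) x : ℝ) : ℂ) =
      Real.Gamma (2 - α) * ∫ x : ℝ, Complex.exp (-(s * x)) * (leftRLLine α v x : ℂ) := by
    rw [← integral_const_mul]
    refine integral_congr_ae (Filter.Eventually.of_forall fun x => ?_)
    simp only [iteratedDeriv_four_eq h2]
    push_cast
    ring
  have hs0 : s ≠ 0 := fun h => by simp [h] at hs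
  have hpow : s ^ ((α + 2 : ℝ) : ℂ) = s ^ 4 * s ^ ((α - 2 : ℝ) : ℂ) := by
    rw [← Complex.cpow_natCast, ← Complex.cpow_add _ _ hs0]
    congr 1
    push_cast
    ring
  rw [e] at h4
  apply mul_left_cancel₀ hΓ
  rw [h4, hpow]
  ring

/-- Since f vanishes to the left of a, e^(-εx) ≤ e^|a| on the relevant set for ε < 1, which gives
domination. -/
lemma tendsto_laplace {f : ℝ → ℝ} (hf : Integrable f) (h0 : ∀ x < a, f x = 0) (y : ℝ) :
    Filter.Tendsto (fun ε : ℝ => ∫ x : ℝ, Complex.exp (-((ε + y * Complex.I) * x)) * (f x : ℂ))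
      (nhdsWithin 0 (Ioi 0))
      (nhds (∫ x : ℝ, Complex.exp (-((y : ℂ) * Complex.I * x)) * (f x : ℂ))) := by
  refine MeasureTheory.tendsto_integral_filter_of_dominated_convergence
    (fun x => Real.exp |a| * ‖f x‖) ?_ ?_ (hf.norm.const_mul _) ?_
  · refine Filter.Eventually.of_forall fun ε => ?_
    exact (by fun_prop : Continuous fun x : ℝ =>
      Complex.exp (-((ε + y * Complex.I) * x))).aestronglyMeasurable.mul
        hf.ofReal.aestronglyMeasurable
  · have h1 : ∀ᶠ ε : ℝ in nhdsWithin 0 (Ioi 0), ε < 1 := nhdsWithin_le_nhds (gt_mem_nhds one_pos)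
    filter_upwards [h1, self_mem_nhdsWithin] with ε hε1 hε0
    have hε0 : 0 < ε := hε0
    refine Filter.Eventually.of_forall fun x => ?_
    rcases lt_or_ge x a with hx | hx
    · simp [h0 x hx]
    · rw [norm_mul, Complex.norm_real, Complex.norm_exp]
      refine mul_le_mul_of_nonneg_right (Real.exp_le_exp.2 ?_) (norm_nonneg _)
      have : (-(((ε : ℂ) + y * Complex.I) * x)).re = -(ε * x) := by simp
      rw [this]
      have h3 : -(ε * x) ≤ ε * |a| := by nlinarith [neg_abs_le a]
      nlinarith [abs_nonneg a]
  · refine Filter.Eventually.of_forall fun x => ?_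
    have : Continuous fun ε : ℝ => Complex.exp (-(((ε : ℂ) + y * Complex.I) * x)) * (f x : ℂ) := by
      fun_prop
    have h := this.tendsto 0
    simp only [Complex.ofReal_zero, zero_add] at h
    exact h.mono_left nhdsWithin_le_nhds

/-- Boundary value at s = 2πiω of the Laplace identity; the power is continuous up to the imaginary
axis, including 0, because α + 2 > 0. -/
lemma fourier_leftRLLine (h1 : 1 < α) (h2 : α < 2) (hv : LeftSmooth α K a b v) (ω : ℝ) :
    𝓕 (fun x => (leftRLLine α v x : ℂ)) ω =
      (((2 * Real.pi * ω : ℝ) : ℂ) * Complex.I) ^ ((α + 2 : ℝ) : ℂ) *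
        𝓕 (fun x => (v x : ℂ)) ω := by
  rw [fourier_eq_integral, fourier_eq_integral]
  set y := 2 * Real.pi * ω
  have t1 := tendsto_laplace hv.integrable (fun x hx => hv.leftRLLine_eq_zero hx) y
  have t2 := tendsto_laplace (a := a)
    (hv.continuous.integrable_of_hasCompactSupport hv.hasCompactSupport)
    (fun x hx => hv.zero_of_notMem x fun h => by linarith [h.1]) y
  have t3 : Filter.Tendsto (fun ε : ℝ => ((ε : ℂ) + y * Complex.I) ^ ((α + 2 : ℝ) : ℂ))
      (nhdsWithin 0 (Ioi 0)) (nhds (((y : ℂ) * Complex.I) ^ ((α + 2 : ℝ) : ℂ))) := by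
    have hc := Complex.continuousAt_cpow_const_of_re_pos (z := (y : ℂ) * Complex.I)
      (w := ((α + 2 : ℝ) : ℂ)) (Or.inl (by simp)) (by rw [Complex.ofReal_re]; linarith)
    refine hc.tendsto.comp ?_
    have : Continuous fun ε : ℝ => (ε : ℂ) + y * Complex.I := by fun_prop
    have h := this.tendsto 0
    simp only [Complex.ofReal_zero, zero_add] at h
    exact h.mono_left nhdsWithin_le_nhds
  refine tendsto_nhds_unique (t1.congr' ?_) (t3.mul t2)
  filter_upwards [self_mem_nhdsWithin] with ε hε
  exact hv.laplace_leftRLLine h1 h2 (by simpa using hε)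

lemma norm_symbol {β : ℝ} (hβ : 0 < β) (y : ℝ) :
    ‖((y : ℂ) * Complex.I) ^ (β : ℂ)‖ = |y| ^ β := by
  rcases eq_or_ne y 0 with rfl | hy
  · rw [Complex.ofReal_zero, zero_mul, Complex.zero_cpow (by exact_mod_cast hβ.ne'), norm_zero,
      abs_zero, Real.zero_rpow hβ.ne']
  · rw [Complex.norm_cpow_real]
    simp

lemma norm_fourier_leftRLLine (h1 : 1 < α) (h2 : α < 2) (hv : LeftSmooth α K a b v) (ω : ℝ) :
    ‖𝓕 (fun x => (leftRLLine α v x : ℂ)) ω‖ =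
      |2 * Real.pi * ω| ^ (α + 2) * ‖𝓕 (fun x => (v x : ℂ)) ω‖ := by
  rw [hv.fourier_leftRLLine h1 h2, norm_mul, norm_symbol (by linarith)]

lemma continuous_fourier (hv : LeftSmooth α K a b v) : Continuous (𝓕 (fun x => (v x : ℂ))) :=
  continuous_fourier_real hv.integrable_ofReal

/-- Low frequencies are bounded by the L¹ norm of v; for |ω| ≥ 1 the symbol has modulus at least 1,
so the transform of the derivative dominates. -/
lemma integrable_fourier (h1 : 1 < α) (h2 : α < 2) (hv : LeftSmooth α K a b v) :
    Integrable (𝓕 (fun x => (v x : ℂ))) := by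
  have hi : Integrable ((Icc (-1 : ℝ) 1).indicator fun _ => ∫ x, ‖(v x : ℂ)‖) := by
    rw [integrable_indicator_iff measurableSet_Icc]
    exact integrableOn_const (by simp)
  refine (hi.add hv.fourier_integrable.norm).mono' hv.continuous_fourier.aestronglyMeasurable
    (Filter.Eventually.of_forall fun ω => ?_)
  rw [Pi.add_apply]
  by_cases hω : ω ∈ Icc (-1 : ℝ) 1
  · rw [indicator_of_mem hω]
    linarith [norm_fourier_le (fun x => (v x : ℂ)) ω,
      norm_nonneg (𝓕 (fun x => (leftRLLine α v x : ℂ)) ω)]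
  · rw [indicator_of_notMem hω, zero_add, hv.norm_fourier_leftRLLine h1 h2]
    refine le_mul_of_one_le_left (norm_nonneg _) (Real.one_le_rpow ?_ (by linarith))
    have h3 : 1 ≤ |ω| := by
      by_contra! h
      exact hω ⟨(abs_le.1 h.le).1, (abs_le.1 h.le).2⟩
    rw [abs_mul, abs_of_pos (by positivity : 0 < 2 * Real.pi)]
    nlinarith [Real.pi_gt_three]

lemma continuous_symbol {β : ℝ} (hβ : 0 < β) :
    Continuous fun ω : ℝ => (((2 * Real.pi * ω : ℝ) : ℂ) * Complex.I) ^ (β : ℂ) := by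
  refine continuous_iff_continuousAt.2 fun ω => ?_
  have hc := Complex.continuousAt_cpow_const_of_re_pos
    (z := ((2 * Real.pi * ω : ℝ) : ℂ) * Complex.I) (w := (β : ℂ))
    (Or.inl (by rw [Complex.re_ofReal_mul, Complex.I_re, mul_zero]))
    (by rwa [Complex.ofReal_re])
  exact ContinuousAt.comp (f := fun ω : ℝ => ((2 * Real.pi * ω : ℝ) : ℂ) * Complex.I) hc
    (by fun_prop)

lemma integrable_symbol_mul_fourier (h1 : 1 < α) (h2 : α < 2) (hv : LeftSmooth α K a b v) {β : ℝ}
    (hβ : 0 < β) (hβα : β ≤ α + 2) :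
    Integrable fun ω : ℝ => (((2 * Real.pi * ω : ℝ) : ℂ) * Complex.I) ^ (β : ℂ) *
      𝓕 (fun x => (v x : ℂ)) ω := by
  refine ((hv.integrable_fourier h1 h2).norm.add hv.fourier_integrable.norm).mono'
    ((continuous_symbol hβ).mul hv.continuous_fourier).aestronglyMeasurable
    (Filter.Eventually.of_forall fun ω => ?_)
  rw [norm_mul, norm_symbol hβ, Pi.add_apply, hv.norm_fourier_leftRLLine h1 h2]
  set y := |2 * Real.pi * ω|
  have hy : 0 ≤ y := abs_nonneg _
  have h3 : y ^ β ≤ 1 + y ^ (α + 2) := by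
    rcases le_total y 1 with h | h
    · linarith [Real.rpow_le_one hy h hβ.le, Real.rpow_nonneg hy (α + 2)]
    · linarith [Real.rpow_le_rpow_of_exponent_le h hβα]
  nlinarith [norm_nonneg (𝓕 (fun x => (v x : ℂ)) ω)]

end LeftSmooth

lemma hasDerivAt_fourierInv {f : ℝ → ℂ} (hf : Integrable f)
    (hf' : Integrable fun ω : ℝ => (((2 * Real.pi * ω : ℝ) : ℂ) * Complex.I) * f ω) (x : ℝ) :
    HasDerivAt (𝓕⁻ f) (𝓕⁻ (fun ω : ℝ => (((2 * Real.pi * ω : ℝ) : ℂ) * Complex.I) * f ω) x) x := by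
  have hxf : Integrable fun ω : ℝ => ω • f ω := by
    have h2pi : (2 * Real.pi * Complex.I : ℂ) ≠ 0 := Complex.two_pi_I_ne_zero
    refine (hf'.const_mul (2 * Real.pi * Complex.I : ℂ)⁻¹).congr
      (Filter.Eventually.of_forall fun ω => ?_)
    simp only [Complex.real_smul]
    push_cast
    field_simp
  have h := (Real.hasDerivAt_fourier hf hxf (-x)).scomp x (hasDerivAt_neg x)
  have e : 𝓕⁻ f = 𝓕 f ∘ Neg.neg := funext fun y => Real.fourierInv_eq_fourier_neg f y
  rw [e]
  have e' : 𝓕⁻ (fun ω : ℝ => (((2 * Real.pi * ω : ℝ) : ℂ) * Complex.I) * f ω) x =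
      (-1 : ℝ) • 𝓕 (fun ω : ℝ => (-2 * Real.pi * Complex.I * ω : ℂ) • f ω) (-x) := by
    rw [Real.fourierInv_eq_fourier_neg, fourier_eq_integral, fourier_eq_integral, neg_smul,
      one_smul, ← integral_neg]
    refine integral_congr_ae (Filter.Eventually.of_forall fun ω => ?_)
    simp only [smul_eq_mul]
    push_cast
    ring
  rw [e']
  exact h

/-- Riemann-Lebesgue. -/
lemma tendsto_fourierInv_atBot (f : ℝ → ℂ) : Filter.Tendsto (𝓕⁻ f) Filter.atBot (nhds 0) := by
  have h := (Real.zero_at_infty_fourier f).mono_left (atTop_le_cocompact)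
  have e : 𝓕⁻ f = 𝓕 f ∘ Neg.neg := funext fun y => Real.fourierInv_eq_fourier_neg f y
  rw [e]
  exact h.comp Filter.tendsto_neg_atBot_atTop

/-- Two functions with the same second derivative that both vanish at `-∞` agree. -/
lemma eq_of_second_deriv_eq {F F' G G' H : ℝ → ℂ} (hF : ∀ x, HasDerivAt F (F' x) x)
    (hF' : ∀ x, HasDerivAt F' (H x) x) (hG : ∀ x, HasDerivAt G (G' x) x)
    (hG' : ∀ x, HasDerivAt G' (H x) x) (hF0 : Filter.Tendsto F Filter.atBot (nhds 0))
    (hG0 : Filter.Tendsto G Filter.atBot (nhds 0)) : F = G := by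
  have hconst : ∀ x, F' x - G' x = F' 0 - G' 0 := fun x =>
    is_const_of_deriv_eq_zero (f := fun x => F' x - G' x)
      (fun x => ((hF' x).sub (hG' x)).differentiableAt)
      (fun x => ((hF' x).sub (hG' x)).deriv.trans (sub_self _)) x 0
  set B := F' 0 - G' 0 with hB
  have hlin : ∀ x : ℝ, F x - G x - x * B = F 0 - G 0 := by
    intro x
    have hd : ∀ x : ℝ, HasDerivAt (fun x : ℝ => F x - G x - (x : ℂ) * B)
        (F' x - G' x - 1 * B) x := fun x =>
      ((hF x).sub (hG x)).sub ((Complex.ofRealCLM.hasDerivAt (x := x)).mul_const B)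
    have := is_const_of_deriv_eq_zero (f := fun x : ℝ => F x - G x - (x : ℂ) * B)
      (fun x => (hd x).differentiableAt)
      (fun x => by rw [(hd x).deriv, hconst, one_mul, sub_self]) x 0
    simpa using this
  have hD : Filter.Tendsto (fun x => F x - G x) Filter.atBot (nhds 0) := by
    simpa using hF0.sub hG0
  -- F - G is affine with slope B, so its increment over a unit step is B, while that increment
  -- tends to 0 at -∞.
  have hB0 : B = 0 := by
    have hsh : Filter.Tendsto (fun x : ℝ => x - 1) Filter.atBot Filter.atBot :=
      Filter.tendsto_atBot_add_const_right _ (-1) Filter.tendsto_id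
    have h3 := hD.sub (hD.comp hsh)
    rw [sub_zero] at h3
    refine tendsto_nhds_unique (Filter.Tendsto.congr (fun x => ?_)
      (tendsto_const_nhds (x := B))) h3
    have e1 := hlin x
    have e2 := hlin (x - 1)
    push_cast at e2
    simp only [Function.comp]
    linear_combination e2 - e1
  have hA0 : F 0 - G 0 = 0 := by
    refine tendsto_nhds_unique (Filter.Tendsto.congr (fun x => ?_)
      (tendsto_const_nhds (x := F 0 - G 0))) hD
    have := hlin x
    rw [hB0, mul_zero, sub_zero] at this
    exact this.symm
  ext x
  have := hlin x
  rw [hB0, mul_zero, sub_zero, hA0] at this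
  exact sub_eq_zero.1 this

namespace LeftSmooth

variable {α K a b : ℝ} {v : ℝ → ℝ}

lemma fourierInv_leftRLLine (hv : LeftSmooth α K a b v) :
    𝓕⁻ (𝓕 (fun x => (leftRLLine α v x : ℂ))) = fun x => (leftRLLine α v x : ℂ) :=
  Continuous.fourierInv_fourier_eq (Complex.continuous_ofReal.comp hv.continuous_leftRLLine)
    hv.integrable.ofReal hv.fourier_integrable

lemma fourierInv_fourier (h1 : 1 < α) (h2 : α < 2) (hv : LeftSmooth α K a b v) :
    𝓕⁻ (𝓕 (fun x => (v x : ℂ))) = fun x => (v x : ℂ) :=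
  Continuous.fourierInv_fourier_eq (Complex.continuous_ofReal.comp hv.continuous)
    hv.integrable_ofReal (hv.integrable_fourier h1 h2)

/-- The Riemann-Liouville derivative as an inverse Fourier transform. -/
lemma second_deriv_eq_fourierInv (h1 : 1 < α) (h2 : α < 2) (hv : LeftSmooth α K a b v) (x : ℝ) :
    ((1 / Real.Gamma (2 - α) * iteratedDeriv 2 (leftKernelIntegralLine α v) x : ℝ) : ℂ) =
      𝓕⁻ (fun ω : ℝ => (((2 * Real.pi * ω : ℝ) : ℂ) * Complex.I) ^ (α : ℂ) *
        𝓕 (fun x => (v x : ℂ)) ω) x := by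
  set c := 1 / Real.Gamma (2 - α) with hc
  have hmul : ∀ β : ℝ, 0 < β → (fun ω : ℝ => (((2 * Real.pi * ω : ℝ) : ℂ) * Complex.I) *
      ((((2 * Real.pi * ω : ℝ) : ℂ) * Complex.I) ^ (β : ℂ) * 𝓕 (fun x => (v x : ℂ)) ω)) =
      fun ω : ℝ => (((2 * Real.pi * ω : ℝ) : ℂ) * Complex.I) ^ ((β + 1 : ℝ) : ℂ) *
        𝓕 (fun x => (v x : ℂ)) ω := by
    intro β hβ
    ext ω
    rw [← mul_assoc]
    congr 1
    set z := ((2 * Real.pi * ω : ℝ) : ℂ) * Complex.I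
    by_cases hz : z = 0
    · rw [hz, zero_mul, Complex.zero_cpow]
      exact_mod_cast (by linarith : β + 1 ≠ 0)
    · push_cast
      rw [Complex.cpow_add _ _ hz, Complex.cpow_one, mul_comm]
  have i0 := hv.integrable_symbol_mul_fourier h1 h2 (β := α) (by linarith) (by linarith)
  have i1 := hv.integrable_symbol_mul_fourier h1 h2 (β := α + 1) (by linarith) (by linarith)
  have i2 := hv.integrable_symbol_mul_fourier h1 h2 (β := α + 1 + 1) (by linarith) (by linarith)
  have d0 := fun x => hasDerivAt_fourierInv i0 (by rw [hmul α (by linarith)]; exact i1) x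
  have d1 := fun x => hasDerivAt_fourierInv i1 (by rw [hmul (α + 1) (by linarith)]; exact i2) x
  simp only [hmul α (by linarith)] at d0
  simp only [hmul (α + 1) (by linarith)] at d1
  -- Both sides have the order α+2 derivative as second derivative. The left one vanishes below a
  -- and the right one decays by Riemann-Lebesgue, so `eq_of_second_deriv_eq` applies.
  have e2 : (fun ω : ℝ => (((2 * Real.pi * ω : ℝ) : ℂ) * Complex.I) ^ ((α + 1 + 1 : ℝ) : ℂ) *
        𝓕 (fun x => (v x : ℂ)) ω) = 𝓕 (fun x => (leftRLLine α v x : ℂ)) := by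
    ext ω
    rw [hv.fourier_leftRLLine h1 h2]
    congr 3
    ring
  simp only [e2, hv.fourierInv_leftRLLine] at d1
  have g0 : ∀ x, HasDerivAt (fun x => ((c * iteratedDeriv 2 (leftKernelIntegralLine α v) x : ℝ) : ℂ))
      ((c * iteratedDeriv 3 (leftKernelIntegralLine α v) x : ℝ) : ℂ) x := fun x =>
    ((hv.hasDerivAt_iteratedDeriv (by norm_num) x).const_mul c).ofReal_comp
  have g1 : ∀ x, HasDerivAt (fun x => ((c * iteratedDeriv 3 (leftKernelIntegralLine α v) x : ℝ) : ℂ))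
      ((leftRLLine α v x : ℝ) : ℂ) x := fun x =>
    ((hv.hasDerivAt_iteratedDeriv (by norm_num) x).const_mul c).ofReal_comp
  have gt : Filter.Tendsto
      (fun x => ((c * iteratedDeriv 2 (leftKernelIntegralLine α v) x : ℝ) : ℂ)) Filter.atBot
      (nhds 0) := by
    refine tendsto_const_nhds.congr' ?_
    filter_upwards [Filter.eventually_lt_atBot a] with x hx
    rw [hv.iteratedDeriv_eq_zero 2 hx, mul_zero, Complex.ofReal_zero]
  exact congrFun (eq_of_second_deriv_eq g0 g1 d0 d1 gt (tendsto_fourierInv_atBot _)) x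

/-- Each shifted value is written by Fourier inversion, and the sum over k is taken inside the
integral. The difference operator has symbol g(α, -2πωh). -/
lemma hasSum_weight_mul (h1 : 1 < α) (h2 : α < 2) (hv : LeftSmooth α K a b v) (h x : ℝ) :
    HasSum (fun k : ℕ => (weight α k : ℂ) * (v (x - ((k : ℝ) - 1) * h) : ℂ))
      (∫ ω : ℝ, Complex.exp (((2 * Real.pi * x * ω : ℝ) : ℂ) * Complex.I) *
        (genFun α (-(2 * Real.pi * ω * h)) * 𝓕 (fun x => (v x : ℂ)) ω)) := by
  set V := 𝓕 (fun x => (v x : ℂ)) with hV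
  have hVi : Integrable V := hv.integrable_fourier h1 h2
  have hVc : Continuous V := hv.continuous_fourier
  set F : ℕ → ℝ → ℂ := fun k ω =>
    Complex.exp (((2 * Real.pi * x * ω : ℝ) : ℂ) * Complex.I) * ((weight α k : ℂ) *
      Complex.exp (((((k : ℝ) - 1) * (-(2 * Real.pi * ω * h)) : ℝ) : ℂ) * Complex.I) * V ω)
  have hF : ∀ k ω, ‖F k ω‖ = |weight α k| * ‖V ω‖ := by
    intro k ω
    simp only [F, norm_mul, Complex.norm_exp_ofReal_mul_I, mul_one, one_mul, Complex.norm_real,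
      Real.norm_eq_abs]
  have hsum : HasSum (fun k => ∫ ω, F k ω)
      (∫ ω : ℝ, Complex.exp (((2 * Real.pi * x * ω : ℝ) : ℂ) * Complex.I) *
        (genFun α (-(2 * Real.pi * ω * h)) * V ω)) := by
    refine MeasureTheory.hasSum_integral_of_dominated_convergence
      (fun k ω => |weight α k| * ‖V ω‖) (fun k => ?_)
      (fun k => Filter.Eventually.of_forall fun ω => (hF k ω).le)
      (Filter.Eventually.of_forall fun ω => (summable_abs_weight h1 h2).mul_right _) ?_
      (Filter.Eventually.of_forall fun ω => ?_)
    · exact (by fun_prop : Continuous (F k)).aestronglyMeasurable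
    · simp only [tsum_mul_right]
      exact hVi.norm.const_mul _
    · exact ((hasSum_genFun h1 h2 _).mul_right _).mul_left _
  convert hsum using 2 with k
  have hinv := congrFun (hv.fourierInv_fourier h1 h2) (x - ((k : ℝ) - 1) * h)
  rw [← hV, fourierInv_eq_integral] at hinv
  rw [← hinv, ← integral_const_mul]
  refine integral_congr_ae (Filter.Eventually.of_forall fun ω => ?_)
  simp only [F]
  rw [show ((2 * Real.pi * (x - ((k : ℝ) - 1) * h) * ω : ℝ) : ℂ) * Complex.I =
    ((2 * Real.pi * x * ω : ℝ) : ℂ) * Complex.I +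
      ((((k : ℝ) - 1) * (-(2 * Real.pi * ω * h)) : ℝ) : ℂ) * Complex.I by push_cast; ring,
    Complex.exp_add]
  ring

/-- Second order consistency of the weighted and shifted Grünwald formula. -/
lemma consistency (h1 : 1 < α) (h2 : α < 2) (hv : LeftSmooth α K a b v) {h : ℝ} (hh : 0 < h)
    (x : ℝ) :
    |(∑' k : ℕ, weight α k * v (x - ((k : ℝ) - 1) * h)) / h ^ α -
      1 / Real.Gamma (2 - α) * iteratedDeriv 2 (leftKernelIntegralLine α v) x| ≤
      (4 + ∑' k, |weight α k|) * K * h ^ 2 := by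
  set C := 4 + ∑' k, |weight α k| with hC
  have hC0 : 0 ≤ C := add_nonneg (by norm_num) (tsum_nonneg fun _ => abs_nonneg _)
  set V := 𝓕 (fun x => (v x : ℂ)) with hV
  have hVi : Integrable V := hv.integrable_fourier h1 h2
  have hVc : Continuous V := hv.continuous_fourier
  have hha : 0 < h ^ α := Real.rpow_pos_of_pos hh _
  have hsum := (hv.hasSum_weight_mul h1 h2 h x).tsum_eq
  rw [← hV] at hsum
  have hcast : ((∑' k : ℕ, weight α k * v (x - ((k : ℝ) - 1) * h) : ℝ) : ℂ) =
      ∑' k : ℕ, (weight α k : ℂ) * (v (x - ((k : ℝ) - 1) * h) : ℂ) := by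
    rw [Complex.ofReal_tsum]
    push_cast
    rfl
  have hg : Continuous fun ω : ℝ => genFun α (-(2 * Real.pi * ω * h)) :=
    (continuous_genFun h1 h2).comp (by fun_prop)
  have i1 : Integrable fun ω : ℝ => Complex.exp (((2 * Real.pi * x * ω : ℝ) : ℂ) * Complex.I) *
      (genFun α (-(2 * Real.pi * ω * h)) * V ω) := by
    refine (hVi.norm.const_mul (∑' k, |weight α k|)).mono'
      (by fun_prop : Continuous _).aestronglyMeasurable (Filter.Eventually.of_forall fun ω => ?_)
    rw [norm_mul, Complex.norm_exp_ofReal_mul_I, one_mul, norm_mul]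
    exact mul_le_mul_of_nonneg_right (norm_genFun_le h1 h2 _) (norm_nonneg _)
  have i2' := hv.integrable_symbol_mul_fourier h1 h2 (β := α) (by linarith) (by linarith)
  have hsc := continuous_symbol (β := α) (by linarith)
  have i2 : Integrable fun ω : ℝ => Complex.exp (((2 * Real.pi * x * ω : ℝ) : ℂ) * Complex.I) *
      ((((2 * Real.pi * ω : ℝ) : ℂ) * Complex.I) ^ (α : ℂ) * V ω) := by
    refine i2'.norm.mono' (by fun_prop : Continuous _).aestronglyMeasurable
      (Filter.Eventually.of_forall fun ω => ?_)
    rw [norm_mul, Complex.norm_exp_ofReal_mul_I, one_mul]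
  -- Scaling by h > 0 leaves the argument unchanged, so the power is multiplicative. The right side
  -- is (-iθ)^α at θ = -2πωh.
  have hscale : ∀ ω : ℝ, (((2 * Real.pi * ω : ℝ) : ℂ) * Complex.I) ^ (α : ℂ) * ((h ^ α : ℝ) : ℂ) =
      (-(((-(2 * Real.pi * ω * h) : ℝ) : ℂ) * Complex.I)) ^ (α : ℂ) := by
    intro ω
    have e : -(((-(2 * Real.pi * ω * h) : ℝ) : ℂ) * Complex.I) =
        (h : ℂ) * (((2 * Real.pi * ω : ℝ) : ℂ) * Complex.I) := by push_cast; ring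
    set z := ((2 * Real.pi * ω : ℝ) : ℂ) * Complex.I
    have hα : (α : ℂ) ≠ 0 := by exact_mod_cast (by linarith : α ≠ 0)
    rw [e]
    by_cases hz : z = 0
    · rw [hz, mul_zero, Complex.zero_cpow hα, zero_mul]
    · have hh0 : (h : ℂ) ≠ 0 := by exact_mod_cast hh.ne'
      rw [Complex.ofReal_cpow hh.le, Complex.cpow_def_of_ne_zero hz,
        Complex.cpow_def_of_ne_zero hh0, Complex.cpow_def_of_ne_zero (mul_ne_zero hh0 hz),
        Complex.log_ofReal_mul hh hz, ← Complex.exp_add, Complex.ofReal_log hh.le]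
      congr 1
      ring
  have key : (((∑' k : ℕ, weight α k * v (x - ((k : ℝ) - 1) * h)) / h ^ α -
      1 / Real.Gamma (2 - α) * iteratedDeriv 2 (leftKernelIntegralLine α v) x : ℝ) : ℂ) *
        ((h ^ α : ℝ) : ℂ) =
      ∫ ω : ℝ, Complex.exp (((2 * Real.pi * x * ω : ℝ) : ℂ) * Complex.I) *
        ((genFun α (-(2 * Real.pi * ω * h)) -
          (-(((-(2 * Real.pi * ω * h) : ℝ) : ℂ) * Complex.I)) ^ (α : ℂ)) * V ω) := by
    rw [Complex.ofReal_sub, hv.second_deriv_eq_fourierInv h1 h2, Complex.ofReal_div, hcast, hsum,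
      sub_mul, div_mul_cancel₀ _ (by exact_mod_cast hha.ne'), fourierInv_eq_integral,
      ← integral_mul_const, ← integral_sub i1 (i2.mul_const _)]
    refine integral_congr_ae (Filter.Eventually.of_forall fun ω => ?_)
    simp only [← hscale]
    ring
  have hnorm : ‖∫ ω : ℝ, Complex.exp (((2 * Real.pi * x * ω : ℝ) : ℂ) * Complex.I) *
        ((genFun α (-(2 * Real.pi * ω * h)) -
          (-(((-(2 * Real.pi * ω * h) : ℝ) : ℂ) * Complex.I)) ^ (α : ℂ)) * V ω)‖ ≤
      C * h ^ (α + 2) * K := by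
    -- The symbol error C|2πωh|^(α+2) times |V| is Ch^(α+2) times the modulus of the transform of
    -- the order α+2 derivative, whose integral is at most K.
    refine (norm_integral_le_of_norm_le
      (hv.fourier_integrable.norm.const_mul (C * h ^ (α + 2)))
      (Filter.Eventually.of_forall fun ω => ?_)).trans ?_
    · rw [norm_mul, Complex.norm_exp_ofReal_mul_I, one_mul, norm_mul,
        hv.norm_fourier_leftRLLine h1 h2]
      refine (mul_le_mul_of_nonneg_right (norm_genFun_sub_le h1 h2 _) (norm_nonneg _)).trans
        (le_of_eq ?_)
      rw [abs_neg, abs_mul, abs_of_pos hh, Real.mul_rpow (abs_nonneg _) hh.le, ← hC, ← hV]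
      ring
    · rw [integral_const_mul]
      exact mul_le_mul_of_nonneg_left hv.fourier_bound
        (mul_nonneg hC0 (Real.rpow_nonneg hh.le _))
  rw [← key, norm_mul, Complex.norm_real, Complex.norm_real, Real.norm_eq_abs, Real.norm_eq_abs,
    abs_of_pos hha, Real.rpow_add hh, Real.rpow_two] at hnorm
  refine le_of_mul_le_mul_right (hnorm.trans (le_of_eq ?_)) hha
  ring

end LeftSmooth

/-! ### Reflection and restriction to the interval -/

/-- Reflection exchanges the two kernel integrals, and derivatives of even order keep their sign;
right-sided results therefore follow from left-sided ones. -/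
lemma leftKernelIntegralLine_comp_neg (α : ℝ) (v : ℝ → ℝ) :
    leftKernelIntegralLine α (fun y => v (-y)) = fun x => rightKernelIntegralLine α v (-x) := by
  ext x
  have h := integral_comp_neg_Iic x (fun ξ => v ξ / (ξ - -x) ^ (α - 1))
  rw [leftKernelIntegralLine, rightKernelIntegralLine, integral_Ici_eq_integral_Ioi, ← h]
  refine setIntegral_congr_fun measurableSet_Iic fun ξ _ => ?_
  rw [neg_sub_neg]

lemma iteratedDeriv_leftKernelIntegralLine_comp_neg (α : ℝ) (v : ℝ → ℝ) {n : ℕ} (hn : Even n)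
    (x : ℝ) :
    iteratedDeriv n (leftKernelIntegralLine α (fun y => v (-y))) x =
      iteratedDeriv n (rightKernelIntegralLine α v) (-x) := by
  rw [leftKernelIntegralLine_comp_neg, iteratedDeriv_comp_neg, hn.neg_one_pow, one_smul]

lemma leftRLLine_comp_neg (α : ℝ) (v : ℝ → ℝ) :
    leftRLLine α (fun y => v (-y)) = fun x => rightRLLine α v (-x) := by
  ext x
  rw [leftRLLine, rightRLLine, iteratedDeriv_leftKernelIntegralLine_comp_neg α v (by decide)]

lemma SpaceSmooth.leftSmooth {α K a b : ℝ} {v : ℝ → ℝ} (hv : SpaceSmooth α K v)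
    (hc : Continuous v) (h0 : ∀ x ∉ Icc a b, v x = 0) : LeftSmooth α K a b v :=
  ⟨hc, h0, hv.left_contDiff, hv.left_integrable, hv.left_fourier_integrable,
    hv.left_fourier_bound⟩

lemma SpaceSmooth.leftSmooth_comp_neg {α K a b : ℝ} {v : ℝ → ℝ} (hv : SpaceSmooth α K v)
    (hc : Continuous v) (h0 : ∀ x ∉ Icc a b, v x = 0) :
    LeftSmooth α K (-b) (-a) (fun y => v (-y)) := by
  have hF : 𝓕 (fun x => (leftRLLine α (fun y => v (-y)) x : ℂ)) =
      fun ω => 𝓕 (fun x => (rightRLLine α v x : ℂ)) (-ω) := by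
    ext ω
    rw [leftRLLine_comp_neg]
    exact Real.fourier_comp_linearIsometry (LinearIsometryEquiv.neg ℝ)
      (fun x : ℝ => (rightRLLine α v x : ℂ)) ω
  refine ⟨hc.comp continuous_neg, fun x hx => h0 _ fun h => hx ?_, ?_, ?_, ?_, ?_⟩
  · exact ⟨by linarith [h.2], by linarith [h.1]⟩
  · rw [leftKernelIntegralLine_comp_neg]
    exact hv.right_contDiff.comp contDiff_neg
  · rw [leftRLLine_comp_neg]
    exact hv.right_integrable.comp_neg
  · rw [hF]
    exact hv.right_fourier_integrable.comp_neg
  · rw [hF, integral_neg_eq_self (fun ω => ‖𝓕 (fun x => (rightRLLine α v x : ℂ)) ω‖)]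
    exact hv.right_fourier_bound

lemma right_consistency {α K a b : ℝ} {v : ℝ → ℝ} (h1 : 1 < α) (h2 : α < 2)
    (hv : SpaceSmooth α K v) (hc : Continuous v) (h0 : ∀ x ∉ Icc a b, v x = 0) {h : ℝ}
    (hh : 0 < h) (x : ℝ) :
    |(∑' k : ℕ, weight α k * v (x + ((k : ℝ) - 1) * h)) / h ^ α -
      1 / Real.Gamma (2 - α) * iteratedDeriv 2 (rightKernelIntegralLine α v) x| ≤
      (4 + ∑' k, |weight α k|) * K * h ^ 2 := by
  have := (hv.leftSmooth_comp_neg hc h0).consistency h1 h2 hh (-x)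
  rw [iteratedDeriv_leftKernelIntegralLine_comp_neg α v (by decide), neg_neg] at this
  have e : ∀ k : ℕ, -(-x - ((k : ℝ) - 1) * h) = x + ((k : ℝ) - 1) * h := fun k => by ring
  simpa only [e] using this

lemma continuous_zeroExt {a b : ℝ} (hab : a < b) {v : ℝ → ℝ} (hv : ContinuousOn v (Icc a b))
    (ha : v a = 0) (hb : v b = 0) : Continuous (zeroExt a b v) := by
  refine continuous_indicator (fun x hx => ?_) (by rwa [closure_Icc])
  rw [frontier_Icc hab.le] at hx
  rcases hx with rfl | rfl
  · exact ha
  · exact hb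

lemma leftKernelIntegral_eq_line {α a b x : ℝ} (v : ℝ → ℝ) (hx : x ∈ Ioo a b) :
    leftKernelIntegral a α v x = leftKernelIntegralLine α (zeroExt a b v) x := by
  have e : ∀ ξ, zeroExt a b v ξ / (x - ξ) ^ (α - 1) =
      (Icc a b).indicator (fun ξ => v ξ / (x - ξ) ^ (α - 1)) ξ := by
    intro ξ
    rw [zeroExt]
    by_cases h : ξ ∈ Icc a b
    · rw [indicator_of_mem h, indicator_of_mem h]
    · rw [indicator_of_notMem h, indicator_of_notMem h, zero_div]
  have hset : Iic x ∩ Icc a b = Icc a x := by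
    ext ξ
    simp only [mem_inter_iff, mem_Iic, mem_Icc]
    exact ⟨fun h => ⟨h.2.1, h.1⟩, fun h => ⟨h.2, h.1, h.2.trans hx.2.le⟩⟩
  rw [leftKernelIntegral, leftKernelIntegralLine, intervalIntegral.integral_of_le hx.1.le]
  simp only [e]
  rw [setIntegral_indicator measurableSet_Icc, hset, integral_Icc_eq_integral_Ioc]

lemma rightKernelIntegral_eq_line {α a b x : ℝ} (v : ℝ → ℝ) (hx : x ∈ Ioo a b) :
    rightKernelIntegral b α v x = rightKernelIntegralLine α (zeroExt a b v) x := by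
  have e : ∀ ξ, zeroExt a b v ξ / (ξ - x) ^ (α - 1) =
      (Icc a b).indicator (fun ξ => v ξ / (ξ - x) ^ (α - 1)) ξ := by
    intro ξ
    rw [zeroExt]
    by_cases h : ξ ∈ Icc a b
    · rw [indicator_of_mem h, indicator_of_mem h]
    · rw [indicator_of_notMem h, indicator_of_notMem h, zero_div]
  have hset : Ici x ∩ Icc a b = Icc x b := by
    ext ξ
    simp only [mem_inter_iff, mem_Ici, mem_Icc]
    exact ⟨fun h => ⟨h.1, h.2.2⟩, fun h => ⟨h.1, hx.1.le.trans h.1, h.2⟩⟩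
  rw [rightKernelIntegral, rightKernelIntegralLine, intervalIntegral.integral_of_le hx.2.le]
  simp only [e]
  rw [setIntegral_indicator measurableSet_Icc, hset, integral_Icc_eq_integral_Ioc]

lemma leftRL_eq_line {α a b x : ℝ} (v : ℝ → ℝ) (hx : x ∈ Ioo a b) :
    leftRL a α v x =
      1 / Real.Gamma (2 - α) * iteratedDeriv 2 (leftKernelIntegralLine α (zeroExt a b v)) x := by
  have h : leftKernelIntegral a α v =ᶠ[nhds x] leftKernelIntegralLine α (zeroExt a b v) := by
    filter_upwards [Ioo_mem_nhds hx.1 hx.2] with y hy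
    exact leftKernelIntegral_eq_line v hy
  rw [leftRL, h.iteratedDeriv_eq]

lemma rightRL_eq_line {α a b x : ℝ} (v : ℝ → ℝ) (hx : x ∈ Ioo a b) :
    rightRL b α v x =
      1 / Real.Gamma (2 - α) * iteratedDeriv 2 (rightKernelIntegralLine α (zeroExt a b v)) x := by
  have h : rightKernelIntegral b α v =ᶠ[nhds x] rightKernelIntegralLine α (zeroExt a b v) := by
    filter_upwards [Ioo_mem_nhds hx.1 hx.2] with y hy
    exact rightKernelIntegral_eq_line v hy
  rw [rightRL, h.iteratedDeriv_eq]

/-! ### The matrices as difference operators -/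

/-- Row i belongs to node i + 1, so `weight α k` meets node i + 2 - k. For the last row k = 0
reaches the boundary node M, which is not a column of W; `hM` removes it. -/
lemma toeplitzW_mulVec (α : ℝ) {M : ℕ} (F : ℕ → ℝ) (hM : F M = 0) (i : Fin (M - 1)) :
    (toeplitzW α (M - 1) *ᵥ fun j => F (j + 1)) i =
      ∑ k ∈ Finset.range (i + 2), weight α k * F (i + 2 - k) := by
  have hi := i.2
  simp only [Matrix.mulVec, dotProduct, toeplitzW, Matrix.of_apply]
  rw [Fin.sum_univ_eq_sum_range
    (fun j => (if j ≤ (i : ℕ) + 1 then weight α (i + 1 - j) else 0) * F (j + 1)) (M - 1)]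
  have h1 : ∑ j ∈ Finset.range (M - 1),
      (if j ≤ (i : ℕ) + 1 then weight α (i + 1 - j) else 0) * F (j + 1) =
      ∑ j ∈ Finset.range (M - 1 + 1),
        (if j ≤ (i : ℕ) + 1 then weight α (i + 1 - j) else 0) * F (j + 1) := by
    rw [Finset.sum_range_succ, show M - 1 + 1 = M by omega, hM, mul_zero, add_zero]
  have h2 : ∑ j ∈ Finset.range ((i : ℕ) + 2),
      weight α (i + 2 - 1 - j) * F (i + 2 - (i + 2 - 1 - j)) =
      ∑ j ∈ Finset.range ((i : ℕ) + 2),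
        (if j ≤ (i : ℕ) + 1 then weight α (i + 1 - j) else 0) * F (j + 1) := by
    refine Finset.sum_congr rfl fun j hj => ?_
    have := Finset.mem_range.1 hj
    rw [if_pos (by omega)]
    congr 2
    omega
  rw [h1, ← Finset.sum_range_reflect _ ((i : ℕ) + 2), h2]
  symm
  refine Finset.sum_subset (Finset.range_mono (by omega)) fun j _ hj => ?_
  rw [Finset.mem_range] at hj
  rw [if_neg (by omega), zero_mul]

/-- Mirror image: `weight α k` meets node i + k, and the boundary node 0 occurs for i = 0, k = 0. -/
lemma toeplitzW_transpose_mulVec (α : ℝ) {M : ℕ} (F : ℕ → ℝ) (h0 : F 0 = 0) (i : Fin (M - 1)) :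
    ((toeplitzW α (M - 1))ᵀ *ᵥ fun j => F (j + 1)) i =
      ∑ k ∈ Finset.range (M - i), weight α k * F (i + k) := by
  have hi := i.2
  simp only [Matrix.mulVec, dotProduct, Matrix.transpose_apply, toeplitzW, Matrix.of_apply]
  rw [Fin.sum_univ_eq_sum_range
    (fun j => (if (i : ℕ) ≤ j + 1 then weight α (j + 1 - i) else 0) * F (j + 1)) (M - 1)]
  have h1 := Finset.sum_range_succ'
    (fun l => (if (i : ℕ) ≤ l then weight α (l - i) else 0) * F l) (M - 1)
  rw [h0, mul_zero, add_zero, show M - 1 + 1 = M by omega] at h1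
  rw [← h1]
  have h2 : ∑ k ∈ Finset.range (M - i), weight α k * F (i + k) =
      ∑ l ∈ Finset.Ico (i : ℕ) M, (if (i : ℕ) ≤ l then weight α (l - i) else 0) * F l := by
    rw [Finset.sum_Ico_eq_sum_range]
    refine Finset.sum_congr rfl fun k _ => ?_
    rw [if_pos (by omega), Nat.add_sub_cancel_left]
  rw [h2]
  symm
  refine Finset.sum_subset (fun l hl => ?_) fun l hl hl' => ?_
  · rw [Finset.mem_Ico] at hl
    exact Finset.mem_range.2 hl.2
  · rw [Finset.mem_range] at hl
    rw [Finset.mem_Ico] at hl'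
    rw [if_neg (by omega), zero_mul]

lemma gridPoint_mem {xL xR : ℝ} (hx : xL < xR) {M : ℕ} (i : Fin (M - 1)) :
    gridPoint xL xR M i ∈ Ioo xL xR := by
  have hi := i.2
  have hM : (0 : ℝ) < M := by exact_mod_cast (by omega : 0 < M)
  have hh : 0 < meshSize xL xR M := div_pos (by linarith) hM
  have hMh : (M : ℝ) * meshSize xL xR M = xR - xL := by rw [meshSize]; field_simp
  have hlt : ((i : ℕ) : ℝ) + 1 < M := by exact_mod_cast (by omega : (i : ℕ) + 1 < M)
  rw [gridPoint]
  constructor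
  · have : 0 < (((i : ℕ) : ℝ) + 1) * meshSize xL xR M := by positivity
    linarith
  · nlinarith

lemma toeplitzW_mulVec_eq_tsum {α xL xR : ℝ} (hx : xL < xR) {M : ℕ} (v : ℝ → ℝ)
    (h0 : ∀ x ∉ Ioo xL xR, v x = 0) (i : Fin (M - 1)) :
    (toeplitzW α (M - 1) *ᵥ fun j => v (gridPoint xL xR M j)) i =
      ∑' k : ℕ, weight α k * v (gridPoint xL xR M i - ((k : ℝ) - 1) * meshSize xL xR M) := by
  have hi := i.2
  have hM : (0 : ℝ) < M := by exact_mod_cast (by omega : 0 < M)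
  set h := meshSize xL xR M with hh'
  have hh : 0 < h := div_pos (by linarith) hM
  have hMh : (M : ℝ) * h = xR - xL := by rw [hh', meshSize]; field_simp
  have key := toeplitzW_mulVec α (M := M) (fun l => v (xL + l * h))
    (h0 _ fun hm => by linarith [hm.2]) i
  have e : (fun j : Fin (M - 1) => v (gridPoint xL xR M j)) =
      fun j : Fin (M - 1) => v (xL + ((j + 1 : ℕ) : ℝ) * h) := by
    ext j
    rw [gridPoint]
    push_cast
    rfl
  rw [e, key, tsum_eq_sum (s := Finset.range ((i : ℕ) + 2)) fun k hk => ?_]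
  · refine Finset.sum_congr rfl fun k hk => ?_
    have hk' := Finset.mem_range.1 hk
    rw [Nat.cast_sub hk'.le, gridPoint, ← hh']
    congr 2
    push_cast
    ring
  · rw [Finset.mem_range, not_lt] at hk
    have hk' : ((i : ℕ) : ℝ) + 2 ≤ k := by exact_mod_cast hk
    rw [h0 _ fun hm => ?_, mul_zero]
    have := hm.1
    rw [gridPoint, ← hh'] at this
    nlinarith

lemma toeplitzW_transpose_mulVec_eq_tsum {α xL xR : ℝ} (hx : xL < xR) {M : ℕ} (v : ℝ → ℝ)
    (h0 : ∀ x ∉ Ioo xL xR, v x = 0) (i : Fin (M - 1)) :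
    ((toeplitzW α (M - 1))ᵀ *ᵥ fun j => v (gridPoint xL xR M j)) i =
      ∑' k : ℕ, weight α k * v (gridPoint xL xR M i + ((k : ℝ) - 1) * meshSize xL xR M) := by
  have hi := i.2
  have hM : (0 : ℝ) < M := by exact_mod_cast (by omega : 0 < M)
  set h := meshSize xL xR M with hh'
  have hh : 0 < h := div_pos (by linarith) hM
  have hMh : (M : ℝ) * h = xR - xL := by rw [hh', meshSize]; field_simp
  have key := toeplitzW_transpose_mulVec α (M := M) (fun l => v (xL + l * h))
    (h0 _ fun hm => by
      have := hm.1
      simp at this) i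
  have e : (fun j : Fin (M - 1) => v (gridPoint xL xR M j)) =
      fun j : Fin (M - 1) => v (xL + ((j + 1 : ℕ) : ℝ) * h) := by
    ext j
    rw [gridPoint]
    push_cast
    rfl
  rw [e, key, tsum_eq_sum (s := Finset.range (M - (i : ℕ))) fun k hk => ?_]
  · refine Finset.sum_congr rfl fun k hk => ?_
    rw [gridPoint, ← hh']
    congr 2
    push_cast
    ring
  · rw [Finset.mem_range, not_lt] at hk
    have hk' : (M : ℝ) ≤ (i : ℕ) + k := by exact_mod_cast (by omega : M ≤ (i : ℕ) + k)
    rw [h0 _ fun hm => ?_, mul_zero]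
    have := hm.2
    rw [gridPoint, ← hh'] at this
    nlinarith

lemma diffMatrix_mulVec_apply (α xL xR : ℝ) (dp dm : ℝ → ℝ) (M : ℕ) (v : Fin (M - 1) → ℝ)
    (i : Fin (M - 1)) :
    (diffMatrix α xL xR dp dm M *ᵥ v) i =
      dp (gridPoint xL xR M i) * (toeplitzW α (M - 1) *ᵥ v) i +
        dm (gridPoint xL xR M i) * ((toeplitzW α (M - 1))ᵀ *ᵥ v) i := by
  rw [diffMatrix, Matrix.add_mulVec, Pi.add_apply, ← Matrix.mulVec_mulVec, ← Matrix.mulVec_mulVec,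
    Matrix.mulVec_diagonal, Matrix.mulVec_diagonal]

/-- Spatial consistency of the scheme on the grid. -/
lemma diffMatrix_consistency {α K xL xR : ℝ} (h1 : 1 < α) (h2 : α < 2) (hx : xL < xR)
    (dp dm : ℝ → ℝ) {v : ℝ → ℝ} (hc : ContinuousOn v (Icc xL xR)) (hL : v xL = 0) (hR : v xR = 0)
    (hv : SpaceSmooth α K (zeroExt xL xR v)) {M : ℕ} (i : Fin (M - 1)) :
    |(diffMatrix α xL xR dp dm M *ᵥ fun j => v (gridPoint xL xR M j)) i / meshSize xL xR M ^ α -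
      (dp (gridPoint xL xR M i) * leftRL xL α v (gridPoint xL xR M i) +
        dm (gridPoint xL xR M i) * rightRL xR α v (gridPoint xL xR M i))| ≤
      (|dp (gridPoint xL xR M i)| + |dm (gridPoint xL xR M i)|) *
        ((4 + ∑' k, |weight α k|) * K * meshSize xL xR M ^ 2) := by
  have hi := i.2
  have hM : (0 : ℝ) < M := by exact_mod_cast (by omega : 0 < M)
  have hh : 0 < meshSize xL xR M := div_pos (by linarith) hM
  have hgm := gridPoint_mem hx i
  have hcz := continuous_zeroExt hx hc hL hR
  have h0 : ∀ x ∉ Icc xL xR, zeroExt xL xR v x = 0 := fun x hx => indicator_of_notMem hx _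
  have h0' : ∀ x ∉ Ioo xL xR, zeroExt xL xR v x = 0 := by
    intro x hxo
    by_cases hxc : x ∈ Icc xL xR
    · rw [zeroExt, indicator_of_mem hxc]
      rcases eq_endpoints_or_mem_Ioo_of_mem_Icc hxc with rfl | rfl | h
      · exact hL
      · exact hR
      · exact absurd h hxo
    · exact h0 x hxc
  have e : (fun j : Fin (M - 1) => v (gridPoint xL xR M j)) =
      fun j => zeroExt xL xR v (gridPoint xL xR M j) := by
    ext j
    rw [zeroExt, indicator_of_mem (Ioo_subset_Icc_self (gridPoint_mem hx j))]
  rw [diffMatrix_mulVec_apply, e, toeplitzW_mulVec_eq_tsum hx _ h0',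
    toeplitzW_transpose_mulVec_eq_tsum hx _ h0', leftRL_eq_line v hgm, rightRL_eq_line v hgm]
  have c1 := (hv.leftSmooth hcz h0).consistency h1 h2 hh (gridPoint xL xR M i)
  have c2 := right_consistency h1 h2 hv hcz h0 hh (gridPoint xL xR M i)
  set P := dp (gridPoint xL xR M i)
  set Q := dm (gridPoint xL xR M i)
  set B := (4 + ∑' k, |weight α k|) * K * meshSize xL xR M ^ 2
  set S := ∑' k : ℕ, weight α k *
    zeroExt xL xR v (gridPoint xL xR M i - ((k : ℝ) - 1) * meshSize xL xR M)
  set S' := ∑' k : ℕ, weight α k *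
    zeroExt xL xR v (gridPoint xL xR M i + ((k : ℝ) - 1) * meshSize xL xR M)
  set R := 1 / Real.Gamma (2 - α) *
    iteratedDeriv 2 (leftKernelIntegralLine α (zeroExt xL xR v)) (gridPoint xL xR M i)
  set R' := 1 / Real.Gamma (2 - α) *
    iteratedDeriv 2 (rightKernelIntegralLine α (zeroExt xL xR v)) (gridPoint xL xR M i)
  have e3 : (P * S + Q * S') / meshSize xL xR M ^ α - (P * R + Q * R') =
      P * (S / meshSize xL xR M ^ α - R) + Q * (S' / meshSize xL xR M ^ α - R') := by ring
  rw [e3, add_mul]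
  refine (abs_add_le _ _).trans ?_
  rw [abs_mul, abs_mul]
  exact add_le_add (mul_le_mul_of_nonneg_left c1 (abs_nonneg P))
    (mul_le_mul_of_nonneg_left c2 (abs_nonneg Q))

/-- The matrix of the scheme is dissipative with respect to the weight `1 / dp`. -/
lemma diffMatrix_dissipative {α xL xR κmin κmax : ℝ} (h1 : 1 < α) (h2 : α < 2) (hx : xL < xR)
    (dp dm : ℝ → ℝ) (hdp : ∀ x ∈ Icc xL xR, 0 < dp x)
    (hcond : RatioCondition α xL xR κmin κmax dp dm) (M : ℕ) (v : Fin (M - 1) → ℝ) :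
    ∑ i, (dp (gridPoint xL xR M i))⁻¹ * (diffMatrix α xL xR dp dm M *ᵥ v) i * v i ≤ 0 := by
  set ρ : ℝ → ℝ := fun x => dm x / dp x with hρ
  set h := meshSize xL xR M with hh'
  have hpt : ∀ l < M - 1, xL + ((l : ℝ) + 1) * h ∈ Icc xL xR := fun l hl =>
    Ioo_subset_Icc_self (gridPoint_mem hx (⟨l, hl⟩ : Fin (M - 1)))
  have hd : 0 ≤ κmax - κmin := by
    have hm := left_mem_Icc.2 hx.le
    linarith [hcond.lower xL hm, hcond.upper xL hm]
  -- In the concave case ρ = κmax - E with E = κmax - ρ; in the convex case ρ = κmin + E with E = ρ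
  -- - κmin. Either way E is convex with values in [0, κmax - κmin].
  have hmain : (toeplitzW α (M - 1) *ᵥ fun i => (1 + ρ (gridPoint xL xR M i)) * v i) ⬝ᵥ v ≤ 0 := by
    have hmid : ∀ i k : ℕ, k ≤ i → xL + ((i : ℝ) + 1) * h =
        (1 / 2 : ℝ) * (xL + (((i - k : ℕ) : ℝ) + 1) * h) +
          (1 / 2 : ℝ) * (xL + (((i + k : ℕ) : ℝ) + 1) * h) := by
      intro i k hk
      rw [Nat.cast_sub hk]
      push_cast
      ring
    rcases hcond.cond with ⟨hcc, hineq⟩ | ⟨hcv, hineq⟩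
    · have := toeplitzW_mul_form_nonpos h1 h2 (m := M - 1)
        (fun l => κmax - ρ (xL + ((l : ℝ) + 1) * h)) (d := κmax - κmin) (κ := κmax) (σ := -1) hd
        (by simp) (fun l hl => sub_nonneg.2 (hcond.upper _ (hpt l hl)))
        (fun l hl => sub_le_sub_left (hcond.lower _ (hpt l hl)) _) (fun i k hk hik => ?_) hineq v
      · refine le_of_eq_of_le ?_ this
        congr 2
        ext i
        rw [gridPoint]
        ring
      · have h3 := hcc.2 (hpt (i - k) (by omega)) (hpt (i + k) (by omega))
          (by norm_num : (0 : ℝ) ≤ 1 / 2) (by norm_num : (0 : ℝ) ≤ 1 / 2) (by norm_num)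
        simp only [smul_eq_mul] at h3
        rw [← hmid i k hk] at h3
        simp only [hρ]
        linarith
    · have := toeplitzW_mul_form_nonpos h1 h2 (m := M - 1)
        (fun l => ρ (xL + ((l : ℝ) + 1) * h) - κmin) (d := κmax - κmin) (κ := κmin) (σ := 1) hd
        (by simp) (fun l hl => sub_nonneg.2 (hcond.lower _ (hpt l hl)))
        (fun l hl => sub_le_sub_right (hcond.upper _ (hpt l hl)) _) (fun i k hk hik => ?_) hineq v
      · refine le_of_eq_of_le ?_ this
        congr 2
        ext i
        rw [gridPoint]
        ring
      · have h3 := hcv.2 (hpt (i - k) (by omega)) (hpt (i + k) (by omega))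
          (by norm_num : (0 : ℝ) ≤ 1 / 2) (by norm_num : (0 : ℝ) ≤ 1 / 2) (by norm_num)
        simp only [smul_eq_mul] at h3
        rw [← hmid i k hk] at h3
        simp only [hρ]
        linarith
  refine le_of_eq_of_le ?_ hmain
  have e1 : (fun i => (1 + ρ (gridPoint xL xR M i)) * v i) =
      v + fun i => ρ (gridPoint xL xR M i) * v i := by
    ext i
    simp only [Pi.add_apply]
    ring
  -- Transposition moves ρ: the form of W·diag(ρ) equals that of diag(ρ)·Wᵀ, which is the second
  -- part of D₊⁻¹A.
  have e2 : (toeplitzW α (M - 1) *ᵥ fun i => ρ (gridPoint xL xR M i) * v i) ⬝ᵥ v =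
      ((toeplitzW α (M - 1))ᵀ *ᵥ v) ⬝ᵥ fun i => ρ (gridPoint xL xR M i) * v i := by
    rw [Matrix.mulVec_transpose, dotProduct_comm, Matrix.dotProduct_mulVec]
  rw [e1, Matrix.mulVec_add, add_dotProduct, e2]
  simp only [dotProduct]
  rw [← Finset.sum_add_distrib]
  refine Finset.sum_congr rfl fun i _ => ?_
  rw [diffMatrix_mulVec_apply]
  have := (hdp _ (Ioo_subset_Icc_self (gridPoint_mem hx i))).ne'
  simp only [hρ]
  field_simp

/-! ### Quadrature in time -/

/-- Three mean value estimates, starting from the bound on g₃. The last is applied to the quadrature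
defect on [a, s] as a function of s, whose derivative is O((b-a)²). The constant is not sharp. -/
lemma abs_sub_trapezoid_le {g g₁ g₂ g₃ : ℝ → ℝ} {a b K : ℝ} (hab : a ≤ b)
    (h0 : ∀ t ∈ Icc a b, HasDerivWithinAt g (g₁ t) (Icc a b) t)
    (h1 : ∀ t ∈ Icc a b, HasDerivWithinAt g₁ (g₂ t) (Icc a b) t)
    (h2 : ∀ t ∈ Icc a b, HasDerivWithinAt g₂ (g₃ t) (Icc a b) t)
    (hK : ∀ t ∈ Icc a b, |g₃ t| ≤ K) :
    |g b - g a - (b - a) / 2 * (g₁ a + g₁ b)| ≤ K * (b - a) ^ 3 := by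
  have ha : a ∈ Icc a b := left_mem_Icc.2 hab
  have hb : b ∈ Icc a b := right_mem_Icc.2 hab
  have hK0 : 0 ≤ K := (abs_nonneg _).trans (hK a ha)
  have hba : 0 ≤ b - a := sub_nonneg.2 hab
  have b2 : ∀ t ∈ Icc a b, |g₂ t - g₂ a| ≤ K * (b - a) := by
    intro t ht
    have := (convex_Icc a b).norm_image_sub_le_of_norm_hasDerivWithin_le h2 hK ha ht
    rw [Real.norm_eq_abs, Real.norm_eq_abs, abs_of_nonneg (sub_nonneg.2 ht.1)] at this
    exact this.trans (mul_le_mul_of_nonneg_left (by linarith [ht.2]) hK0)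
  have b1 : ∀ t ∈ Icc a b, |g₁ t - g₁ a - (t - a) * g₂ a| ≤ K * (b - a) * (b - a) := by
    intro t ht
    have hd : ∀ s ∈ Icc a b, HasDerivWithinAt (fun s => g₁ s - s * g₂ a) (g₂ s - g₂ a)
        (Icc a b) s := fun s hs => by
      simpa using (h1 s hs).fun_sub ((hasDerivWithinAt_id s _).mul_const (g₂ a))
    have := (convex_Icc a b).norm_image_sub_le_of_norm_hasDerivWithin_le hd b2 ha ht
    rw [Real.norm_eq_abs, Real.norm_eq_abs, abs_of_nonneg (sub_nonneg.2 ht.1)] at this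
    refine le_trans (le_of_eq ?_) (this.trans
      (mul_le_mul_of_nonneg_left (by linarith [ht.2]) (mul_nonneg hK0 hba)))
    congr 1
    ring
  have hd : ∀ s ∈ Icc a b, HasDerivWithinAt (fun s => g s - (s - a) / 2 * (g₁ a + g₁ s))
      (g₁ s - (1 / 2 * (g₁ a + g₁ s) + (s - a) / 2 * g₂ s)) (Icc a b) s := fun s hs =>
    (h0 s hs).fun_sub ((((hasDerivWithinAt_id s _).sub_const a).div_const 2).fun_mul
      ((h1 s hs).const_add (g₁ a)))
  have hbd : ∀ s ∈ Icc a b, ‖g₁ s - (1 / 2 * (g₁ a + g₁ s) + (s - a) / 2 * g₂ s)‖ ≤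
      K * (b - a) * (b - a) := by
    intro s hs
    have e : g₁ s - (1 / 2 * (g₁ a + g₁ s) + (s - a) / 2 * g₂ s) =
        1 / 2 * (g₁ s - g₁ a - (s - a) * g₂ a) - (s - a) / 2 * (g₂ s - g₂ a) := by ring
    have hsa : 0 ≤ (s - a) / 2 := by linarith [hs.1]
    rw [e, Real.norm_eq_abs]
    refine (abs_sub _ _).trans ?_
    rw [abs_mul, abs_mul, abs_of_nonneg hsa, abs_of_pos (by norm_num : (0 : ℝ) < 1 / 2)]
    have p1 := b1 s hs
    have p2 : (s - a) / 2 * |g₂ s - g₂ a| ≤ (b - a) / 2 * (K * (b - a)) :=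
      mul_le_mul (by linarith [hs.2]) (b2 s hs) (abs_nonneg _) (by linarith)
    linarith
  have := (convex_Icc a b).norm_image_sub_le_of_norm_hasDerivWithin_le hd hbd ha hb
  rw [Real.norm_eq_abs, Real.norm_eq_abs, abs_of_nonneg hba] at this
  refine le_trans (le_of_eq ?_) (this.trans (le_of_eq (by ring)))
  congr 1
  ring

lemma abs_average_sub_midpoint_le {f f₁ f₂ : ℝ → ℝ} {a b K : ℝ} (hab : a ≤ b)
    (h0 : ∀ t ∈ Icc a b, HasDerivWithinAt f (f₁ t) (Icc a b) t)
    (h1 : ∀ t ∈ Icc a b, HasDerivWithinAt f₁ (f₂ t) (Icc a b) t)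
    (hK : ∀ t ∈ Icc a b, |f₂ t| ≤ K) :
    |(f a + f b) / 2 - f ((a + b) / 2)| ≤ 2 * K * (b - a) ^ 2 := by
  have ha : a ∈ Icc a b := left_mem_Icc.2 hab
  have hb : b ∈ Icc a b := right_mem_Icc.2 hab
  have hm : (a + b) / 2 ∈ Icc a b := ⟨by linarith, by linarith⟩
  have hK0 : 0 ≤ K := (abs_nonneg _).trans (hK a ha)
  have hba : 0 ≤ b - a := sub_nonneg.2 hab
  have b1 : ∀ t ∈ Icc a b, |f₁ t - f₁ a| ≤ K * (b - a) := by
    intro t ht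
    have := (convex_Icc a b).norm_image_sub_le_of_norm_hasDerivWithin_le h1 hK ha ht
    rw [Real.norm_eq_abs, Real.norm_eq_abs, abs_of_nonneg (sub_nonneg.2 ht.1)] at this
    exact this.trans (mul_le_mul_of_nonneg_left (by linarith [ht.2]) hK0)
  have b0 : ∀ t ∈ Icc a b, |f t - f a - (t - a) * f₁ a| ≤ K * (b - a) ^ 2 := by
    intro t ht
    have hd : ∀ s ∈ Icc a b, HasDerivWithinAt (fun s => f s - s * f₁ a) (f₁ s - f₁ a)
        (Icc a b) s := fun s hs => by
      simpa using (h0 s hs).fun_sub ((hasDerivWithinAt_id s _).mul_const (f₁ a))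
    have := (convex_Icc a b).norm_image_sub_le_of_norm_hasDerivWithin_le hd b1 ha ht
    rw [Real.norm_eq_abs, Real.norm_eq_abs, abs_of_nonneg (sub_nonneg.2 ht.1)] at this
    have h3 := this.trans
      (mul_le_mul_of_nonneg_left (by linarith [ht.2] : t - a ≤ b - a) (mul_nonneg hK0 hba))
    rw [show K * (b - a) ^ 2 = K * (b - a) * (b - a) by ring]
    refine le_trans (le_of_eq ?_) h3
    congr 1
    ring
  have p1 := abs_le.1 (b0 b hb)
  have p2 := abs_le.1 (b0 _ hm)
  rw [abs_le]
  constructor <;> nlinarith [p1.1, p1.2, p2.1, p2.2, mul_nonneg hK0 (sq_nonneg (b - a))]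

lemma TimeSmooth.hasDerivWithinAt {xL xR T K : ℝ} (hT : 0 < T) {m : ℕ} {v : ℝ → ℝ → ℝ}
    (hv : TimeSmooth xL xR T m K v) {x : ℝ} (hx : x ∈ Ioo xL xR) {k : ℕ} (hk : k < m) {t : ℝ}
    (ht : t ∈ Icc 0 T) :
    HasDerivWithinAt (iteratedDerivWithin k (fun s => v x s) (Icc 0 T))
      (iteratedDerivWithin (k + 1) (fun s => v x s) (Icc 0 T) t) (Icc 0 T) t := by
  rw [iteratedDerivWithin_succ]
  exact ((hv.contDiffOn x hx).differentiableOn_iteratedDerivWithin (by exact_mod_cast hk)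
    (uniqueDiffOn_Icc hT) t ht).hasDerivWithinAt

/-! ### Convergence -/

section Convergence

variable {α xL xR T : ℝ} {dp dm : ℝ → ℝ} {f : ℝ → ℝ → ℝ} {φ : ℝ → ℝ} {u : ℝ → ℝ → ℝ}
  {δ Δ κmin κmax K : ℝ}

lemma abs_coeff_le (hδ : 0 < δ) (hdp : ∀ x ∈ Icc xL xR, δ ≤ dp x ∧ dp x ≤ Δ)
    (hcond : RatioCondition α xL xR κmin κmax dp dm) {x : ℝ} (hx : x ∈ Icc xL xR) :
    |dp x| + |dm x| ≤ (1 + κmax) * Δ := by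
  have hp : 0 < dp x := hδ.trans_le (hdp x hx).1
  have h1 := hcond.lower x hx
  have h2 := hcond.upper x hx
  have h0 := hcond.nonneg
  have hdm : dm x = dm x / dp x * dp x := by field_simp
  have hdm0 : 0 ≤ dm x := by rw [hdm]; exact mul_nonneg (h0.trans h1) hp.le
  have hdm1 : dm x ≤ κmax * Δ := by
    rw [hdm]
    exact mul_le_mul h2 (hdp x hx).2 hp.le (h0.trans (h1.trans h2))
  rw [abs_of_pos hp, abs_of_nonneg hdm0]
  linarith [(hdp x hx).2]

lemma semidiscrete_consistency (h1 : 1 < α) (h2 : α < 2) (hx : xL < xR) (hT : 0 < T)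
    (hδ : 0 < δ) (hdp : ∀ x ∈ Icc xL xR, δ ≤ dp x ∧ dp x ≤ Δ)
    (hcond : RatioCondition α xL xR κmin κmax dp dm)
    (hu : IsExactSolution α xL xR T dp dm f φ u)
    (hspace : ∀ t ∈ Icc 0 T, SpaceSmooth α K (zeroExt xL xR (fun x => u x t)))
    (hK : 0 ≤ K) (htime : TimeSmooth xL xR T 3 K u) (hf : TimeSmooth xL xR T 2 K f)
    {M : ℕ} (i : Fin (M - 1)) {t : ℝ} (ht : t ∈ Icc 0 T) :
    |(diffMatrix α xL xR dp dm M *ᵥ fun j => u (gridPoint xL xR M j) t) i /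
        meshSize xL xR M ^ α -
      (iteratedDerivWithin 1 (fun s => u (gridPoint xL xR M i) s) (Icc 0 T) t -
        f (gridPoint xL xR M i) t)| ≤
      (1 + κmax) * Δ * ((4 + ∑' k, |weight α k|) * K * meshSize xL xR M ^ 2) := by
  have hgm := gridPoint_mem hx i
  have hcl : t ∈ closure (Ioc 0 T) := by rwa [closure_Ioc hT.ne]
  have hcontu : ∀ j : Fin (M - 1), ContinuousWithinAt (fun s => u (gridPoint xL xR M j) s)
      (Ioc 0 T) t := fun j =>
    ((htime.contDiffOn _ (gridPoint_mem hx j)).continuousOn t ht).mono Ioc_subset_Icc_self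
  have hcontg : ContinuousWithinAt
      (iteratedDerivWithin 1 (fun s => u (gridPoint xL xR M i) s) (Icc 0 T)) (Ioc 0 T) t :=
    (htime.hasDerivWithinAt hT hgm (by norm_num) ht).continuousWithinAt.mono Ioc_subset_Icc_self
  have hcontf : ContinuousWithinAt (fun s => f (gridPoint xL xR M i) s) (Ioc 0 T) t :=
    ((hf.contDiffOn _ hgm).continuousOn t ht).mono Ioc_subset_Icc_self
  -- The equation is only assumed for t > 0, but the first time step also uses t = 0. All terms of
  -- the inequality are continuous in t, so it passes to the closure of (0, T].
  refine ContinuousWithinAt.closure_le (s := Ioc 0 T) (f := fun t =>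
    |(diffMatrix α xL xR dp dm M *ᵥ fun j => u (gridPoint xL xR M j) t) i /
        meshSize xL xR M ^ α -
      (iteratedDerivWithin 1 (fun s => u (gridPoint xL xR M i) s) (Icc 0 T) t -
        f (gridPoint xL xR M i) t)|)
    (g := fun _ => (1 + κmax) * Δ * ((4 + ∑' k, |weight α k|) * K * meshSize xL xR M ^ 2))
    hcl ?_ continuousWithinAt_const fun s hs => ?_
  · refine ContinuousWithinAt.abs (ContinuousWithinAt.sub (ContinuousWithinAt.div_const ?_ _)
      (hcontg.sub hcontf))
    simp only [Matrix.mulVec, dotProduct]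
    exact tendsto_finsetSum _ fun j _ => (hcontu j).const_mul _
  · have hs' := Ioc_subset_Icc_self hs
    have hder : iteratedDerivWithin 1 (fun s => u (gridPoint xL xR M i) s) (Icc 0 T) s -
        f (gridPoint xL xR M i) s =
        dp (gridPoint xL xR M i) * leftRL xL α (fun ξ => u ξ s) (gridPoint xL xR M i) +
          dm (gridPoint xL xR M i) * rightRL xR α (fun ξ => u ξ s) (gridPoint xL xR M i) := by
      have := (hu.equation s hs _ hgm).derivWithin (uniqueDiffOn_Icc hT s hs')
      rw [iteratedDerivWithin_one, this]
      ring
    rw [hder]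
    refine (diffMatrix_consistency h1 h2 hx dp dm (hu.continuous_space s hs')
      (hu.boundary_left s hs') (hu.boundary_right s hs') (hspace s hs') i).trans ?_
    refine mul_le_mul_of_nonneg_right (abs_coeff_le hδ hdp hcond (Ioo_subset_Icc_self hgm)) ?_
    exact mul_nonneg (mul_nonneg (add_nonneg (by norm_num) (tsum_nonneg fun _ => abs_nonneg _)) hK)
      (sq_nonneg _)

/-- The local truncation error of the scheme on the time interval `[a, b]`, `b = a + τ`. -/
lemma truncation_le (h1 : 1 < α) (h2 : α < 2) (hx : xL < xR) (hT : 0 < T)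
    (hδ : 0 < δ) (hdp : ∀ x ∈ Icc xL xR, δ ≤ dp x ∧ dp x ≤ Δ)
    (hcond : RatioCondition α xL xR κmin κmax dp dm)
    (hu : IsExactSolution α xL xR T dp dm f φ u)
    (hspace : ∀ t ∈ Icc 0 T, SpaceSmooth α K (zeroExt xL xR (fun x => u x t)))
    (hK : 0 ≤ K) (htime : TimeSmooth xL xR T 3 K u) (hf : TimeSmooth xL xR T 2 K f)
    {M : ℕ} (i : Fin (M - 1)) {a τ : ℝ} (hτ : 0 < τ) (ha : 0 ≤ a) (hb : a + τ ≤ T) :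
    |(u (gridPoint xL xR M i) (a + τ) - u (gridPoint xL xR M i) a) / τ -
      ((diffMatrix α xL xR dp dm M *ᵥ fun j => u (gridPoint xL xR M j) (a + τ)) i +
        (diffMatrix α xL xR dp dm M *ᵥ fun j => u (gridPoint xL xR M j) a) i) /
        (2 * meshSize xL xR M ^ α) - f (gridPoint xL xR M i) (a + τ / 2)| ≤
      (3 * K + (1 + κmax) * Δ * ((4 + ∑' k, |weight α k|) * K)) *
        (τ ^ 2 + meshSize xL xR M ^ 2) := by
  have hgm := gridPoint_mem hx i
  set x := gridPoint xL xR M i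
  have hab : a ≤ a + τ := by linarith
  have hsub : Icc a (a + τ) ⊆ Icc 0 T := Icc_subset_Icc ha hb
  have hma : a ∈ Icc 0 T := hsub (left_mem_Icc.2 hab)
  have hmb : a + τ ∈ Icc 0 T := hsub (right_mem_Icc.2 hab)
  have c0 := semidiscrete_consistency h1 h2 hx hT hδ hdp hcond hu hspace hK htime hf i hma
  have c1 := semidiscrete_consistency h1 h2 hx hT hδ hdp hcond hu hspace hK htime hf i hmb
  have trap := abs_sub_trapezoid_le (g := fun s => u x s)
    (g₁ := iteratedDerivWithin 1 (fun s => u x s) (Icc 0 T))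
    (g₂ := iteratedDerivWithin 2 (fun s => u x s) (Icc 0 T))
    (g₃ := iteratedDerivWithin 3 (fun s => u x s) (Icc 0 T)) hab
    (fun t ht => by
      have := htime.hasDerivWithinAt hT hgm (k := 0) (by norm_num) (hsub ht)
      rw [iteratedDerivWithin_zero] at this
      exact this.mono hsub)
    (fun t ht => (htime.hasDerivWithinAt hT hgm (by norm_num) (hsub ht)).mono hsub)
    (fun t ht => (htime.hasDerivWithinAt hT hgm (by norm_num) (hsub ht)).mono hsub)
    (fun t ht => htime.bound x hgm t (hsub ht))
  have mid := abs_average_sub_midpoint_le (f := fun s => f x s)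
    (f₁ := iteratedDerivWithin 1 (fun s => f x s) (Icc 0 T))
    (f₂ := iteratedDerivWithin 2 (fun s => f x s) (Icc 0 T)) hab
    (fun t ht => by
      have := hf.hasDerivWithinAt hT hgm (k := 0) (by norm_num) (hsub ht)
      rw [iteratedDerivWithin_zero] at this
      exact this.mono hsub)
    (fun t ht => (hf.hasDerivWithinAt hT hgm (by norm_num) (hsub ht)).mono hsub)
    (fun t ht => hf.bound x hgm t (hsub ht))
  simp only [add_sub_cancel_left] at trap mid
  rw [show (a + (a + τ)) / 2 = a + τ / 2 by ring] at mid
  set g₁ := iteratedDerivWithin 1 (fun s => u x s) (Icc 0 T)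
  set A₀ := (diffMatrix α xL xR dp dm M *ᵥ fun j => u (gridPoint xL xR M j) a) i
  set A₁ := (diffMatrix α xL xR dp dm M *ᵥ fun j => u (gridPoint xL xR M j) (a + τ)) i
  set h := meshSize xL xR M
  set C := (1 + κmax) * Δ * ((4 + ∑' k, |weight α k|) * K) with hC
  rw [← mul_assoc, ← hC] at c0 c1
  have trap' : |(u x (a + τ) - u x a) / τ - (g₁ a + g₁ (a + τ)) / 2| ≤ K * τ ^ 2 := by
    have e : (u x (a + τ) - u x a) / τ - (g₁ a + g₁ (a + τ)) / 2 =
        (u x (a + τ) - u x a - τ / 2 * (g₁ a + g₁ (a + τ))) / τ := by field_simp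
    rw [e, abs_div, abs_of_pos hτ, div_le_iff₀ hτ]
    refine trap.trans (le_of_eq (by ring))
  have hM : (0 : ℝ) < M := by
    have := i.2
    exact_mod_cast (by omega : 0 < M)
  have hC0 : 0 ≤ C := by
    have hp := abs_coeff_le hδ hdp hcond (Ioo_subset_Icc_self hgm)
    exact mul_nonneg ((add_nonneg (abs_nonneg _) (abs_nonneg _)).trans hp)
      (mul_nonneg (add_nonneg (by norm_num) (tsum_nonneg fun _ => abs_nonneg _)) hK)
  -- Trapezoidal defect, minus the average of the two spatial defects, plus the midpoint defect of
  -- f. The 3K in the bound is K from the trapezoid and 2K from the midpoint.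
  have e : (u x (a + τ) - u x a) / τ - (A₁ + A₀) / (2 * h ^ α) - f x (a + τ / 2) =
      ((u x (a + τ) - u x a) / τ - (g₁ a + g₁ (a + τ)) / 2) -
        1 / 2 * (A₀ / h ^ α - (g₁ a - f x a)) -
        1 / 2 * (A₁ / h ^ α - (g₁ (a + τ) - f x (a + τ))) +
        ((f x a + f x (a + τ)) / 2 - f x (a + τ / 2)) := by
    rw [← div_div, div_eq_mul_inv _ (h ^ α)] at *
    ring
  rw [e]
  rw [abs_le] at *
  have p1 : 0 ≤ K * h ^ 2 := mul_nonneg hK (sq_nonneg _)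
  have p2 : 0 ≤ C * τ ^ 2 := mul_nonneg hC0 (sq_nonneg _)
  constructor <;> nlinarith [trap'.1, trap'.2, mid.1, mid.2, c0.1, c0.2, c1.1, c1.2]

lemma error_le (h1 : 1 < α) (h2 : α < 2) (hx : xL < xR) (hT : 0 < T)
    (hδ : 0 < δ) (hdp : ∀ x ∈ Icc xL xR, δ ≤ dp x ∧ dp x ≤ Δ)
    (hcond : RatioCondition α xL xR κmin κmax dp dm)
    (hu : IsExactSolution α xL xR T dp dm f φ u) {C : ℝ} {M N : ℕ} (hM : 0 < M)
    (hN : 0 < N) {U : ℕ → Fin (M - 1) → ℝ} (hU : IsSchemeSolution α xL xR T dp dm f φ M N U)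
    (htr : ∀ (i : Fin (M - 1)) (n : ℕ), n < N →
      |(u (gridPoint xL xR M i) (n * timeStep T N + timeStep T N) -
          u (gridPoint xL xR M i) (n * timeStep T N)) / timeStep T N -
        ((diffMatrix α xL xR dp dm M *ᵥ
            fun j => u (gridPoint xL xR M j) (n * timeStep T N + timeStep T N)) i +
          (diffMatrix α xL xR dp dm M *ᵥ
            fun j => u (gridPoint xL xR M j) (n * timeStep T N)) i) /
          (2 * meshSize xL xR M ^ α) -
        f (gridPoint xL xR M i) (n * timeStep T N + timeStep T N / 2)| ≤ C)
    {n : ℕ} (hn : n ≤ N) :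
    Real.sqrt (∑ i, (dp (gridPoint xL xR M i))⁻¹ *
      (u (gridPoint xL xR M i) (n * timeStep T N) - U n i) ^ 2) ≤
      n * timeStep T N * Real.sqrt (M * (δ⁻¹ * C ^ 2)) := by
  set τ := timeStep T N with hτ'
  have hτ : 0 < τ := div_pos hT (by exact_mod_cast hN)
  set h := meshSize xL xR M with hh'
  have hh : 0 < h := div_pos (by linarith) (by exact_mod_cast hM)
  have hdp0 : ∀ x ∈ Icc xL xR, 0 < dp x := fun x hx => hδ.trans_le (hdp x hx).1
  have hD : ∀ i : Fin (M - 1), 0 ≤ (dp (gridPoint xL xR M i))⁻¹ := fun i =>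
    inv_nonneg.2 (hdp0 _ (Ioo_subset_Icc_self (gridPoint_mem hx i))).le
  induction n with
  | zero =>
    have : ∀ i : Fin (M - 1), u (gridPoint xL xR M i) (((0 : ℕ) : ℝ) * τ) - U 0 i = 0 := by
      intro i
      rw [hU.initial, Nat.cast_zero, zero_mul,
        hu.initial _ (Ioo_subset_Icc_self (gridPoint_mem hx i)), sub_self]
    simp only [this]
    simp
  | succ n ih =>
    have hnN : n < N := hn
    have ih := ih hnN.le
    set r : Fin (M - 1) → ℝ := fun i =>
      (u (gridPoint xL xR M i) (n * τ + τ) - u (gridPoint xL xR M i) (n * τ)) / τ -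
        ((diffMatrix α xL xR dp dm M *ᵥ fun j => u (gridPoint xL xR M j) (n * τ + τ)) i +
          (diffMatrix α xL xR dp dm M *ᵥ fun j => u (gridPoint xL xR M j) (n * τ)) i) /
          (2 * h ^ α) - f (gridPoint xL xR M i) (n * τ + τ / 2) with hr
    have hstep := hU.step n hnN
    rw [← hτ', ← hh'] at hstep
    have hcast : ((n + 1 : ℕ) : ℝ) * τ = n * τ + τ := by push_cast; ring
    have key := crankNicolson_step_le (diffMatrix α xL xR dp dm M)
      (fun i => (dp (gridPoint xL xR M i))⁻¹) hD
      (diffMatrix_dissipative h1 h2 hx dp dm hdp0 hcond M) (ν := τ / (2 * h ^ α)) (τ := τ)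
      (by positivity) hτ.le
      (fun i => u (gridPoint xL xR M i) (n * τ) - U n i)
      (fun i => u (gridPoint xL xR M i) (n * τ + τ) - U (n + 1) i) r ?_
    · have hrle : Real.sqrt (∑ i, (dp (gridPoint xL xR M i))⁻¹ * r i ^ 2) ≤
          Real.sqrt (M * (δ⁻¹ * C ^ 2)) := by
        refine Real.sqrt_le_sqrt ?_
        have hb : ∀ i : Fin (M - 1), (dp (gridPoint xL xR M i))⁻¹ * r i ^ 2 ≤ δ⁻¹ * C ^ 2 := by
          intro i
          have hri : |r i| ≤ C := htr i n hnN
          refine mul_le_mul (inv_anti₀ hδ (hdp _ (Ioo_subset_Icc_self (gridPoint_mem hx i))).1)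
            ?_ (sq_nonneg _) (inv_nonneg.2 hδ.le)
          rw [← sq_abs]
          exact pow_le_pow_left₀ (abs_nonneg _) hri 2
        refine (Finset.sum_le_sum fun i _ => hb i).trans ?_
        rw [Finset.sum_const, Finset.card_univ, Fintype.card_fin, nsmul_eq_mul]
        refine mul_le_mul_of_nonneg_right ?_ (by positivity)
        exact_mod_cast Nat.sub_le M 1
      rw [hcast]
      refine key.trans ((add_le_add ih (mul_le_mul_of_nonneg_left hrle hτ.le)).trans
        (le_of_eq ?_))
      ring
    -- The error equation: r is by definition the defect of the exact solution in the scheme divided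
    -- by τ.
    · have e1 : (fun i => u (gridPoint xL xR M i) (n * τ + τ) - U (n + 1) i) =
          (fun i => u (gridPoint xL xR M i) (n * τ + τ)) - U (n + 1) := rfl
      have e0 : (fun i => u (gridPoint xL xR M i) (n * τ) - U n i) =
          (fun i => u (gridPoint xL xR M i) (n * τ)) - U n := rfl
      rw [e1, e0, Matrix.mulVec_sub, Matrix.mulVec_sub, hstep]
      ext i
      simp only [Matrix.sub_mulVec, Matrix.add_mulVec, Matrix.one_mulVec, Matrix.smul_mulVec,
        Pi.sub_apply, Pi.add_apply, Pi.smul_apply, smul_eq_mul, hr]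
      rw [show ((n : ℝ) + 1 / 2) * τ = n * τ + τ / 2 by ring]
      have hha : 0 < h ^ α := Real.rpow_pos_of_pos hh _
      field_simp
      ring

end Convergence

end WSGD

end

theorem theorem4 (α xL xR T : ℝ) (hα1 : 1 < α) (hα2 : α < 2) (hx : xL < xR) (hT : 0 < T)
    (dp dm : ℝ → ℝ) (f : ℝ → ℝ → ℝ) (φ : ℝ → ℝ) (u : ℝ → ℝ → ℝ)
    (δ Δ κmin κmax : ℝ) (hδ : 0 < δ)
    (hdp : ∀ x ∈ Set.Icc xL xR, δ ≤ dp x ∧ dp x ≤ Δ)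
    (hcond : WSGD.RatioCondition α xL xR κmin κmax dp dm)
    (hu : WSGD.IsExactSolution α xL xR T dp dm f φ u)
    (K : ℝ)
    (hspace : ∀ t ∈ Set.Icc 0 T,
      WSGD.SpaceSmooth α K (WSGD.zeroExt xL xR (fun x => u x t)))
    (htime : WSGD.TimeSmooth xL xR T 3 K u)
    (hf : WSGD.TimeSmooth xL xR T 2 K f) :
    ∃ c₂ : ℝ, 0 < c₂ ∧ ∀ M N : ℕ, 0 < M → 0 < N → ∀ U : ℕ → Fin (M - 1) → ℝ,
      WSGD.IsSchemeSolution α xL xR T dp dm f φ M N U →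
      ∀ n ≤ N,
        WSGD.discreteNorm (WSGD.meshSize xL xR M)
            (fun i => u (WSGD.gridPoint xL xR M i) ((n : ℝ) * WSGD.timeStep T N) - U n i) ^ 2 ≤
          c₂ * (WSGD.timeStep T N ^ 2 + WSGD.meshSize xL xR M ^ 2) ^ 2 := by
  -- K bounds an integral of norms, so its sign needs no separate hypothesis.
  have hK : 0 ≤ K := (integral_nonneg fun _ => norm_nonneg _).trans
    (hspace 0 (left_mem_Icc.2 hT.le)).left_fourier_bound
  set B := 3 * K + (1 + κmax) * Δ * ((4 + ∑' k, |WSGD.weight α k|) * K) with hB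
  have hΔ : 0 < Δ := by
    have h := hdp xL (left_mem_Icc.2 hx.le)
    linarith [h.1, h.2]
  have hc0 : 0 ≤ Δ * T ^ 2 * (xR - xL) * (δ⁻¹ * B ^ 2) := by
    have : 0 < xR - xL := sub_pos.2 hx
    positivity
  -- Δ and δ⁻¹ come from passing between the weighted and unweighted norms, T² from nτ ≤ T, and xR -
  -- xL from hM. The 1 keeps the constant positive when B = 0.
  refine ⟨Δ * T ^ 2 * (xR - xL) * (δ⁻¹ * B ^ 2) + 1, by linarith, fun M N hM hN U hU n hn => ?_⟩
  set τ := WSGD.timeStep T N with hτ'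
  set h := WSGD.meshSize xL xR M with hh'
  have hN' : (0 : ℝ) < N := by exact_mod_cast hN
  have hM' : (0 : ℝ) < M := by exact_mod_cast hM
  have hτ : 0 < τ := div_pos hT hN'
  have hh : 0 < h := div_pos (by linarith) hM'
  have hNτ : (N : ℝ) * τ = T := by rw [hτ', WSGD.timeStep]; field_simp
  have hMh : h * (M : ℝ) = xR - xL := by rw [hh', WSGD.meshSize]; field_simp
  have herr := WSGD.error_le hα1 hα2 hx hT hδ hdp hcond hu (C := B * (τ ^ 2 + h ^ 2)) hM hN hU
    (fun i m hm => WSGD.truncation_le hα1 hα2 hx hT hδ hdp hcond hu hspace hK htime hf i hτ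
      (by positivity) (by
        have : ((m : ℝ) + 1) ≤ N := by exact_mod_cast hm
        nlinarith)) hn
  rw [← hτ'] at herr
  set e : Fin (M - 1) → ℝ := fun i => u (WSGD.gridPoint xL xR M i) ((n : ℝ) * τ) - U n i with he
  have hnτ : (n : ℝ) * τ ≤ T := by
    have : (n : ℝ) ≤ N := by exact_mod_cast hn
    rw [← hNτ]
    exact mul_le_mul_of_nonneg_right this hτ.le
  have hS0 : 0 ≤ M * (δ⁻¹ * (B * (τ ^ 2 + h ^ 2)) ^ 2) := by positivity
  have hdp0 : ∀ i : Fin (M - 1), 0 < dp (WSGD.gridPoint xL xR M i) ∧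
      dp (WSGD.gridPoint xL xR M i) ≤ Δ := fun i => by
    have h := hdp _ (Ioo_subset_Icc_self (WSGD.gridPoint_mem hx i))
    exact ⟨hδ.trans_le h.1, h.2⟩
  have hD0 : 0 ≤ ∑ i, (dp (WSGD.gridPoint xL xR M i))⁻¹ * e i ^ 2 :=
    Finset.sum_nonneg fun i _ => mul_nonneg (inv_nonneg.2 (hdp0 i).1.le) (sq_nonneg _)
  have hsq : ∑ i, (dp (WSGD.gridPoint xL xR M i))⁻¹ * e i ^ 2 ≤
      T ^ 2 * (M * (δ⁻¹ * (B * (τ ^ 2 + h ^ 2)) ^ 2)) := by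
    have h3 := herr.trans (mul_le_mul_of_nonneg_right hnτ (Real.sqrt_nonneg _))
    have h4 := pow_le_pow_left₀ (Real.sqrt_nonneg _) h3 2
    rwa [Real.sq_sqrt hD0, mul_pow, Real.sq_sqrt hS0] at h4
  have hsum : ∑ i, e i ^ 2 ≤ Δ * ∑ i, (dp (WSGD.gridPoint xL xR M i))⁻¹ * e i ^ 2 := by
    rw [Finset.mul_sum]
    refine Finset.sum_le_sum fun i _ => ?_
    rw [← mul_assoc]
    refine le_mul_of_one_le_left (sq_nonneg _) ?_
    rw [← div_eq_mul_inv, one_le_div (hdp0 i).1]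
    exact (hdp0 i).2
  have hdot : e ⬝ᵥ e = ∑ i, e i ^ 2 := Finset.sum_congr rfl fun i _ => (sq (e i)).symm
  have he0 : 0 ≤ h * (e ⬝ᵥ e) := by
    rw [hdot]
    exact mul_nonneg hh.le (Finset.sum_nonneg fun i _ => sq_nonneg _)
  rw [WSGD.discreteNorm, Real.sq_sqrt he0, hdot]
  calc h * ∑ i, e i ^ 2
      ≤ h * (Δ * (T ^ 2 * (M * (δ⁻¹ * (B * (τ ^ 2 + h ^ 2)) ^ 2)))) :=
        mul_le_mul_of_nonneg_left (hsum.trans (mul_le_mul_of_nonneg_left hsq hΔ.le)) hh.le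
    _ = Δ * T ^ 2 * (h * M) * (δ⁻¹ * B ^ 2) * (τ ^ 2 + h ^ 2) ^ 2 := by ring
    _ ≤ _ := by
        rw [hMh]
        exact mul_le_mul_of_nonneg_right (by linarith) (sq_nonneg _)
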